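/- A set $\tau\subseteq\mathbb N=\{0,1,2,\dots\}$ is a residue class modulo an integer $m\ge 1$ if $\tau=\{n\in\mathbb N : n\equiv a \pmod m\}$ for some integer $a$. A pair $(\sigma,\rho)$ of residue classes is *easy* if $0\in\rho$, or $\sigma$ is the set of even and $\rho$ the set of odd numbers, or both $\sigma$ and $\rho$ are the set of odd numbers; otherwise it is *difficult*. A $(\sigma,\rho)$-set of a finite simple graph $G$ is a set $S\subseteq V(G)$ with $|N(v)\cap S|\in\sigma$ for all $v\in S$ and $|N(v)\cap S|\in\rho$ for all $v\in V(G)\setminus S$. $(\sigma,\rho)$-DomSet asks whether a given graph has a $(\sigma,\rho)$-set. A graph with relations is a triple $G=(V,E,\mathcal C)$ where $(V,E)$ is a finite simple graph and each $C\in\mathcal C$ consists of a scope $\mathrm{scp}(C)\subseteq V$ and a family $\mathrm{acc}(C)\subseteq 2^{\mathrm{scp}(C)}$; its arity is the maximum of $|\mathrm{scp}(C)|$ over $C\in\mathcal C$. A $(\sigma,\rho)$-set of $G$ is a $(\sigma,\rho)$-set $S$ of $(V,E)$ with $S\cap\mathrm{scp}(C)\in\mathrm{acc}(C)$ for all $C\in\mathcal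 C$, and $(\sigma,\rho)$-DomSet with relations asks whether a given graph with relations has such a set. A path decomposition of a graph with relations is a path decomposition of the graph obtained from $(V,E)$ by making the scope of every relation a clique; the width of a path decomposition is the maximum size of a bag minus one. **Lemma.** Let $\sigma$ and $\rho$ be residue classes modulo the same $m\ge 1$ such that $(\sigma,\rho)$ is difficult. There is a constant $c$ (depending only on $\sigma$ and $\rho$) such that for every constant $d\in\mathbb N$ there is a polynomial-time computable function which maps every graph $G$ with relations of arity at most $d$, given together with a path decomposition of $G$ of some width $\mathrm{pw}$, to a graph $G'$ together with a path decomposition of $G'$ of width at most $\mathrm{pw}+c\cdot 2^d$, such that $G$ has a $(\sigma,\rho)$-set if and only if $G'$ has a $(\sigma,\rho)$-set. -/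

import Mathlib

namespace SigmaRho

/-! ### Residue classes, easy and difficult pairs -/

/-- `τ ⊆ ℕ` is a residue class modulo the positive integer `m`. -/
def IsResidueClass (m : ℕ) (τ : Set ℕ) : Prop :=
  0 < m ∧ ∃ a : ℤ, τ = {n : ℕ | (n : ℤ) ≡ a [ZMOD (m : ℤ)]}

/-- The pair `(σ, ρ)` is easy. -/
def IsEasy (σ ρ : Set ℕ) : Prop :=
  0 ∈ ρ ∨ (σ = {n | Even n} ∧ ρ = {n | Odd n}) ∨ (σ = {n | Odd n} ∧ ρ = {n | Odd n})

/-- The pair `(σ, ρ)` is difficult. -/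
def IsDifficult (σ ρ : Set ℕ) : Prop :=
  ¬ IsEasy σ ρ

/-! ### `(σ, ρ)`-sets and graphs with relations -/

/-- `S` is a `(σ, ρ)`-set of the graph `G`. -/
def IsSigmaRhoSet {V : Type*} (σ ρ : Set ℕ) (G : SimpleGraph V) (S : Finset V) : Prop :=
  (∀ v ∈ S, (G.neighborSet v ∩ (S : Set V)).ncard ∈ σ) ∧
    ∀ v ∉ S, (G.neighborSet v ∩ (S : Set V)).ncard ∈ ρ

/-- A relational constraint: a scope, and the selections within the scope that are accepted. -/
structure RelConstraint (V : Type*) where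
  scope : Finset V
  acc : Finset (Finset V)
  acc_subset : ∀ A ∈ acc, A ⊆ scope

/-- A graph with relations on the vertex set `V`. -/
structure RelGraph (V : Type*) where
  graph : SimpleGraph V
  constraints : Set (RelConstraint V)

/-- Every relation of `G` has arity at most `d`. -/
def RelGraph.ArityLE {V : Type*} (G : RelGraph V) (d : ℕ) : Prop :=
  ∀ C ∈ G.constraints, C.scope.card ≤ d

/-- `S` is a `(σ, ρ)`-set of the graph with relations `G`. -/
def RelGraph.IsSigmaRhoSet {V : Type*} [DecidableEq V] (σ ρ : Set ℕ) (G : RelGraph V)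
    (S : Finset V) : Prop :=
  SigmaRho.IsSigmaRhoSet σ ρ G.graph S ∧ ∀ C ∈ G.constraints, S ∩ C.scope ∈ C.acc

/-- The graph obtained from `G` by making the scope of every relation a clique. -/
def RelGraph.completion {V : Type*} (G : RelGraph V) : SimpleGraph V :=
  G.graph ⊔ SimpleGraph.fromRel fun u v => ∃ C ∈ G.constraints, u ∈ C.scope ∧ v ∈ C.scope

/-! ### Path decompositions -/

/-- The list `bags`, in this order along a path, is a path decomposition of `G`. -/
structure IsPathDecomposition {V : Type*} (G : SimpleGraph V) (bags : List (Finset V)) :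
    Prop where
  nonempty : bags ≠ []
  covers_vertex : ∀ v, ∃ B ∈ bags, v ∈ B
  covers_edge : ∀ u v, G.Adj u v → ∃ B ∈ bags, u ∈ B ∧ v ∈ B
  connected : ∀ (v : V) (i j k : Fin bags.length), i ≤ j → j ≤ k →
    v ∈ bags.get i → v ∈ bags.get k → v ∈ bags.get j

/-- The maximal size of a bag, minus one (so `-1` if all bags are empty). -/
def pathWidth {V : Type*} (bags : List (Finset V)) : ℤ :=
  (((bags.map Finset.card).foldr max 0 : ℕ) : ℤ) - 1

/-! ### Instances as finite data

Vertices are `0, …, n - 1`; edges, relations and bags are given by explicit lists. -/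

/-- The simple graph given by a list of edges. -/
def graphOfEdges {n : ℕ} (edges : List (Fin n × Fin n)) : SimpleGraph (Fin n) :=
  SimpleGraph.fromRel fun u v => (u, v) ∈ edges

/-- The data of a relational constraint: the scope is listed without repetition, the accepted
selections are listed without repetition, each of them in the order of the scope. -/
structure ConstraintData (n : ℕ) where
  scope : List (Fin n)
  scope_nodup : scope.Nodup
  acc : List (List (Fin n))
  acc_nodup : acc.Nodup
  acc_sublist : ∀ A ∈ acc, A.Sublist scope

/-- The relational constraint described by the data. -/
def ConstraintData.toRelConstraint {n : ℕ} (c : ConstraintData n) : RelConstraint (Fin n) where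
  scope := c.scope.toFinset
  acc := (c.acc.map List.toFinset).toFinset
  acc_subset := by
    intro A hA
    simp only [List.mem_toFinset, List.mem_map] at hA
    obtain ⟨l, hl, rfl⟩ := hA
    intro v hv
    rw [List.mem_toFinset] at hv ⊢
    exact (c.acc_sublist l hl).subset hv

/-- The graph with relations described by a list of edges and a list of constraints. -/
def relGraphOf {n : ℕ} (edges : List (Fin n × Fin n)) (rels : List (ConstraintData n)) :
    RelGraph (Fin n) where
  graph := graphOfEdges edges
  constraints := {C | ∃ c ∈ rels, C = c.toRelConstraint}

/-- An instance of `(σ, ρ)`-DomSet with relations, given with a path decomposition. -/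
structure RelInstance where
  n : ℕ
  edges : List (Fin n × Fin n)
  rels : List (ConstraintData n)
  bags : List (List (Fin n))
  isPathDecomposition :
    IsPathDecomposition (relGraphOf edges rels).completion (bags.map List.toFinset)

/-- The graph with relations of an instance. -/
def RelInstance.relGraph (I : RelInstance) : RelGraph (Fin I.n) :=
  relGraphOf I.edges I.rels

/-- The width of the given path decomposition. -/
def RelInstance.width (I : RelInstance) : ℤ :=
  pathWidth (I.bags.map List.toFinset)

/-- `I` is a yes-instance of `(σ, ρ)`-DomSet with relations. -/
def RelInstance.IsYes (σ ρ : Set ℕ) (I : RelInstance) : Prop :=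
  ∃ S : Finset (Fin I.n), I.relGraph.IsSigmaRhoSet σ ρ S

/-- An instance of `(σ, ρ)`-DomSet, given with a path decomposition. -/
structure PlainInstance where
  n : ℕ
  edges : List (Fin n × Fin n)
  bags : List (List (Fin n))
  isPathDecomposition : IsPathDecomposition (graphOfEdges edges) (bags.map List.toFinset)

/-- The graph of an instance. -/
def PlainInstance.graph (I : PlainInstance) : SimpleGraph (Fin I.n) :=
  graphOfEdges I.edges

/-- The width of the given path decomposition. -/
def PlainInstance.width (I : PlainInstance) : ℤ :=
  pathWidth (I.bags.map List.toFinset)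

/-- `I` is a yes-instance of `(σ, ρ)`-DomSet. -/
def PlainInstance.IsYes (σ ρ : Set ℕ) (I : PlainInstance) : Prop :=
  ∃ S : Finset (Fin I.n), IsSigmaRhoSet σ ρ I.graph S

/-! ### Encoding of instances as strings

Numbers are written in unary, which is polynomially equivalent to binary here because all of them
are at most the number of vertices. -/

/-- The tape alphabet. -/
inductive Sym : Type
  | tick
  | mark
  | cons
  | nil

/-- Unary encoding of a number, with an end marker. -/
def encodeNat (k : ℕ) : List Sym :=
  List.replicate k Sym.tick ++ [Sym.mark]

/-- Encoding of a list: each entry is preceded by `cons`, and `nil` marks the end. -/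
def encodeList {α : Type*} (enc : α → List Sym) (l : List α) : List Sym :=
  l.flatMap (fun x => Sym.cons :: enc x) ++ [Sym.nil]

def encodeVertex {n : ℕ} (v : Fin n) : List Sym :=
  encodeNat v.val

def encodeEdge {n : ℕ} (e : Fin n × Fin n) : List Sym :=
  encodeVertex e.1 ++ encodeVertex e.2

def encodeConstraint {n : ℕ} (c : ConstraintData n) : List Sym :=
  encodeList encodeVertex c.scope ++ encodeList (encodeList encodeVertex) c.acc

def RelInstance.encode (I : RelInstance) : List Sym :=
  encodeNat I.n ++ encodeList encodeEdge I.edges ++ encodeList encodeConstraint I.rels ++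
    encodeList (encodeList encodeVertex) I.bags

def PlainInstance.encode (I : PlainInstance) : List Sym :=
  encodeNat I.n ++ encodeList encodeEdge I.edges ++ encodeList (encodeList encodeVertex) I.bags

/-- Instances with relations of arity at most `d`. -/
abbrev RelInstanceOfArity (d : ℕ) : Type :=
  {I : RelInstance // I.relGraph.ArityLE d}

/-- The function `f` from instances with relations of arity at most `d` to plain instances is
computed by a Turing machine in time polynomial in the length of the encoded input. -/
def IsPolyTime {d : ℕ} (f : RelInstanceOfArity d → PlainInstance) : Prop :=
  Nonempty (Turing.TM2ComputableInPolyTime (fun I : RelInstanceOfArity d => I.1.encode)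
    PlainInstance.encode f)

end SigmaRho

/-!
# Removing relations from `(σ, ρ)`-DomSet

Identify a selection of vertices with a vector of zeros and ones over `ZMod m`. If `σ` and `ρ` are
the residue classes of `s` and `r`, then with `t = r - s` being a `(σ, ρ)`-set is the linear system
"at each vertex, the number of selected neighbours plus `t` times the vertex itself is `r`". For a
difficult pair `m ≥ 3` and `r ≠ 0` (`IsDifficult.zmod`). Each relation of arity at most `d` is
replaced by a gadget, a graph on `O(2 ^ d)` new vertices some of which are joined to the scope. The
gadget admits a solution exactly if the selection on the scope is accepted, and always contributes
`0` modulo `m` to the vertices of the scope, so that it does not disturb the rest of the graph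
(`Realizes`).

**Gadgets.** The main device is a class of `m` twins: vertices with the same neighbours apart from
each other. Subtracting the equations of two twins shows that they are equal in every solution, so a
class contributes `0` modulo `m` to each common neighbour, while the equations at the twins
constrain that neighbourhood. If the class has the value `w`, its equation reads "sum over the
neighbours plus `e w` equals `r`", where `e` is `t` for false twins and `t - 1` for true twins;
since `m ≥ 3`, one of them satisfies `2 e ≠ 0`. Two classes with the same variables, whose
right-hand sides are `c` and `c + e`, force the sum of the variables to be `c`: it is
one of `c`, `c - e` by the first class, one of `c`, `c + e` by the second, and `2 e ≠ 0`. Constants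
are supplied by copies of a graph with a vertex that is selected in all solutions
(`exists_constant_graph`), free variables by copies of a graph with a vertex that is selected in
some solutions only (`exists_free_graph`). Hence every linear system with coefficients `0` and `1`
in the scope and in free Boolean variables is realized (`realizes_gadget`). A relation is
expressed by such a system by following the selection down the complete binary tree of depth `d`
and excluding the rejected leaves (`tree_system_solvable_iff`). There are `O(2 ^ d)` variables and
equations, as many as nodes of the tree up to a constant factor; each of them takes a constant
number of vertices, so the gadget is linear in `2 ^ d`.

**Path decomposition.** A scope is a clique, so by the Helly property of intervals some bag contains
it (`exists_common_bag`). The vertices of the gadget are put into a copy of the *first* such bag,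
inserted behind it. This first bag is always one of the original bags, since an enlarged bag comes
behind an original bag with the same original vertices. So no bag is enlarged twice, and the width
grows by at most the size of one gadget (`RawState.ReducesFrom`).

**Running time.** The machine is written in a small structured language for stack machines
(`Prog`), which is compiled to Turing machines with several stacks
(`Prog.nonempty_computableInPolyTime`). As `d` is fixed, the finite memory can hold the relation and
the gadgets are stored in the program; the program only reads a constraint, searches
the bags for its scope, and emits the edges and the new bag (`Prog.runs_processRel`). All words
that occur stay polynomially bounded because no bag is enlarged twice (`Prog.runs_reduction`).
-/

namespace SigmaRho

/-! ### Domination modulo `m` as a linear system over `ZMod m` -/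

/-- The value in `ZMod m` of a Boolean, the number of selected vertices at a single place. -/
def ind (m : ℕ) (b : Bool) : ZMod m := if b then 1 else 0

@[simp] theorem ind_true (m : ℕ) : ind m true = 1 := rfl

@[simp] theorem ind_false (m : ℕ) : ind m false = 0 := rfl

/-- The selection `x` of vertices solves the domination equations of the graph `adj`: at every
vertex the number of selected neighbours plus `t` times the vertex itself is `r`. For `t = r - s`
this says that selected vertices see `s` and the others `r` selected vertices, modulo `m`. -/
def Solves {m : ℕ} (t r : ZMod m) {V : Type} [Fintype V] (adj : V → V → Bool) (x : V → Bool) :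
    Prop :=
  ∀ v, ∑ u, ind m (adj v u && x u) + t * ind m (x v) = r

theorem sum_ind_const_true {m : ℕ} {V : Type} [Fintype V] :
    ∑ _u : V, ind m true = (Fintype.card V : ZMod m) := by
  simp

theorem sum_ind_ne {m : ℕ} {V : Type} [Fintype V] [DecidableEq V] (x : V → Bool) (v : V) :
    ∑ u, ind m (decide (v ≠ u) && x u) = ∑ u, ind m (x u) - ind m (x v) := by
  rw [eq_sub_iff_add_eq, ← Finset.sum_erase_add _ (fun u => ind m (decide (v ≠ u) && x u))
    (Finset.mem_univ v), ← Finset.sum_erase_add _ (fun u => ind m (x u)) (Finset.mem_univ v)]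
  simp only [ne_eq, not_true_eq_false, decide_false, Bool.false_and, ind_false, add_zero]
  congr 1
  refine Finset.sum_congr rfl fun u hu => ?_
  simp [(Finset.ne_of_mem_erase hu).symm]

theorem ind_cancel {m : ℕ} {a : ZMod m} (ha : a ≠ 0) {b c : Bool}
    (h : a * ind m b = a * ind m c) : b = c := by
  cases b <;> cases c <;> simp_all

/-- There is a graph with a vertex which is selected in every solution. If true twins are equal
(`t ≠ 1`) or `s = 0`, the complete graph on `s + 1` vertices will do; otherwise false twins are
equal, and the complete bipartite graph with `s` vertices on each side will do. -/
theorem exists_constant_graph {m : ℕ} (hm : 3 ≤ m) (s r : ZMod m) (hr : r ≠ 0) :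
    ∃ (C : Type) (_ : Fintype C) (adj : C → C → Bool) (c₀ : C),
      (∀ u v, adj u v = adj v u) ∧ (∀ u, adj u u = false) ∧
        (∃ x, Solves (r - s) r adj x) ∧ ∀ x, Solves (r - s) r adj x → x c₀ = true := by
  have : NeZero m := ⟨by lia⟩
  have : Fact (1 < m) := ⟨by lia⟩
  by_cases hts : r - s ≠ 1 ∨ s = 0
  · refine ⟨Fin (s.val + 1), inferInstance, fun u v => decide (u ≠ v), 0, ?_, ?_, ?_, ?_⟩
    · intro u v; simp [eq_comm]
    · simp
    · refine ⟨fun _ => true, fun v => ?_⟩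
      rw [sum_ind_ne, sum_ind_const_true]
      simp
    · intro x hx
      have key : ∀ v, ∑ u, ind m (x u) + (r - s - 1) * ind m (x v) = r := by
        intro v
        have := hx v
        rw [sum_ind_ne] at this
        linear_combination this
      by_contra h0
      rw [Bool.not_eq_true] at h0
      have hall : ∀ v, x v = false := by
        intro v
        rcases hts with hts | hts
        · refine (ind_cancel (sub_ne_zero.2 hts) ?_).trans h0
          exact add_left_cancel ((key v).trans (key 0).symm)
        · subst hts
          have : v = 0 := by
            have := v.2
            simp only [ZMod.val_zero] at this
            ext
            simpa using this
          rw [this, h0]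
      apply hr
      rw [← key 0]
      simp [hall]
  · push Not at hts
    obtain ⟨ht, hs⟩ := hts
    have hpos : 0 < s.val := Nat.pos_of_ne_zero (by simpa using hs)
    refine ⟨Bool × Fin s.val, inferInstance, fun u v => u.1 != v.1, (false, ⟨0, hpos⟩),
      ?_, ?_, ?_, ?_⟩
    · rintro ⟨u, _⟩ ⟨v, _⟩; cases u <;> cases v <;> rfl
    · simp
    · refine ⟨fun _ => true, ?_⟩
      rintro ⟨b, i⟩
      rw [Fintype.sum_prod_type]
      cases b <;> simp
    · intro x hx
      rw [ht] at hx
      have h1 := fun i => hx (false, i)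
      have h2 := fun i => hx (true, i)
      simp only [Fintype.sum_prod_type, Fintype.sum_bool, bne_self_eq_false, Bool.false_and,
        ind_false, Finset.sum_const_zero, add_zero, zero_add, one_mul, Bool.bne_true,
        Bool.not_false, Bool.true_and, Bool.bne_false] at h1 h2
      have hrs : r = s + 1 := by rw [← ht]; ring
      by_contra h0
      rw [Bool.not_eq_true] at h0
      have h1all : ∀ i, x (false, i) = false := by
        intro i
        refine (ind_cancel (m := m) one_ne_zero ?_).trans h0
        rw [one_mul, one_mul]
        exact add_left_cancel ((h1 i).trans (h1 _).symm)
      have h2all : ∀ i, ind m (x (true, i)) = r := by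
        intro i
        have := h2 i
        simpa [h1all] using this
      cases h3 : x (true, ⟨0, hpos⟩)
      · have := h2all ⟨0, hpos⟩
        rw [h3] at this
        exact hr this.symm
      · have h4 := h2all ⟨0, hpos⟩
        rw [h3, ind_true] at h4
        rw [← h4] at hrs
        exact hs (by simpa using hrs)

/-- There is a graph with a vertex which is selected in some solution and not in another one: two
copies of a graph, each of which is `s`-regular and sends `r` edges from each vertex to the other
copy, so that either copy is a solution. -/
theorem exists_free_graph {m : ℕ} (hm : 3 ≤ m) (s r : ZMod m) (hr : r ≠ 0) :
    ∃ (F : Type) (_ : Fintype F) (adj : F → F → Bool) (p₀ : F),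
      (∀ u v, adj u v = adj v u) ∧ (∀ u, adj u u = false) ∧
        ∀ b, ∃ x, Solves (r - s) r adj x ∧ x p₀ = b := by
  have : NeZero m := ⟨by lia⟩
  have hpos : 0 < r.val := Nat.pos_of_ne_zero (by simpa using hr)
  refine ⟨Bool × Fin (s.val + 1) × Fin r.val, inferInstance,
    fun u v => if u.1 = v.1 then decide (u.2.2 = v.2.2) && decide (u.2.1 ≠ v.2.1)
      else decide (u.2.1 = v.2.1), (true, 0, ⟨0, hpos⟩), ?_, ?_, ?_⟩
  · rintro ⟨u, a, b⟩ ⟨v, a', b'⟩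
    simp only [eq_comm, ne_eq]
  · simp
  · intro i
    refine ⟨fun v => v.1 == i, ?_, by simp⟩
    rintro ⟨j, a, b⟩
    simp only [Fintype.sum_prod_type, Fintype.sum_bool]
    have e1 : ∑ a', ∑ b' : Fin r.val, ind m (decide (b = b') && decide (a ≠ a')) = s := by
      have : ∀ a', ∑ b' : Fin r.val, ind m (decide (b = b') && decide (a ≠ a')) =
          ind m (decide (a ≠ a') && true) := by
        intro a'
        rw [Finset.sum_eq_single b]
        · simp
        · intro b' _ hb'
          simp [hb'.symm]
        · simp
      simp only [this]
      rw [sum_ind_ne, sum_ind_const_true]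
      simp
    have e2 : ∑ a', ∑ _b' : Fin r.val, ind m (decide (a = a')) = r := by
      rw [Finset.sum_eq_single a]
      · simp
      · intro a' _ ha'
        simp [ha'.symm]
      · simp
    simp only [ne_eq, decide_not] at e1
    cases i <;> cases j <;> simp <;> first | exact e2 | rw [e1, add_sub_cancel]

/-! ### Realizing linear equations -/

/-- The selection `z` of the vertices of the gadget solves the domination equations at these
vertices, when the selection of the `d` vertices to which the gadget is attached is `x`. -/
def Extends {m d : ℕ} (t r : ZMod m) {W : Type} [Fintype W] (adj : W → W → Bool)
    (att : Fin d → W → Bool) (x : Fin d → Bool) (z : W → Bool) : Prop :=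
  ∀ w, ∑ w', ind m (adj w w' && z w') + ∑ i, ind m (att i w && x i) + t * ind m (z w) = r

/-- The graph `adj`, attached to `d` further vertices by the edges `att`, realizes the relation `T`
on these vertices, and always contributes `0` to the number of their selected neighbours. -/
structure Realizes {m d : ℕ} (t r : ZMod m) {W : Type} [Fintype W] (adj : W → W → Bool)
    (att : Fin d → W → Bool) (T : Set (Fin d → Bool)) : Prop where
  symm : ∀ u v, adj u v = adj v u
  irrefl : ∀ u, adj u u = false
  contribution : ∀ x z, Extends t r adj att x z → ∀ i, ∑ w, ind m (att i w && z w) = 0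
  exists_iff : ∀ x, (∃ z, Extends t r adj att x z) ↔ x ∈ T

theorem Realizes.equiv {m d : ℕ} {t r : ZMod m} {W W' : Type} [Fintype W] [Fintype W']
    {adj : W → W → Bool} {att : Fin d → W → Bool} {T : Set (Fin d → Bool)}
    (h : Realizes t r adj att T) (φ : W' ≃ W) :
    Realizes t r (fun u v => adj (φ u) (φ v)) (fun i w => att i (φ w)) T := by
  have key : ∀ x z, Extends t r (fun u v => adj (φ u) (φ v)) (fun i w => att i (φ w)) x (z ∘ φ) ↔
      Extends t r adj att x z := by
    intro x z
    rw [Extends, Extends, ← φ.forall_congr_right]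
    refine forall_congr' fun w => ?_
    rw [← φ.sum_comp]
    rfl
  refine ⟨fun _ _ => h.symm _ _, fun _ => h.irrefl _, fun x z hz i => ?_, fun x => ?_⟩
  · rw [← h.contribution x (z ∘ φ.symm) ((key _ _).1 (by simpa [Function.comp_assoc] using hz)) i,
      ← φ.sum_comp]
    simp
  · rw [← h.exists_iff x]
    constructor
    · rintro ⟨z, hz⟩
      exact ⟨z ∘ φ.symm, (key _ _).1 (by simpa [Function.comp_assoc] using hz)⟩
    · rintro ⟨z, hz⟩
      exact ⟨z ∘ φ, (key _ _).2 hz⟩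

section Gadget

variable {P Q F C : Type} {m d : ℕ}

/-- The vertices of the gadget for a system of linear equations: a copy of the graph `F` for each
variable, `m` copies of the graph `C`, and for each equation two classes of `m` twins. -/
abbrev GadgetVertex (P Q F C : Type) (m : ℕ) : Type :=
  (P × F) ⊕ (Fin m × C) ⊕ (Q × Bool × Fin m)

variable [DecidableEq P] [DecidableEq Q] [DecidableEq F] [DecidableEq C]

/-- The edges of the gadget. The twins of the equation `q` are adjacent to the vertices `p₀` of the
variables of the equation and, for the class `δ`, to `K q δ` many vertices `c₀`; the twins of
a class are adjacent to each other if `twin` holds. -/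
def gadgetAdj (adjF : F → F → Bool) (adjC : C → C → Bool) (p₀ : F) (c₀ : C) (twin : Bool)
    (A : Q → Finset (P ⊕ Fin d)) (K : Q → Bool → ℕ) :
    GadgetVertex P Q F C m → GadgetVertex P Q F C m → Bool
  | .inl (p, f), .inl (p', f') => decide (p = p') && adjF f f'
  | .inl (p, f), .inr (.inr (q, _, _)) => decide (f = p₀) && decide (.inl p ∈ A q)
  | .inr (.inr (q, _, _)), .inl (p, f) => decide (f = p₀) && decide (.inl p ∈ A q)
  | .inr (.inl (k, c)), .inr (.inl (k', c')) => decide (k = k') && adjC c c'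
  | .inr (.inl (k, c)), .inr (.inr (q, δ, _)) => decide (c = c₀) && decide (k.val < K q δ)
  | .inr (.inr (q, δ, _)), .inr (.inl (k, c)) => decide (c = c₀) && decide (k.val < K q δ)
  | .inr (.inr (q, δ, i)), .inr (.inr (q', δ', i')) =>
    twin && (decide (q = q') && (decide (δ = δ') && decide (i ≠ i')))
  | .inl _, .inr (.inl _) => false
  | .inr (.inl _), .inl _ => false

/-- The edges between the gadget and the vertices to which it is attached. -/
def gadgetAtt (A : Q → Finset (P ⊕ Fin d)) (i : Fin d) : GadgetVertex P Q F C m → Bool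
  | .inr (.inr (q, _, _)) => decide (.inr i ∈ A q)
  | _ => false

theorem sum_ind_twins (b : Bool) {w : Fin m → Bool} (h : ∀ i j, w i = w j) :
    ∑ i, ind m (b && w i) = 0 := by
  rcases Nat.eq_zero_or_pos m with rfl | hm
  · simp
  · simp [fun i => h i ⟨0, hm⟩]

theorem sum_ind_lt [NeZero m] (a : ZMod m) : ∑ k : Fin m, ind m (decide (k.val < a.val)) = a := by
  rw [Fin.sum_univ_eq_sum_range (fun k => ind m (decide (k < a.val)))]
  have : ∀ k, ind m (decide (k < a.val)) = if k ∈ Finset.range a.val then 1 else 0 := by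
    intro k
    simp [ind]
  simp_rw [this, Finset.sum_ite_mem, Finset.inter_eq_right.2
    (Finset.range_subset_range.2 a.val_lt.le)]
  simp

variable [Fintype P] [Fintype Q] [Fintype F] [Fintype C]

theorem sum_ind_decide_eq {V W : Type} [Fintype V] [DecidableEq V] [Fintype W] (v : V)
    (f : V → W → Bool) :
    ∑ u, ∑ w, ind m (decide (v = u) && f u w) = ∑ w, ind m (f v w) := by
  rw [Finset.sum_eq_single v]
  · simp
  · intro u _ hu
    simp [hu.symm]
  · simp

theorem sum_ind_decide_eq' {V W : Type} [Fintype V] [DecidableEq V] [Fintype W] (v : V)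
    (f : W → V → Bool) :
    ∑ w, ∑ u, ind m (decide (u = v) && f w u) = ∑ w, ind m (f w v) := by
  refine Finset.sum_congr rfl fun w _ => ?_
  rw [Finset.sum_eq_single v]
  · simp
  · intro u _ hu
    simp [hu]
  · simp

theorem sum_ind_class (q : Q) (δ : Bool) (i : Fin m) (w : Q → Bool → Fin m → Bool) :
    ∑ q', ∑ δ', ∑ i', ind m (decide (q = q') &&
      (decide (δ = δ') && (decide (i ≠ i') && w q' δ' i'))) =
        ∑ i', ind m (w q δ i') - ind m (w q δ i) := by
  rw [← sum_ind_ne, Finset.sum_eq_single q, Finset.sum_eq_single δ]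
  · simp
  · intro δ' _ hδ'
    simp [hδ'.symm]
  · simp
  · intro q' _ hq'
    simp [hq'.symm]
  · simp

/-- Any system of linear equations with coefficients `0` and `1` in `d` given and further free
Boolean variables is realized by a gadget. The twins of a class are equal, so they contribute
`0` modulo `m` to every neighbour. Hence the copies of `F` and `C` do not notice them, and the
equation at a twin `w` in the class `δ` says that the sum over `A q` plus `e w` is `c q + δ e`. The
two classes together say that the sum is `c q`, since `2 e ≠ 0`. -/
theorem realizes_gadget {m d : ℕ} [NeZero m] {t r e : ZMod m} {twin : Bool}
    (he : e = if twin then t - 1 else t) (he2 : 2 * e ≠ 0)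
    {adjF : F → F → Bool} {p₀ : F} (hFs : ∀ u v, adjF u v = adjF v u) (hFi : ∀ u, adjF u u = false)
    (hF : ∀ b, ∃ x, Solves t r adjF x ∧ x p₀ = b)
    {adjC : C → C → Bool} {c₀ : C} (hCs : ∀ u v, adjC u v = adjC v u)
    (hCi : ∀ u, adjC u u = false)
    (hC : ∃ x, Solves t r adjC x) (hC' : ∀ x, Solves t r adjC x → x c₀ = true)
    (A : Q → Finset (P ⊕ Fin d)) (c : Q → ZMod m) :
    Realizes t r (gadgetAdj (m := m) adjF adjC p₀ c₀ twin A fun q δ => (r - c q - ind m δ * e).val)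
      (gadgetAtt A)
      {x | ∃ y : P → Bool, ∀ q, ∑ a ∈ A q, ind m (Sum.elim y x a) = c q} := by
  have he0 : e ≠ 0 := by rintro rfl; simp at he2
  set adj := gadgetAdj (m := m) adjF adjC p₀ c₀ twin A fun q δ => (r - c q - ind m δ * e).val
    with hadj
  set att : Fin d → GadgetVertex P Q F C m → Bool := gadgetAtt A with hatt
  -- The sum over `A q` splits into the free and the given variables.
  have hsplit : ∀ (y : P → Bool) (x : Fin d → Bool) q, ∑ a ∈ A q, ind m (Sum.elim y x a) =
      ∑ p, ind m (decide (.inl p ∈ A q) && y p) + ∑ i, ind m (decide (.inr i ∈ A q) && x i) := by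
    intro y x q
    have : ∀ a, ind m (decide (a ∈ A q) && Sum.elim y x a) =
        if a ∈ A q then ind m (Sum.elim y x a) else 0 := by
      intro a
      by_cases h : a ∈ A q <;> simp [h]
    conv_lhs => rw [← Finset.univ_inter (A q)]
    rw [← Finset.sum_ite_mem, ← Finset.sum_congr rfl fun a _ => this a, Fintype.sum_sum_type]
    rfl
  have twins : ∀ x z, Extends t r adj att x z →
      ∀ q δ i j, z (.inr (.inr (q, δ, i))) = z (.inr (.inr (q, δ, j))) := by
    intro x z hz q δ i j
    have h := (hz (.inr (.inr (q, δ, i)))).trans (hz (.inr (.inr (q, δ, j)))).symm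
    simp only [hadj, hatt, gadgetAdj, gadgetAtt, Fintype.sum_sum_type, Fintype.sum_prod_type] at h
    refine ind_cancel he0 ?_
    cases twin
    · simp only [Bool.false_and, ind_false, Finset.sum_const_zero] at h
      simpa [he] using h
    · simp only [Bool.true_and, Bool.and_assoc] at h
      rw [sum_ind_class q δ i fun q δ i => z (.inr (.inr (q, δ, i))),
        sum_ind_class q δ j fun q δ i => z (.inr (.inr (q, δ, i)))] at h
      simp only [he, if_true]
      linear_combination h
  -- The equations at the three kinds of vertices, once twins are known to be equal.
  have rowF : ∀ (x : Fin d → Bool) (z : GadgetVertex P Q F C m → Bool),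
       (∀ q δ i j, z (.inr (.inr (q, δ, i))) = z (.inr (.inr (q, δ, j)))) →
      ∀ p f, ∑ w', ind m (adj (.inl (p, f)) w' && z w') +
        ∑ i, ind m (att i (.inl (p, f)) && x i) =
          ∑ f', ind m (adjF f f' && z (.inl (p, f'))) := by
    intro x z hz p f
    simp only [hadj, hatt, gadgetAdj, gadgetAtt, Fintype.sum_sum_type, Fintype.sum_prod_type,
      Bool.and_assoc]
    rw [sum_ind_decide_eq p]
    have h0 := fun b q δ => sum_ind_twins b (hz q δ)
    simp only [← Bool.and_assoc, Fintype.sum_bool, Bool.false_and, ind_false,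
      Finset.sum_const_zero, add_zero, zero_add]
    refine add_eq_left.2 (Finset.sum_eq_zero fun q _ => ?_)
    exact (congrArg₂ (· + ·) (h0 (decide (f = p₀) && decide (.inl p ∈ A q)) q true)
      (h0 (decide (f = p₀) && decide (.inl p ∈ A q)) q false)).trans (add_zero 0)
  have rowC : ∀ (x : Fin d → Bool) (z : GadgetVertex P Q F C m → Bool),
       (∀ q δ i j, z (.inr (.inr (q, δ, i))) = z (.inr (.inr (q, δ, j)))) →
      ∀ k a, ∑ w', ind m (adj (.inr (.inl (k, a))) w' && z w') +
        ∑ i, ind m (att i (.inr (.inl (k, a))) && x i) =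
          ∑ f', ind m (adjC a f' && z (.inr (.inl (k, f')))) := by
    intro x z hz k a
    simp only [hadj, hatt, gadgetAdj, gadgetAtt, Fintype.sum_sum_type, Fintype.sum_prod_type,
      Bool.and_assoc]
    rw [sum_ind_decide_eq k]
    have h0 := fun b q δ => sum_ind_twins b (hz q δ)
    simp [← Bool.and_assoc, h0]
  have rowQ : ∀ (x : Fin d → Bool) (z : GadgetVertex P Q F C m → Bool),
       (∀ q δ i j, z (.inr (.inr (q, δ, i))) = z (.inr (.inr (q, δ, j)))) →
      (∀ k, z (.inr (.inl (k, c₀))) = true) →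
      ∀ q δ i, ∑ w', ind m (adj (.inr (.inr (q, δ, i))) w' && z w') +
        ∑ j, ind m (att j (.inr (.inr (q, δ, i))) && x j) +
          t * ind m (z (.inr (.inr (q, δ, i)))) =
          ∑ a ∈ A q, ind m (Sum.elim (fun p => z (.inl (p, p₀))) x a) + (r - c q - ind m δ * e) +
            e * ind m (z (.inr (.inr (q, δ, i)))) := by
    intro x z hz hc q δ i
    simp only [hadj, hatt, gadgetAdj, gadgetAtt, Fintype.sum_sum_type, Fintype.sum_prod_type,
      Bool.and_assoc]
    rw [sum_ind_decide_eq' p₀ (fun p f => decide (.inl p ∈ A q) && z (.inl (p, f))),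
      sum_ind_decide_eq' c₀ (fun (k : Fin m) c' =>
        decide (k.val < (r - c q - ind m δ * e).val) && z (.inr (.inl (k, c')))), hsplit]
    simp only [hc, Bool.and_true, sum_ind_lt]
    cases twin
    · simp only [he, Bool.false_and, ind_false, Finset.sum_const_zero]
      simp
      ring
    · have h0 := sum_ind_twins true (hz q δ)
      simp only [Bool.true_and] at h0 ⊢
      rw [sum_ind_class q δ i fun q δ i => z (.inr (.inr (q, δ, i))), h0]
      simp only [he, if_true]
      ring
  refine ⟨?_, ?_, ?_, ?_⟩
  · rintro (⟨p, f⟩ | ⟨k, a⟩ | ⟨q, δ, i⟩) (⟨p', f'⟩ | ⟨k', a'⟩ | ⟨q', δ', i'⟩) <;>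
      simp only [hadj, gadgetAdj]
    · rw [hFs f f']; simp [eq_comm]
    · rw [hCs a a']; simp [eq_comm]
    · simp [eq_comm]
  · rintro (⟨p, f⟩ | ⟨k, a⟩ | ⟨q, δ, i⟩) <;> simp [hadj, gadgetAdj, hFi, hCi]
  · intro x z hz i
    have h0 := fun b q δ => sum_ind_twins b (twins x z hz q δ)
    simp only [hatt, gadgetAtt, Fintype.sum_sum_type, Fintype.sum_prod_type, Fintype.sum_bool,
      Bool.false_and, ind_false, Finset.sum_const_zero, zero_add]
    refine Finset.sum_eq_zero fun q _ => ?_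
    exact (congrArg₂ (· + ·) (h0 (decide (.inr i ∈ A q)) q true)
      (h0 (decide (.inr i ∈ A q)) q false)).trans (add_zero 0)
  · intro x
    constructor
    · rintro ⟨z, hz⟩
      have htw := twins x z hz
      have hc : ∀ k, z (.inr (.inl (k, c₀))) = true := by
        intro k
        refine hC' (fun a => z (.inr (.inl (k, a)))) fun a => ?_
        rw [← rowC x z htw]
        exact hz _
      refine ⟨fun p => z (.inl (p, p₀)), fun q => ?_⟩
      have h0 := hz (.inr (.inr (q, false, 0)))
      have h1 := hz (.inr (.inr (q, true, 0)))
      rw [rowQ x z htw hc] at h0 h1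
      simp only [ind_false, ind_true] at h0 h1
      cases h2 : z (.inr (.inr (q, false, 0)))
      · rw [h2, ind_false] at h0
        linear_combination h0
      · cases h3 : z (.inr (.inr (q, true, 0)))
        · rw [h2, ind_true] at h0
          rw [h3, ind_false] at h1
          exact absurd (by linear_combination h0 - h1) he2
        · rw [h3, ind_true] at h1
          linear_combination h1
    · rintro ⟨y, hy⟩
      choose xF hxF hxF' using hF
      obtain ⟨xC, hxC⟩ := hC
      let z : GadgetVertex P Q F C m → Bool
        | .inl (p, f) => xF (y p) f
        | .inr (.inl (_, a)) => xC a
        | .inr (.inr (_, δ, _)) => δ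
      have htw : ∀ q δ i j, z (.inr (.inr (q, δ, i))) = z (.inr (.inr (q, δ, j))) :=
        fun _ _ _ _ => rfl
      refine ⟨z, ?_⟩
      rintro (⟨p, f⟩ | ⟨k, a⟩ | ⟨q, δ, i⟩)
      · rw [rowF x z htw]
        exact hxF _ _
      · rw [rowC x z htw]
        exact hxC _
      · rw [rowQ x z htw fun _ => hC' xC hxC]
        have : (fun p => z (.inl (p, p₀))) = y := funext fun p => hxF' _
        rw [this, hy]
        cases δ <;> simp [z] <;> ring

end Gadget

end SigmaRho

namespace SigmaRho

/-! ### Realizing relations -/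

/-- The nodes of the complete binary tree of depth `d`: Boolean strings of length at most `d`. -/
abbrev TreeNode (d : ℕ) : Type := Σ j : Fin (d + 1), (Fin j → Bool)

/-- The nodes of the complete binary tree of depth `d` other than its root; a string of length
`j + 1` comes with the number `j`. -/
abbrev TreeEdge (d : ℕ) : Type := Σ j : Fin d, (Fin (j + 1) → Bool)

/-- The upper end of an edge of the tree. -/
def TreeEdge.parent {d : ℕ} (E : TreeEdge d) : TreeNode d :=
  ⟨E.1.castSucc, fun i => E.2 (Fin.castSucc i)⟩

/-- The lower end of an edge of the tree. -/
def TreeEdge.child {d : ℕ} (E : TreeEdge d) : TreeNode d :=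
  ⟨E.1.succ, E.2⟩

/-- The node of the tree is an initial segment of `x`. -/
def TreeNode.Agrees {d : ℕ} (N : TreeNode d) (x : Fin d → Bool) : Prop :=
  ∀ i : Fin N.1, N.2 i = x (i.castLE (Nat.lt_succ_iff.1 N.1.2))

theorem TreeEdge.child_agrees {d : ℕ} (E : TreeEdge d) (x : Fin d → Bool) :
    E.child.Agrees x ↔ E.parent.Agrees x ∧ E.2 (Fin.last _) = x E.1 :=
  Fin.forall_fin_succ' (P := fun i : Fin (E.1 + 1) => E.2 i = x (i.castLE E.1.2))

/-- The free variables of the linear system for a relation on `d` variables: the negations of the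
given variables, variables saying that a node of the tree is, or is not, an initial segment of the
given vector, and a slack variable for each edge of the tree. -/
abbrev TreeVar (d : ℕ) : Type := Fin d ⊕ TreeNode d ⊕ TreeNode d ⊕ TreeEdge d

/-- The equations of the linear system for a relation on `d` variables. -/
abbrev TreeEqn (d : ℕ) : Type := Fin d ⊕ TreeNode d ⊕ Unit ⊕ TreeEdge d ⊕ (Fin d → Bool)

/-- The variables in the equations of the linear system for the relation `T`. The equation of an
edge has slack for every choice of its literals but the one in which the given vector follows the
edge from a node said to be an initial segment to a node said not to be one. -/
noncomputable def treeSupport {d : ℕ} (T : Set (Fin d → Bool)) :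
    TreeEqn d → Finset (TreeVar d ⊕ Fin d) :=
  open Classical in fun
  | .inl i => {.inl (.inl i), .inr i}
  | .inr (.inl N) => {.inl (.inr (.inl N)), .inl (.inr (.inr (.inl N)))}
  | .inr (.inr (.inl _)) => {.inl (.inr (.inl ⟨0, Fin.elim0⟩))}
  | .inr (.inr (.inr (.inl E))) =>
    {.inl (.inr (.inl E.parent)), if E.2 (Fin.last _) then .inr E.1 else .inl (.inl E.1),
      .inl (.inr (.inr (.inl E.child))), .inl (.inr (.inr (.inr E)))}
  | .inr (.inr (.inr (.inr B))) =>
    if B ∈ T then ∅ else {.inl (.inr (.inr (.inl ⟨Fin.last d, B⟩)))}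

/-- The right-hand sides of the linear system for the relation `T`. -/
noncomputable def treeRhs {m d : ℕ} (T : Set (Fin d → Bool)) : TreeEqn d → ZMod m :=
  open Classical in fun
  | .inr (.inr (.inr (.inl _))) => 2
  | .inr (.inr (.inr (.inr B))) => if B ∈ T then 0 else 1
  | _ => 1

theorem two_ne_zero_zmod {m : ℕ} (hm : 3 ≤ m) : (2 : ZMod m) ≠ 0 := by
  intro h
  have : ((2 : ℕ) : ZMod m) = 0 := by exact_mod_cast h
  rw [ZMod.natCast_eq_zero_iff] at this
  exact absurd (Nat.le_of_dvd (by lia) this) (by lia)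

/-- The linear system for the relation `T` is solvable exactly for the vectors in `T`: the nodes
on the path of the given vector have to be labelled as initial segments, and the leaf at the end of
the path may be labelled so only if it is in `T`. -/
theorem tree_system_solvable_iff {m d : ℕ} (hm : 3 ≤ m) (T : Set (Fin d → Bool))
    (x : Fin d → Bool) :
    (∃ y : TreeVar d → Bool,
      ∀ q, ∑ a ∈ treeSupport T q, ind m (Sum.elim y x a) = treeRhs T q) ↔ x ∈ T := by
  classical
  have : Fact (1 < m) := ⟨by lia⟩
  have two := two_ne_zero_zmod hm
  have compl : ∀ a b : Bool, ind m a + ind m b = 1 ↔ b = !a := by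
    intro a b
    cases a <;> cases b <;> simp
  have edge : ∀ a l c f : Bool, ind m a + (ind m l + (ind m (!c) + ind m f)) = 2 →
      a = true → l = true → c = true := by
    intro a l c f h ha hl
    by_contra hc
    rw [Bool.not_eq_true] at hc
    subst ha hl hc
    cases f
    · refine one_ne_zero (α := ZMod m) ?_
      simp only [ind_true, ind_false, Bool.not_false] at h
      linear_combination h
    · refine two ?_
      simp only [ind_true, Bool.not_false] at h
      linear_combination h
  -- The equation of an edge, written out.
  have sumE : ∀ (y : TreeVar d → Bool) (E : TreeEdge d), (∀ i, y (.inl i) = !(x i)) →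
      ∑ a ∈ treeSupport T (.inr (.inr (.inr (.inl E)))), ind m (Sum.elim y x a) =
        ind m (y (.inr (.inl E.parent))) + (ind m (x E.1 == E.2 (Fin.last _)) +
          (ind m (y (.inr (.inr (.inl E.child)))) + ind m (y (.inr (.inr (.inr E)))))) := by
    intro y E hy
    cases hE : E.2 (Fin.last _) <;> simp [treeSupport, hE, hy]
  constructor
  · rintro ⟨y, hy⟩
    have hneg : ∀ i, y (.inl i) = !(x i) := by
      intro i
      have := hy (.inl i)
      simp only [treeSupport, treeRhs] at this
      rw [Finset.sum_pair (by simp), add_comm] at this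
      exact (compl _ _).1 this
    have hcpl : ∀ N, y (.inr (.inr (.inl N))) = !(y (.inr (.inl N))) := by
      intro N
      have := hy (.inr (.inl N))
      simp only [treeSupport, treeRhs] at this
      rw [Finset.sum_pair (by simp)] at this
      exact (compl _ _).1 this
    have hpath : ∀ j (hj : j < d + 1),
        y (.inr (.inl ⟨⟨j, hj⟩, fun i => x (i.castLE (Nat.lt_succ_iff.1 hj))⟩)) = true := by
      intro j
      induction j with
      | zero =>
        intro hj
        have := hy (.inr (.inr (.inl ())))
        simp only [treeSupport, treeRhs, Finset.sum_singleton, Sum.elim_inl] at this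
        have e : (fun i : Fin 0 => x (i.castLE (Nat.lt_succ_iff.1 hj))) = Fin.elim0 :=
          Subsingleton.elim _ _
        by_contra h
        rw [Bool.not_eq_true] at h
        erw [e] at h
        erw [h] at this
        simp at this
      | succ j ih =>
        intro hj
        have h1 := hy (.inr (.inr (.inr (.inl
          ⟨⟨j, Nat.succ_lt_succ_iff.1 hj⟩, fun i => x (i.castLE (Nat.lt_succ_iff.1 hj))⟩))))
        rw [sumE _ _ hneg, hcpl] at h1
        exact edge _ _ _ _ h1 (ih (by lia)) (by simp; rfl)
    by_contra hx
    have h1 := hy (.inr (.inr (.inr (.inr x))))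
    simp only [treeSupport, treeRhs, hx, if_false, Finset.sum_singleton, Sum.elim_inl, hcpl] at h1
    have h2 : y (.inr (.inl ⟨Fin.last d, x⟩)) = true := hpath d (by lia)
    rw [h2] at h1
    simp at h1
  · intro hx
    let y : TreeVar d → Bool
      | .inl i => !(x i)
      | .inr (.inl N) => decide (N.Agrees x)
      | .inr (.inr (.inl N)) => !decide (N.Agrees x)
      | .inr (.inr (.inr E)) => !decide (E.parent.Agrees x) && !(x E.1 == E.2 (Fin.last _))
    refine ⟨y, ?_⟩
    rintro (i | N | ⟨⟩ | E | B)
    · simp only [treeSupport, treeRhs]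
      rw [Finset.sum_pair (by simp), add_comm]
      exact (compl _ _).2 rfl
    · simp only [treeSupport, treeRhs]
      rw [Finset.sum_pair (by simp)]
      exact (compl _ _).2 rfl
    · have : TreeNode.Agrees ⟨0, Fin.elim0⟩ x := fun i => i.elim0
      simp [treeSupport, treeRhs, y, this]
    · rw [sumE y E fun _ => rfl]
      have e : decide (E.child.Agrees x) =
          (decide (E.parent.Agrees x) && (x E.1 == E.2 (Fin.last _))) := by
        rw [Bool.eq_iff_iff, Bool.and_eq_true, decide_eq_true_iff, decide_eq_true_iff, beq_iff_eq,
          TreeEdge.child_agrees, eq_comm (a := x E.1)]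
      simp only [y, e, treeRhs]
      cases decide (E.parent.Agrees x) <;> cases (x E.1 == E.2 (Fin.last _)) <;> norm_num
    · by_cases hB : B ∈ T
      · simp [treeSupport, treeRhs, hB]
      · have : ¬ TreeNode.Agrees ⟨Fin.last d, B⟩ x := by
          intro h
          exact hB ((funext h : B = x) ▸ hx)
        simp [treeSupport, treeRhs, hB, y, this]

theorem card_treeNode (d : ℕ) : Fintype.card (TreeNode d) ≤ 2 * 2 ^ d := by
  simp only [Fintype.card_sigma, Fintype.card_pi, Fintype.card_bool, Finset.prod_const,
    Finset.card_univ, Fintype.card_fin]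
  rw [Fin.sum_univ_eq_sum_range (fun j => 2 ^ j) (d + 1)]
  have := Nat.geomSum_eq (le_refl 2) (d + 1)
  simp at this
  rw [this, pow_succ]
  lia

theorem card_treeEdge (d : ℕ) : Fintype.card (TreeEdge d) ≤ 2 * 2 ^ d := by
  refine (Fintype.card_le_of_injective TreeEdge.child ?_).trans (card_treeNode d)
  rintro ⟨j, B⟩ ⟨j', B'⟩ h
  simp only [TreeEdge.child, Sigma.mk.injEq, Fin.succ_inj] at h
  obtain ⟨rfl, h⟩ := h
  rw [eq_of_heq h]

/-- Every relation on `d` vertices is realized by a gadget whose size depends on `d` only and is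
linear in `2 ^ d`. -/
theorem exists_relation_gadget {m : ℕ} (hm : 3 ≤ m) (s r : ZMod m) (hr : r ≠ 0) :
    ∃ c : ℕ, ∀ d, ∃ g ≤ c * 2 ^ d, ∀ T : Set (Fin d → Bool),
      ∃ (adj : Fin g → Fin g → Bool) (att : Fin d → Fin g → Bool),
        Realizes (r - s) r adj att T := by
  classical
  have : NeZero m := ⟨by lia⟩
  have two := two_ne_zero_zmod hm
  obtain ⟨C, _, adjC, c₀, hCs, hCi, hC, hC'⟩ := exists_constant_graph hm s r hr
  obtain ⟨F, _, adjF, p₀, hFs, hFi, hF⟩ := exists_free_graph hm s r hr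
  -- True twins are used only if `2 t = 0`; then `2 (t - 1) = -2`.
  obtain ⟨twin, e, he, he2⟩ : ∃ (twin : Bool) (e : ZMod m),
      e = (if twin then r - s - 1 else r - s) ∧ 2 * e ≠ 0 := by
    by_cases h : 2 * (r - s) = 0
    · refine ⟨true, _, rfl, fun h' => two ?_⟩
      simp only [if_true] at h'
      linear_combination h - h'
    · exact ⟨false, _, rfl, h⟩
  refine ⟨7 * Fintype.card F + m * Fintype.card C + 7 * (2 * m), fun d => ?_⟩
  refine ⟨Fintype.card (GadgetVertex (TreeVar d) (TreeEqn d) F C m), ?_, fun T => ?_⟩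
  · have h1 := card_treeNode d
    have h2 := card_treeEdge d
    have h3 : d < 2 ^ d := Nat.lt_two_pow_self
    have hP : Fintype.card (TreeVar d) ≤ 7 * 2 ^ d := by
      simp only [TreeVar, Fintype.card_sum, Fintype.card_fin]
      lia
    have hQ : Fintype.card (TreeEqn d) ≤ 7 * 2 ^ d := by
      have h4 : Fintype.card (Fin d → Bool) = 2 ^ d := by simp
      simp only [TreeEqn, Fintype.card_sum, Fintype.card_fin, h4, Fintype.card_unit]
      lia
    have h5 : Fintype.card (GadgetVertex (TreeVar d) (TreeEqn d) F C m) =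
        Fintype.card (TreeVar d) * Fintype.card F +
          (m * Fintype.card C + Fintype.card (TreeEqn d) * (2 * m)) := by
      simp only [GadgetVertex, Fintype.card_sum, Fintype.card_prod, Fintype.card_fin,
        Fintype.card_bool]
    rw [h5]
    calc _ ≤ 7 * 2 ^ d * Fintype.card F + (m * Fintype.card C * 2 ^ d + 7 * 2 ^ d * (2 * m)) := by
          exact Nat.add_le_add (by gcongr) (Nat.add_le_add
            (Nat.le_mul_of_pos_right _ (by positivity)) (by gcongr))
      _ = _ := by ring
  · have h := realizes_gadget he he2 hFs hFi hF hCs hCi hC hC' (treeSupport T) (treeRhs T)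
    simp only [tree_system_solvable_iff hm, Set.ofPred_mem_eq] at h
    exact ⟨_, _, h.equiv (Fintype.equivFin _).symm⟩

end SigmaRho

namespace SigmaRho

/-! ### Replacing a relation by a gadget -/

/-- Membership in the graph on `ℕ` given by a list of edges. -/
def natAdj (E : List (ℕ × ℕ)) (u v : ℕ) : Bool :=
  decide (u ≠ v) && (decide ((u, v) ∈ E) || decide ((v, u) ∈ E))

theorem natAdj_comm (E : List (ℕ × ℕ)) (u v : ℕ) : natAdj E u v = natAdj E v u := by
  rw [natAdj, natAdj, Bool.or_comm]
  simp only [ne_comm]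

/-- A relational constraint on natural numbers: the scope and the list of accepted selections. -/
abbrev RawConstraint : Type := List ℕ × List (List ℕ)

/-- The restriction of the selection `p` to the first `d` positions of the list `scope`; missing
positions count as not selected. -/
def selMask (d : ℕ) (scope : List ℕ) (p : ℕ → Bool) : Fin d → Bool :=
  fun i => (scope[i.val]?).any p

/-- The relation on the positions of the scope that is described by the accepted selections. -/
def accTable (d : ℕ) (c : RawConstraint) : Finset (Fin d → Bool) :=
  (c.2.map fun A => selMask d c.1 (fun v => decide (v ∈ A))).toFinset

/-- For each relation on `d` positions a graph with `g` vertices attached to these positions. -/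
structure GadgetFamily (d g : ℕ) where
  adj : Finset (Fin d → Bool) → Fin g → Fin g → Bool
  att : Finset (Fin d → Bool) → Fin d → Fin g → Bool

/-- The edges of the gadget for the relation `T` on a scope of length `l`; the first end of an edge
is a position of the scope or a vertex of the gadget, the second end is a vertex of the gadget. -/
def GadgetFamily.code {d g : ℕ} (G : GadgetFamily d g) (T : Finset (Fin d → Bool)) (l : ℕ) :
    List ((Fin d ⊕ Fin g) × Fin g) :=
  (((List.finRange g).product (List.finRange g)).filter fun e => G.adj T e.1 e.2).map
      (fun e => (.inr e.1, e.2)) ++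
    (((List.finRange d).product (List.finRange g)).filter fun e =>
      decide (e.1.val < l) && G.att T e.1 e.2).map (fun e => (.inl e.1, e.2))

/-- The number of a vertex, when the vertices of the gadget are numbered from `n` on. -/
def nodeNum {d g : ℕ} (n : ℕ) (scope : List ℕ) : Fin d ⊕ Fin g → ℕ
  | .inl i => scope.getD i 0
  | .inr j => n + j

/-- The edges of the gadget for the constraint `c`, with the vertices numbered from `n` on. -/
def GadgetFamily.edges {d g : ℕ} (G : GadgetFamily d g) (n : ℕ) (c : RawConstraint) :
    List (ℕ × ℕ) :=
  (G.code (accTable d c) c.1.length).map fun e => (nodeNum n c.1 e.1, n + e.2)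

/-- The constraint is meaningful for graphs on `0, …, n - 1`, and has arity at most `d`. -/
structure RawConstraint.Valid (d n : ℕ) (c : RawConstraint) : Prop where
  nodup : c.1.Nodup
  lt : ∀ v ∈ c.1, v < n
  length_le : c.1.length ≤ d

/-- The selection `x` satisfies the domination equations of the graph with edges `E` on
`0, …, n - 1` and the constraints `R`. -/
def IsRawSolution {m : ℕ} (t r : ZMod m) (n : ℕ) (E : List (ℕ × ℕ)) (R : List RawConstraint)
    (x : ℕ → Bool) : Prop :=
  (∀ v < n, ∑ u ∈ Finset.range n, ind m (natAdj E v u && x u) + t * ind m (x v) = r) ∧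
    ∀ c ∈ R, ∃ A ∈ c.2, ∀ v ∈ c.1, x v = decide (v ∈ A)

section Step

variable {d g n : ℕ} (G : GadgetFamily d g) {c : RawConstraint} {E : List (ℕ × ℕ)}

theorem mem_gadget_edges {p : ℕ × ℕ} : p ∈ G.edges n c ↔
    (∃ i j, G.adj (accTable d c) i j = true ∧ p = (n + i.val, n + j.val)) ∨
      ∃ (i : Fin d) (j : Fin g), G.att (accTable d c) i j = true ∧
        ∃ v, c.1[i.val]? = some v ∧ p = (v, n + j.val) := by
  simp only [GadgetFamily.edges, GadgetFamily.code, List.map_append, List.map_map,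
    List.mem_append, List.mem_map, List.mem_filter, List.pair_mem_product, List.mem_finRange,
    Prod.exists, true_and, Bool.and_eq_true, decide_eq_true_eq, Function.comp_apply, nodeNum,
    true_and]
  refine or_congr (by simp only [eq_comm]) ?_
  refine exists_congr fun i => exists_congr fun j => ?_
  constructor
  · rintro ⟨⟨hi, ha⟩, rfl⟩
    exact ⟨ha, c.1[i.val], by simp [hi], by simp [hi]⟩
  · rintro ⟨ha, v, hv, rfl⟩
    obtain ⟨hi, rfl⟩ := List.getElem?_eq_some_iff.1 hv
    exact ⟨⟨hi, ha⟩, by simp [hi]⟩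

theorem accTable_iff (x : ℕ → Bool) (hc : c.1.length ≤ d) :
    selMask d c.1 x ∈ accTable d c ↔ ∃ A ∈ c.2, ∀ v ∈ c.1, x v = decide (v ∈ A) := by
  simp only [accTable, List.mem_toFinset, List.mem_map]
  refine exists_congr fun A => and_congr_right fun _ => ?_
  constructor
  · intro h v hv
    obtain ⟨i, hi, rfl⟩ := List.getElem_of_mem hv
    have := congrFun h ⟨i, by lia⟩
    simpa [selMask, hi, eq_comm] using this
  · intro h
    funext i
    by_cases hi : i.val < c.1.length
    · simp [selMask, hi, h]
    · simp [selMask, hi]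

theorem natAdj_append_old {u v : ℕ} (hu : u < n) (hv : v < n) :
    natAdj (E ++ G.edges n c) u v = natAdj E u v := by
  have : ∀ u v, v < n → (u, v) ∉ G.edges n c := by
    intro u v hv h
    rw [mem_gadget_edges] at h
    rcases h with ⟨i, j, _, h⟩ | ⟨i, j, _, w, _, h⟩
    · rw [Prod.mk.injEq] at h; lia
    · rw [Prod.mk.injEq] at h; lia
  simp [natAdj, this u v hv, this v u hu]

theorem natAdj_append_mixed (hE : ∀ e ∈ E, e.1 < n ∧ e.2 < n) {u : ℕ}
    (hu : u < n) (j : Fin g) :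
    natAdj (E ++ G.edges n c) u (n + j) =
      decide (∃ i : Fin d, c.1[i.val]? = some u ∧ G.att (accTable d c) i j = true) := by
  have h1 : (u, n + j.val) ∉ E := fun h => by have := (hE _ h).2; simp at this
  have h2 : (n + j.val, u) ∉ E := fun h => by have := (hE _ h).1; simp at this
  have h3 : (n + j.val, u) ∉ G.edges n c := by
    rw [mem_gadget_edges]
    rintro (⟨i, j, _, h⟩ | ⟨i, j, _, w, _, h⟩)
    · rw [Prod.mk.injEq] at h; lia
    · rw [Prod.mk.injEq] at h; lia
  have h4 : (u, n + j.val) ∈ G.edges n c ↔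
      ∃ i : Fin d, c.1[i.val]? = some u ∧ G.att (accTable d c) i j = true := by
    rw [mem_gadget_edges]
    constructor
    · rintro (⟨i, j', _, h⟩ | ⟨i, j', h0, w, h1, h⟩)
      · rw [Prod.mk.injEq] at h; lia
      · rw [Prod.mk.injEq] at h
        obtain rfl : j = j' := Fin.ext (by lia)
        exact ⟨i, h.1 ▸ h1, h0⟩
    · rintro ⟨i, hi, ha⟩
      exact .inr ⟨i, j, ha, u, hi, rfl⟩
  have h5 : u ≠ n + j := by lia
  simp [natAdj, h1, h2, h3, h4, h5]

theorem natAdj_append_new (hE : ∀ e ∈ E, e.1 < n ∧ e.2 < n) (hc : c.Valid d n)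
    (hs : ∀ i j, G.adj (accTable d c) i j = G.adj (accTable d c) j i)
    (hi : ∀ i, G.adj (accTable d c) i i = false) (i j : Fin g) :
    natAdj (E ++ G.edges n c) (n + i) (n + j) = G.adj (accTable d c) i j := by
  have h1 : ∀ i j : Fin g, (n + i.val, n + j.val) ∉ E := fun i j h => by
    have := (hE _ h).2; simp at this
  have h4 : ∀ i j : Fin g, (n + i.val, n + j.val) ∈ G.edges n c ↔
      G.adj (accTable d c) i j = true := by
    intro i j
    rw [mem_gadget_edges]
    constructor
    · rintro (⟨i', j', h0, h⟩ | ⟨i', j', h0, w, h1, h⟩)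
      · rw [Prod.mk.injEq] at h
        obtain rfl : i = i' := Fin.ext (by lia)
        obtain rfl : j = j' := Fin.ext (by lia)
        exact h0
      · rw [Prod.mk.injEq] at h
        have := hc.lt _ (List.mem_of_getElem? h1)
        lia
    · exact fun h => .inl ⟨i, j, h, rfl⟩
  simp only [natAdj, List.mem_append, h1, false_or, h4, hs j i, Bool.or_self, Bool.decide_eq_true]
  by_cases h : i = j
  · simp [h, hi]
  · have : i.val ≠ j.val := fun h' => h (Fin.ext h')
    simp [this]

/-- Splitting an adjacency to the scope according to the position in the scope. -/
theorem ind_exists_eq_sum {m : ℕ} (hc : c.1.Nodup) (u : ℕ) (a : Fin d → Bool) (b : Bool) :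
    ind m (decide (∃ i : Fin d, c.1[i.val]? = some u ∧ a i = true) && b) =
      ∑ i : Fin d, ind m (decide (c.1[i.val]? = some u) && (a i && b)) := by
  by_cases h : ∃ i : Fin d, c.1[i.val]? = some u
  · obtain ⟨i, hi⟩ := h
    have huniq : ∀ k : Fin d, c.1[k.val]? = some u → k = i := by
      intro k hk
      obtain ⟨h1, h2⟩ := List.getElem?_eq_some_iff.1 hk
      obtain ⟨h3, h4⟩ := List.getElem?_eq_some_iff.1 hi
      exact Fin.ext ((hc.getElem_inj_iff).1 (h2.trans h4.symm))
    rw [Finset.sum_eq_single i]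
    · have : (∃ i : Fin d, c.1[i.val]? = some u ∧ a i = true) ↔ a i = true := by
        constructor
        · rintro ⟨k, hk, ha⟩
          exact huniq k hk ▸ ha
        · exact fun ha => ⟨i, hi, ha⟩
      simp [this, hi]
    · intro k _ hk
      have : ¬ c.1[k.val]? = some u := fun h => hk (huniq k h)
      simp [this]
    · simp
  · have h' : ∀ i : Fin d, ¬ c.1[i.val]? = some u := fun i hi => h ⟨i, hi⟩
    simp [h']

theorem sum_scope_adj {m : ℕ} (hE : ∀ e ∈ E, e.1 < n ∧ e.2 < n) (hc : c.Valid d n)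
    (x : ℕ → Bool) (j : Fin g) :
    ∑ u ∈ Finset.range n, ind m (natAdj (E ++ G.edges n c) (n + j) u && x u) =
      ∑ i, ind m (G.att (accTable d c) i j && selMask d c.1 x i) := by
  have h1 : ∀ u ∈ Finset.range n, ind m (natAdj (E ++ G.edges n c) (n + j) u && x u) =
      ∑ i : Fin d, ind m (decide (c.1[i.val]? = some u) &&
        (G.att (accTable d c) i j && x u)) := by
    intro u hu
    rw [natAdj_comm, natAdj_append_mixed G hE (Finset.mem_range.1 hu),
      ind_exists_eq_sum hc.nodup u fun i => G.att (accTable d c) i j]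
  rw [Finset.sum_congr rfl h1, Finset.sum_comm]
  refine Finset.sum_congr rfl fun i _ => ?_
  cases hi : c.1[i.val]? with
  | none => simp [selMask, hi]
  | some v =>
    have hv : v < n := hc.lt v (List.mem_of_getElem? hi)
    rw [Finset.sum_eq_single v]
    · simp [selMask, hi]
    · intro u _ hu
      simp [hu.symm]
    · simp [hv]

theorem sum_gadget_adj {m : ℕ} (hE : ∀ e ∈ E, e.1 < n ∧ e.2 < n) (hc : c.Valid d n)
    {z : Fin g → Bool} (hz : ∀ i, ∑ w, ind m (G.att (accTable d c) i w && z w) = 0)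
    {v : ℕ} (hv : v < n) :
    ∑ j : Fin g, ind m (natAdj (E ++ G.edges n c) v (n + j) && z j) = 0 := by
  have h1 : ∀ j : Fin g, ind m (natAdj (E ++ G.edges n c) v (n + j) && z j) =
      ∑ i : Fin d, ind m (decide (c.1[i.val]? = some v) &&
        (G.att (accTable d c) i j && z j)) := by
    intro j
    rw [natAdj_append_mixed G hE hv,
      ind_exists_eq_sum hc.nodup v fun i => G.att (accTable d c) i j]
  simp only [h1]
  rw [Finset.sum_comm]
  refine Finset.sum_eq_zero fun i _ => ?_
  by_cases hi : c.1[i.val]? = some v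
  · simpa [hi] using hz i
  · simp [hi]

/-- Replacing a constraint by its gadget does not change solvability. -/
theorem exists_rawSolution_step {m : ℕ} {t r : ZMod m}
    (hG : ∀ T, Realizes t r (G.adj T) (G.att T) T) {R : List RawConstraint}
    (hE : ∀ e ∈ E, e.1 < n ∧ e.2 < n) (hc : c.Valid d n) (hR : ∀ c ∈ R, ∀ v ∈ c.1, v < n) :
    (∃ x, IsRawSolution t r n E (c :: R) x) ↔
      ∃ x, IsRawSolution t r (n + g) (E ++ G.edges n c) R x := by
  have hT := hG (accTable d c)
  have rowOld : ∀ x : ℕ → Bool,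
      (∀ i, ∑ w : Fin g, ind m (G.att (accTable d c) i w && x (n + w)) = 0) → ∀ v < n,
      ∑ u ∈ Finset.range (n + g), ind m (natAdj (E ++ G.edges n c) v u && x u) =
        ∑ u ∈ Finset.range n, ind m (natAdj E v u && x u) := by
    intro x hx v hv
    rw [Finset.sum_range_add, ← Fin.sum_univ_eq_sum_range
      (fun j => ind m (natAdj (E ++ G.edges n c) v (n + j) && x (n + j))),
      sum_gadget_adj G hE hc (z := fun j => x (n + j)) hx hv, add_zero]
    refine Finset.sum_congr rfl fun u hu => ?_
    rw [natAdj_append_old G hv (Finset.mem_range.1 hu)]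
  have rowNew : ∀ (x : ℕ → Bool) (j : Fin g),
      ∑ u ∈ Finset.range (n + g), ind m (natAdj (E ++ G.edges n c) (n + j) u && x u) =
        ∑ k, ind m (G.adj (accTable d c) j k && x (n + k)) +
          ∑ i, ind m (G.att (accTable d c) i j && selMask d c.1 x i) := by
    intro x j
    rw [Finset.sum_range_add, ← Fin.sum_univ_eq_sum_range
      (fun k => ind m (natAdj (E ++ G.edges n c) (n + j) (n + k) && x (n + k))),
      sum_scope_adj G hE hc, add_comm]
    simp only [natAdj_append_new G hE hc hT.symm hT.irrefl]
  constructor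
  · rintro ⟨x, hx, hxR⟩
    obtain ⟨z, hz⟩ := (hT.exists_iff (selMask d c.1 x)).2
      ((accTable_iff x hc.length_le).2 (hxR c (by simp)))
    let x' : ℕ → Bool := fun v =>
      if v < n then x v else if h : v - n < g then z ⟨v - n, h⟩ else false
    have hlt : ∀ v < n, x' v = x v := fun v hv => by simp [x', hv]
    have hge : ∀ j : Fin g, x' (n + j) = z j := fun j => by simp [x']
    have hmask : selMask d c.1 x' = selMask d c.1 x := by
      funext i
      cases hi : c.1[i.val]? with
      | none => simp [selMask, hi]
      | some v => simp [selMask, hi, hlt v (hc.lt v (List.mem_of_getElem? hi))]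
    refine ⟨x', fun v hv => ?_, fun c' hc' => ?_⟩
    · by_cases hvn : v < n
      · rw [rowOld x' (by simpa [hge] using hT.contribution _ z hz) v hvn, hlt v hvn, ← hx v hvn]
        congr 1
        refine Finset.sum_congr rfl fun u hu => ?_
        rw [hlt u (Finset.mem_range.1 hu)]
      · obtain ⟨j, rfl⟩ : ∃ j : Fin g, v = n + j := ⟨⟨v - n, by lia⟩, by simp; lia⟩
        rw [rowNew, hmask]
        simpa [hge] using hz j
    · obtain ⟨A, hA, h⟩ := hxR c' (by simp [hc'])
      exact ⟨A, hA, fun v hv => (hlt v (hR c' hc' v hv)).trans (h v hv)⟩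
  · rintro ⟨x, hx, hxR⟩
    have hz : Extends t r (G.adj (accTable d c)) (G.att (accTable d c)) (selMask d c.1 x)
        (fun j => x (n + j)) := by
      intro j
      rw [← hx (n + j) (by lia), rowNew]
    refine ⟨x, fun v hv => ?_, fun c' hc' => ?_⟩
    · rw [← hx v (by lia), rowOld x (hT.contribution _ _ hz) v hv]
    · rcases List.mem_cons.1 hc' with rfl | hc'
      · exact (accTable_iff x hc.length_le).1 ((hT.exists_iff _).1 ⟨_, hz⟩)
      · exact hxR c' hc'

end Step

end SigmaRho

namespace SigmaRho

/-! ### The reduction on lists of natural numbers -/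

/-- Inserts, after the first bag which satisfies `p`, a copy of this bag enlarged by `new`. -/
def insertBag (p : List ℕ → Bool) (new : List ℕ) : List (List ℕ) → List (List ℕ)
  | [] => []
  | B :: L => if p B then B :: (B ++ new) :: L else B :: insertBag p new L

theorem insertBag_eq {p : List ℕ → Bool} (new : List ℕ) {L : List (List ℕ)}
    (h : ∃ B ∈ L, p B = true) :
    ∃ pre B suf, L = pre ++ B :: suf ∧ p B = true ∧ (∀ D ∈ pre, p D = false) ∧
      insertBag p new L = pre ++ B :: (B ++ new) :: suf := by
  induction L with
  | nil => simp at h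
  | cons D L ih =>
    by_cases hD : p D = true
    · exact ⟨[], D, L, rfl, hD, by simp, by simp [insertBag, hD]⟩
    · obtain ⟨pre, B, suf, rfl, hB, hpre, h'⟩ := ih (by simpa [hD] using h)
      exact ⟨D :: pre, B, suf, rfl, hB, by simpa [hD] using hpre, by simp [insertBag, hD, h']⟩

/-- A graph on `0, …, n - 1` with a list of bags. -/
structure RawState where
  n : ℕ
  edges : List (ℕ × ℕ)
  bags : List (List ℕ)

/-- Whether a bag contains the scope of a constraint. -/
def scopeIn (c : RawConstraint) (B : List ℕ) : Bool := decide (∀ v ∈ c.1, v ∈ B)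

/-- Replaces one constraint by its gadget: the vertices of the gadget get the next free numbers,
and are put into a copy of the first bag that contains the scope. -/
def GadgetFamily.step {d g : ℕ} (G : GadgetFamily d g) (S : RawState) (c : RawConstraint) :
    RawState where
  n := S.n + g
  edges := S.edges ++ G.edges S.n c
  bags := insertBag (scopeIn c) (List.range' S.n g) S.bags

/-- The vertex `v` is in the bag at position `i`. -/
def InBag (bags : List (List ℕ)) (v i : ℕ) : Prop := ∃ B, bags[i]? = some B ∧ v ∈ B

/-- The bags that contain a vertex are consecutive. -/
def Consecutive (bags : List (List ℕ)) : Prop :=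
  ∀ v i j k, i ≤ j → j ≤ k → InBag bags v i → InBag bags v k → InBag bags v j

/-- The part of being a path decomposition of a graph that concerns the numbers `0, …, n - 1` as
vertices, the edges and the bags. -/
structure RawState.Decomposed (S : RawState) : Prop where
  edge_lt : ∀ e ∈ S.edges, e.1 < S.n ∧ e.2 < S.n
  bag_lt : ∀ B ∈ S.bags, ∀ v ∈ B, v < S.n
  ne_nil : S.bags ≠ []
  covers_vertex : ∀ v < S.n, ∃ B ∈ S.bags, v ∈ B
  covers_edge : ∀ e ∈ S.edges, ∃ B ∈ S.bags, e.1 ∈ B ∧ e.2 ∈ B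
  consecutive : Consecutive S.bags

/-- The invariant of the reduction from the instance `S₀`. By `origin`, the first bag that contains
a set of original vertices is an original bag. Thus a bag is enlarged at most once. -/
structure RawState.ReducesFrom (g : ℕ) (S₀ S : RawState) : Prop where
  decomposed : S.Decomposed
  le : S₀.n ≤ S.n
  subset : ∀ B ∈ S₀.bags, B ∈ S.bags
  origin : ∀ (i : ℕ) (B : List ℕ), S.bags[i]? = some B →
    ∃ j ≤ i, ∃ B₀, S.bags[j]? = some B₀ ∧ B₀ ∈ S₀.bags ∧ ∀ v ∈ B, v < S₀.n → v ∈ B₀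
  shape : ∀ B ∈ S.bags, ∃ B₀ ∈ S₀.bags, ∃ new, B = B₀ ++ new ∧ new.length ≤ g

theorem RawState.Decomposed.reducesFrom_self {S : RawState} (h : S.Decomposed) (g : ℕ) :
    S.ReducesFrom g S where
  decomposed := h
  le := le_rfl
  subset := fun _ => id
  origin := fun i B hB => ⟨i, le_rfl, B, hB, List.mem_of_getElem? hB, fun _ hv _ => hv⟩
  shape := fun B hB => ⟨B, hB, [], by simp⟩

theorem getElem?_insert {pre suf : List (List ℕ)} {B new : List ℕ} (i : ℕ) :
    (pre ++ B :: (B ++ new) :: suf)[i]? = if i ≤ pre.length then (pre ++ B :: suf)[i]? else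
      if i = pre.length + 1 then some (B ++ new) else (pre ++ B :: suf)[i - 1]? := by
  rcases lt_trichotomy i (pre.length + 1) with h | rfl | h
  · rw [if_pos (by lia)]
    rcases Nat.lt_succ_iff_lt_or_eq.1 h with h | rfl
    · rw [List.getElem?_append_left h, List.getElem?_append_left h]
    · simp
  · simp
  · obtain ⟨k, rfl⟩ : ∃ k, i = pre.length + (k + 2) := ⟨i - pre.length - 2, by lia⟩
    rw [if_neg (by lia), if_neg (by lia), List.getElem?_append_right (by lia),
      List.getElem?_append_right (by lia), show pre.length + (k + 2) - pre.length = k + 2 by lia,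
      show pre.length + (k + 2) - 1 - pre.length = k + 1 by lia]
    rfl

/-- The bags of the new list that contain an old vertex, in terms of the bags of the old list. -/
theorem inBag_insert_iff {pre suf : List (List ℕ)} {B new : List ℕ} {v : ℕ} (hv : v ∉ new)
    (i : ℕ) : InBag (pre ++ B :: (B ++ new) :: suf) v i ↔
      InBag (pre ++ B :: suf) v (if i ≤ pre.length then i else i - 1) := by
  rw [InBag, InBag, getElem?_insert]
  split_ifs with h1 h2
  · rfl
  · subst h2
    simp [hv]
  · rfl

theorem inBag_insert_new {pre suf : List (List ℕ)} {B new : List ℕ} {v : ℕ}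
    (hv : ∀ D ∈ pre ++ B :: suf, v ∉ D) {i : ℕ} (h : InBag (pre ++ B :: (B ++ new) :: suf) v i) :
    i = pre.length + 1 := by
  obtain ⟨D, hD, hvD⟩ := h
  rw [getElem?_insert] at hD
  by_contra hi
  rw [if_neg hi] at hD
  split_ifs at hD with h1
  · exact hv D (List.mem_of_getElem? hD) hvD
  · exact hv D (List.mem_of_getElem? hD) hvD

theorem consecutive_insert {pre suf : List (List ℕ)} {B new : List ℕ}
    (hnew : ∀ v ∈ new, ∀ D ∈ pre ++ B :: suf, v ∉ D) (h : Consecutive (pre ++ B :: suf)) :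
    Consecutive (pre ++ B :: (B ++ new) :: suf) := by
  intro v i j k hij hjk hi hk
  by_cases hv : v ∈ new
  · have h1 := inBag_insert_new (hnew v hv) hi
    have h2 := inBag_insert_new (hnew v hv) hk
    obtain rfl : i = j := by lia
    exact hi
  · rw [inBag_insert_iff hv] at hi hk ⊢
    refine h v _ _ _ ?_ ?_ hi hk <;> split_ifs <;> lia

theorem RawState.ReducesFrom.step {d g : ℕ} (G : GadgetFamily d g) {S₀ S : RawState}
    (h : S₀.ReducesFrom g S) {c : RawConstraint} (hc : c.Valid d S₀.n)
    (hB : ∃ B ∈ S₀.bags, ∀ v ∈ c.1, v ∈ B) : S₀.ReducesFrom g (G.step S c) := by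
  obtain ⟨h, hle, hsub, horigin, hshape⟩ := h
  obtain ⟨pre, B, suf, hL, hBp, hpre, hins⟩ := insertBag_eq (p := scopeIn c)
    (List.range' S.n g) (L := S.bags) (by
      obtain ⟨B, hB, hcB⟩ := hB
      exact ⟨B, hsub B hB, by simpa [scopeIn] using hcB⟩)
  have hscope : ∀ v ∈ c.1, v ∈ B := by simpa [scopeIn] using hBp
  have hbags : (G.step S c).bags = pre ++ B :: (B ++ List.range' S.n g) :: suf := hins
  have hmem : ∀ D, D ∈ (G.step S c).bags ↔ D ∈ S.bags ∨ D = B ++ List.range' S.n g := by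
    intro D
    rw [hbags, hL]
    simp only [List.mem_append, List.mem_cons]
    tauto
  have hBS : B ∈ S.bags := by rw [hL]; simp
  -- The first bag containing the scope is an original bag.
  have hB₀ : B ∈ S₀.bags := by
    obtain ⟨j, hj, B₀, hjB, hB₀, hB₀'⟩ := horigin pre.length B (by simp [hL])
    rcases hj.lt_or_eq with hj | rfl
    · have h1 : B₀ ∈ pre := by
        rw [hL, List.getElem?_append_left hj] at hjB
        exact List.mem_of_getElem? hjB
      have h2 := hpre B₀ h1
      simp only [scopeIn, decide_eq_false_iff_not] at h2
      exact absurd (fun v hv => hB₀' v (hscope v hv) (hc.lt v hv)) h2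
    · rw [hL] at hjB
      simp only [List.getElem?_append_right le_rfl, Nat.sub_self, List.getElem?_cons_zero,
        Option.some.injEq] at hjB
      exact hjB ▸ hB₀
  have hfresh : ∀ v ∈ List.range' S.n g, ∀ D ∈ S.bags, v ∉ D := by
    intro v hv D hD hvD
    have := h.bag_lt D hD v hvD
    rw [List.mem_range'_1] at hv
    lia
  refine ⟨⟨?_, ?_, ?_, ?_, ?_, ?_⟩, ?_, ?_, ?_, ?_⟩
  · intro e he
    change e.1 < S.n + g ∧ e.2 < S.n + g
    rcases List.mem_append.1 he with he | he
    · have := h.edge_lt e he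
      lia
    · rw [mem_gadget_edges] at he
      rcases he with ⟨i, j, _, rfl⟩ | ⟨i, j, _, v, hv, rfl⟩
      · simp
      · have := hc.lt v (List.mem_of_getElem? hv)
        simp
        lia
  · intro D hD v hv
    change v < S.n + g
    rcases (hmem D).1 hD with hD | rfl
    · have := h.bag_lt D hD v hv
      lia
    · rcases List.mem_append.1 hv with hv | hv
      · have := h.bag_lt B hBS v hv
        lia
      · rw [List.mem_range'_1] at hv
        lia
  · rw [hbags]; simp
  · intro v hv
    change v < S.n + g at hv
    by_cases hvn : v < S.n
    · obtain ⟨D, hD, hvD⟩ := h.covers_vertex v hvn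
      exact ⟨D, (hmem D).2 (.inl hD), hvD⟩
    · refine ⟨_, (hmem _).2 (.inr rfl), List.mem_append_right _ ?_⟩
      rw [List.mem_range'_1]
      lia
  · intro e he
    rcases List.mem_append.1 he with he | he
    · obtain ⟨D, hD, hvD⟩ := h.covers_edge e he
      exact ⟨D, (hmem D).2 (.inl hD), hvD⟩
    · refine ⟨_, (hmem _).2 (.inr rfl), ?_⟩
      rw [mem_gadget_edges] at he
      rcases he with ⟨i, j, _, rfl⟩ | ⟨i, j, _, v, hv, rfl⟩
      · simp [List.mem_range'_1]
      · have := hscope v (List.mem_of_getElem? hv)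
        simp [List.mem_range'_1, this]
  · rw [hbags]
    exact consecutive_insert (by rw [← hL]; exact hfresh) (by rw [← hL]; exact h.consecutive)
  · exact hle.trans (Nat.le_add_right _ _)
  · exact fun D hD => (hmem D).2 (.inl (hsub D hD))
  · intro i D hD
    rw [hbags] at hD ⊢
    -- Positions of the old list, and where they are in the new list.
    have hpos : ∀ i D, i ≤ pre.length → S.bags[i]? = some D →
        (pre ++ B :: (B ++ List.range' S.n g) :: suf)[i]? = some D := by
      intro i D hi hD
      rw [getElem?_insert, if_pos hi, ← hL, hD]
    have hpos' : ∀ i D, pre.length < i → S.bags[i]? = some D →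
        (pre ++ B :: (B ++ List.range' S.n g) :: suf)[i + 1]? = some D := by
      intro i D hi hD
      rw [getElem?_insert, if_neg (by lia), if_neg (by lia), Nat.add_sub_cancel, ← hL, hD]
    have hpB : S.bags[pre.length]? = some B := by simp [hL]
    rw [getElem?_insert] at hD
    split_ifs at hD with h1 h2
    · rw [← hL] at hD
      obtain ⟨j, hj, B₀, hjB, h3⟩ := horigin i D hD
      exact ⟨j, hj, B₀, hpos j B₀ (hj.trans h1) hjB, h3⟩
    · refine ⟨pre.length, by lia, B, hpos _ _ le_rfl hpB, hB₀, ?_⟩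
      intro v hv hvn
      rw [Option.some.injEq] at hD
      rw [← hD] at hv
      rcases List.mem_append.1 hv with hv | hv
      · exact hv
      · rw [List.mem_range'_1] at hv
        lia
    · rw [← hL] at hD
      obtain ⟨j, hj, B₀, hjB, h3⟩ := horigin (i - 1) D hD
      by_cases hjp : j ≤ pre.length
      · exact ⟨j, by lia, B₀, hpos j B₀ hjp hjB, h3⟩
      · exact ⟨j + 1, by lia, B₀, hpos' j B₀ (by lia) hjB, h3⟩
  · intro D hD
    rcases (hmem D).1 hD with hD | rfl
    · exact hshape D hD
    · exact ⟨B, hB₀, _, rfl, by simp⟩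

/-- The sets of positions of vertices that pairwise share a bag have a common element, since they
are intervals: take the position where the last of these intervals begins. -/
theorem exists_common_bag {bags : List (List ℕ)} (h0 : bags ≠ []) (hcons : Consecutive bags)
    (scope : List ℕ) (hpair : ∀ u ∈ scope, ∀ v ∈ scope, ∃ B ∈ bags, u ∈ B ∧ v ∈ B) :
    ∃ B ∈ bags, ∀ v ∈ scope, v ∈ B := by
  classical
  have hex : ∀ v ∈ scope, ∃ i, InBag bags v i := by
    intro v hv
    obtain ⟨B, hB, hvB, _⟩ := hpair v hv v hv
    obtain ⟨i, hi⟩ := List.mem_iff_getElem?.1 hB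
    exact ⟨i, B, hi, hvB⟩
  let first : ℕ → ℕ := fun v => if h : ∃ i, InBag bags v i then Nat.find h else 0
  have hfirst : ∀ v ∈ scope, InBag bags v (first v) ∧ ∀ i, InBag bags v i → first v ≤ i := by
    intro v hv
    simp only [first, dif_pos (hex v hv)]
    exact ⟨Nat.find_spec (hex v hv), fun i hi => Nat.find_min' _ hi⟩
  rcases scope.eq_nil_or_concat with rfl | hne
  · obtain ⟨B, hB⟩ := List.exists_mem_of_ne_nil bags h0
    exact ⟨B, hB, by simp⟩
  · obtain ⟨w, hw, hmax⟩ := scope.toFinset.exists_max_image first (by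
      obtain ⟨l, a, rfl⟩ := hne
      exact ⟨a, by simp⟩)
    rw [List.mem_toFinset] at hw
    obtain ⟨⟨B, hB, hwB⟩, hmin⟩ := hfirst w hw
    refine ⟨B, List.mem_of_getElem? hB, fun u hu => ?_⟩
    obtain ⟨D, hD, huD, hwD⟩ := hpair u hu w hw
    obtain ⟨k, hk⟩ := List.mem_iff_getElem?.1 hD
    obtain ⟨B', hB', huB'⟩ := hcons u (first u) (first w) k (hmax u (by simpa using hu))
      (hmin k ⟨D, hk, hwD⟩) (hfirst u hu).1 ⟨D, hk, huD⟩
    rw [hB] at hB'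
    rw [Option.some.injEq] at hB'
    exact hB' ▸ huB'

end SigmaRho

namespace SigmaRho

/-! ### Instances as lists of natural numbers -/

theorem IsResidueClass.exists_zmod {m : ℕ} {τ : Set ℕ} (h : IsResidueClass m τ) :
    ∃ s : ZMod m, ∀ k : ℕ, k ∈ τ ↔ (k : ZMod m) = s := by
  obtain ⟨_, a, rfl⟩ := h
  refine ⟨a, fun k => ?_⟩
  rw [Set.mem_ofPred_eq, ← ZMod.intCast_eq_intCast_iff, Int.cast_natCast]

theorem IsDifficult.zmod {m : ℕ} {σ ρ : Set ℕ} (hm : 0 < m) {s r : ZMod m}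
    (hσ : ∀ k : ℕ, k ∈ σ ↔ (k : ZMod m) = s) (hρ : ∀ k : ℕ, k ∈ ρ ↔ (k : ZMod m) = r)
    (h : IsDifficult σ ρ) : 3 ≤ m ∧ r ≠ 0 := by
  simp only [IsDifficult, IsEasy, not_or] at h
  obtain ⟨h0, h1, h2⟩ := h
  have hr : r ≠ 0 := by
    rintro rfl
    exact h0 ((hρ 0).2 (by simp))
  refine ⟨?_, hr⟩
  by_contra hlt
  have hcases : m = 1 ∨ m = 2 := by lia
  rcases hcases with rfl | rfl
  · exact hr (Subsingleton.elim _ _)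
  · have hr1 : ∀ r : ZMod 2, r ≠ 0 → r = 1 := by decide
    have hs : ∀ s : ZMod 2, s = 0 ∨ s = 1 := by decide
    obtain rfl := hr1 r hr
    have hodd : ρ = {n | Odd n} := by
      ext k
      rw [hρ, Set.mem_ofPred_eq, ZMod.natCast_eq_one_iff_odd]
    rcases hs s with rfl | rfl
    · refine h1 ⟨?_, hodd⟩
      ext k
      rw [hσ, Set.mem_ofPred_eq, ZMod.natCast_eq_zero_iff_even]
    · refine h2 ⟨?_, hodd⟩
      ext k
      rw [hσ, Set.mem_ofPred_eq, ZMod.natCast_eq_one_iff_odd]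

/-- The edges as pairs of natural numbers. -/
def rawEdges {n : ℕ} (E : List (Fin n × Fin n)) : List (ℕ × ℕ) := E.map fun e => (e.1.val, e.2.val)

/-- The bags as lists of natural numbers. -/
def rawBags {n : ℕ} (L : List (List (Fin n))) : List (List ℕ) := L.map (List.map Fin.val)

/-- The constraint as lists of natural numbers. -/
def ConstraintData.raw {n : ℕ} (c : ConstraintData n) : RawConstraint :=
  (c.scope.map Fin.val, rawBags c.acc)

/-- The graph and the bags of an instance as lists of natural numbers. -/
def RelInstance.raw (I : RelInstance) : RawState := ⟨I.n, rawEdges I.edges, rawBags I.bags⟩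

theorem mem_rawEdges {n : ℕ} {E : List (Fin n × Fin n)} {u v : Fin n} :
    (u.val, v.val) ∈ rawEdges E ↔ (u, v) ∈ E := by
  simp [rawEdges, Fin.val_inj]

theorem graphOfEdges_adj_iff {n : ℕ} {E : List (Fin n × Fin n)} {u v : Fin n} :
    (graphOfEdges E).Adj u v ↔ natAdj (rawEdges E) u v = true := by
  simp [graphOfEdges, natAdj, mem_rawEdges, Fin.val_inj]

theorem natCast_ncard_neighborSet_inter {m n : ℕ} (E : List (Fin n × Fin n)) (S : Finset (Fin n))
    {x : ℕ → Bool} (hx : ∀ v : Fin n, x v = decide (v ∈ S)) (v : Fin n) :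
    (((graphOfEdges E).neighborSet v ∩ (S : Set (Fin n))).ncard : ZMod m) =
      ∑ u ∈ Finset.range n, ind m (natAdj (rawEdges E) v u && x u) := by
  classical
  rw [← Fin.sum_univ_eq_sum_range (fun u => ind m (natAdj (rawEdges E) v u && x u))]
  have : (graphOfEdges E).neighborSet v ∩ (S : Set (Fin n)) =
      ((Finset.univ.filter fun u : Fin n => (natAdj (rawEdges E) v u && x u) = true :
        Finset (Fin n)) : Set (Fin n)) := by
    ext u
    simp [graphOfEdges_adj_iff, hx]
  rw [this, Set.ncard_coe_finset, Finset.card_filter, Nat.cast_sum]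
  refine Finset.sum_congr rfl fun u _ => ?_
  simp [ind]

theorem isSigmaRhoSet_iff {m n : ℕ} {σ ρ : Set ℕ} {s r : ZMod m}
    (hσ : ∀ k : ℕ, k ∈ σ ↔ (k : ZMod m) = s) (hρ : ∀ k : ℕ, k ∈ ρ ↔ (k : ZMod m) = r)
    (E : List (Fin n × Fin n)) (S : Finset (Fin n))
    {x : ℕ → Bool} (hx : ∀ v : Fin n, x v = decide (v ∈ S)) :
    IsSigmaRhoSet σ ρ (graphOfEdges E) S ↔
      ∀ v < n, ∑ u ∈ Finset.range n, ind m (natAdj (rawEdges E) v u && x u) +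
        (r - s) * ind m (x v) = r := by
  simp only [IsSigmaRhoSet, hσ, hρ, natCast_ncard_neighborSet_inter E S hx]
  constructor
  · rintro ⟨h1, h2⟩ v hv
    have hxv := hx ⟨v, hv⟩
    simp only at hxv
    by_cases hS : (⟨v, hv⟩ : Fin n) ∈ S
    · have := h1 _ hS
      simp only at this
      rw [this, hxv]
      simp [hS]
    · have := h2 _ hS
      simp only at this
      rw [this, hxv]
      simp [hS]
  · intro h
    constructor
    · intro v hv
      have := h v v.2
      rw [hx v, decide_eq_true hv, ind_true] at this
      linear_combination this
    · intro v hv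
      have := h v v.2
      rw [hx v, decide_eq_false hv, ind_false] at this
      linear_combination this

theorem ConstraintData.accepts_iff {n : ℕ} (c : ConstraintData n) (S : Finset (Fin n))
    {x : ℕ → Bool} (hx : ∀ v : Fin n, x v = decide (v ∈ S)) :
    S ∩ c.toRelConstraint.scope ∈ c.toRelConstraint.acc ↔
      ∃ A ∈ c.raw.2, ∀ v ∈ c.raw.1, x v = decide (v ∈ A) := by
  simp only [ConstraintData.toRelConstraint, ConstraintData.raw, rawBags, List.mem_toFinset,
    List.mem_map, exists_exists_and_eq_and]
  refine exists_congr fun A => and_congr_right fun hA => ?_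
  have hsub := (c.acc_sublist A hA).subset
  constructor
  · rintro h v ⟨v, hv, rfl⟩
    have := Finset.ext_iff.1 h v
    simp only [List.mem_toFinset, Finset.mem_inter, hv, and_true] at this
    rw [hx]
    simp [Fin.val_inj, this]
  · intro h
    ext v
    simp only [List.mem_toFinset, Finset.mem_inter]
    constructor
    · intro hv
      have := h v ⟨v, hsub hv, rfl⟩
      rw [hx] at this
      simp only [Fin.val_inj, exists_eq_right, decide_eq_decide] at this
      exact ⟨this.2 hv, hsub hv⟩
    · rintro ⟨hv, hvs⟩
      have := h v ⟨v, hvs, rfl⟩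
      rw [hx] at this
      simp only [Fin.val_inj, exists_eq_right, decide_eq_decide] at this
      exact this.1 hv

theorem exists_bool_fun {n : ℕ} (S : Finset (Fin n)) :
    ∃ x : ℕ → Bool, ∀ v : Fin n, x v = decide (v ∈ S) :=
  ⟨fun v => if h : v < n then decide (⟨v, h⟩ ∈ S) else false, fun v => by simp⟩

theorem exists_finset {n : ℕ} (x : ℕ → Bool) :
    ∃ S : Finset (Fin n), ∀ v : Fin n, x v = decide (v ∈ S) :=
  ⟨Finset.univ.filter fun v => x v = true, fun v => by simp⟩

theorem RelInstance.isYes_iff {m : ℕ} {σ ρ : Set ℕ} {s r : ZMod m}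
    (hσ : ∀ k : ℕ, k ∈ σ ↔ (k : ZMod m) = s) (hρ : ∀ k : ℕ, k ∈ ρ ↔ (k : ZMod m) = r)
    (I : RelInstance) : I.IsYes σ ρ ↔ ∃ x, IsRawSolution (r - s) r I.raw.n I.raw.edges
      (I.rels.map ConstraintData.raw) x := by
  have key : ∀ S x, (∀ v : Fin I.n, x v.val = decide (v ∈ S)) →
      (I.relGraph.IsSigmaRhoSet σ ρ S ↔ IsRawSolution (r - s) r I.raw.n I.raw.edges
        (I.rels.map ConstraintData.raw) x) := by
    intro S x hx
    refine and_congr (isSigmaRhoSet_iff hσ hρ I.edges S hx) ?_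
    simp only [RelInstance.relGraph, relGraphOf, Set.mem_ofPred_eq, forall_exists_index, and_imp,
      List.mem_map]
    constructor
    · rintro h _ c hc rfl
      exact (c.accepts_iff S hx).1 (h _ c hc rfl)
    · rintro h _ c hc rfl
      exact (c.accepts_iff S hx).2 (h _ c hc rfl)
  constructor
  · rintro ⟨S, hS⟩
    obtain ⟨x, hx⟩ := exists_bool_fun S
    exact ⟨x, (key S x hx).1 hS⟩
  · rintro ⟨x, hx⟩
    obtain ⟨S, hS⟩ := exists_finset (n := I.n) x
    exact ⟨S, (key S x hS).2 hx⟩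

theorem PlainInstance.isYes_iff {m : ℕ} {σ ρ : Set ℕ} {s r : ZMod m}
    (hσ : ∀ k : ℕ, k ∈ σ ↔ (k : ZMod m) = s) (hρ : ∀ k : ℕ, k ∈ ρ ↔ (k : ZMod m) = r)
    (J : PlainInstance) :
    J.IsYes σ ρ ↔ ∃ x, IsRawSolution (r - s) r J.n (rawEdges J.edges) [] x := by
  have key : ∀ S x, (∀ v : Fin J.n, x v.val = decide (v ∈ S)) →
      (IsSigmaRhoSet σ ρ J.graph S ↔
        IsRawSolution (r - s) r J.n (rawEdges J.edges) [] x) := by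
    intro S x hx
    refine (isSigmaRhoSet_iff hσ hρ J.edges S hx).trans ?_
    simp [IsRawSolution]
  constructor
  · rintro ⟨S, hS⟩
    obtain ⟨x, hx⟩ := exists_bool_fun S
    exact ⟨x, (key S x hx).1 hS⟩
  · rintro ⟨x, hx⟩
    obtain ⟨S, hS⟩ := exists_finset (n := J.n) x
    exact ⟨S, (key S x hS).2 hx⟩

theorem inBag_rawBags_iff {n : ℕ} {L : List (List (Fin n))} {v : Fin n}
    {i : Fin (L.map List.toFinset).length} :
    v ∈ (L.map List.toFinset).get i ↔ InBag (rawBags L) v i := by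
  have hi : i.val < L.length := by simpa using i.2
  simp [InBag, rawBags, List.getElem?_map, List.getElem?_eq_getElem hi, Fin.val_inj]

theorem exists_mem_toFinset_iff {n : ℕ} {L : List (List (Fin n))} {u v : Fin n} :
    (∃ B ∈ L.map List.toFinset, u ∈ B ∧ v ∈ B) ↔ ∃ B ∈ rawBags L, u.val ∈ B ∧ v.val ∈ B := by
  simp [rawBags, Fin.val_inj]

theorem RelInstance.decomposed (I : RelInstance) : I.raw.Decomposed := by
  obtain ⟨h0, h1, h2, h3⟩ := I.isPathDecomposition
  have hlt : ∀ B ∈ rawBags I.bags, ∀ v ∈ B, v < I.n := by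
    intro B hB v hv
    simp only [rawBags, List.mem_map] at hB
    obtain ⟨B, _, rfl⟩ := hB
    obtain ⟨v, _, rfl⟩ := List.mem_map.1 hv
    exact v.2
  refine ⟨?_, hlt, ?_, ?_, ?_, ?_⟩
  · rintro _ he
    simp only [RelInstance.raw, rawEdges, List.mem_map] at he
    obtain ⟨e, _, rfl⟩ := he
    exact ⟨e.1.2, e.2.2⟩
  · simpa [RelInstance.raw, rawBags] using h0
  · intro v hv
    obtain ⟨B, hB, hvB⟩ := h1 ⟨v, hv⟩
    obtain ⟨B', hB', h, _⟩ := exists_mem_toFinset_iff.1 ⟨B, hB, hvB, hvB⟩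
    exact ⟨B', hB', h⟩
  · rintro _ he
    simp only [RelInstance.raw, rawEdges, List.mem_map] at he
    obtain ⟨e, he, rfl⟩ := he
    refine exists_mem_toFinset_iff.1 ?_
    by_cases hne : e.1 = e.2
    · obtain ⟨B, hB, hvB⟩ := h1 e.1
      exact ⟨B, hB, hvB, hne ▸ hvB⟩
    · refine h2 _ _ (Or.inl ?_)
      change (graphOfEdges I.edges).Adj _ _
      simp [graphOfEdges, hne, he]
  · intro v i j k hij hjk hi hk
    obtain ⟨B, hB, hvB⟩ := hk
    have hkl : k < I.bags.length := by
      have := (List.getElem?_eq_some_iff.1 hB).1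
      simpa [RelInstance.raw, rawBags] using this
    have hv : v < I.n := hlt B (List.mem_of_getElem? hB) v hvB
    have := h3 ⟨v, hv⟩ ⟨i, by simp; lia⟩ ⟨j, by simp; lia⟩ ⟨k, by simp; lia⟩ hij hjk
    rw [inBag_rawBags_iff, inBag_rawBags_iff, inBag_rawBags_iff] at this
    exact this hi ⟨B, hB, hvB⟩

theorem RelInstance.exists_bag_scope (I : RelInstance) {c : ConstraintData I.n} (hc : c ∈ I.rels) :
    ∃ B ∈ I.raw.bags, ∀ v ∈ c.raw.1, v ∈ B := by
  refine exists_common_bag I.decomposed.ne_nil I.decomposed.consecutive _ fun u hu v hv => ?_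
  simp only [ConstraintData.raw, List.mem_map] at hu hv
  obtain ⟨u, hu, rfl⟩ := hu
  obtain ⟨v, hv, rfl⟩ := hv
  refine exists_mem_toFinset_iff.1 ?_
  by_cases hne : u = v
  · obtain ⟨B, hB, hvB⟩ := I.isPathDecomposition.covers_vertex u
    exact ⟨B, hB, hvB, hne ▸ hvB⟩
  · refine I.isPathDecomposition.covers_edge u v (Or.inr ?_)
    rw [SimpleGraph.fromRel_adj]
    exact ⟨hne, .inl ⟨c.toRelConstraint, ⟨c, hc, rfl⟩, by simpa [ConstraintData.toRelConstraint],
      by simpa [ConstraintData.toRelConstraint]⟩⟩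

theorem ConstraintData.raw_valid {d : ℕ} {I : RelInstance} (hI : I.relGraph.ArityLE d)
    {c : ConstraintData I.n} (hc : c ∈ I.rels) : c.raw.Valid d I.n where
  nodup := c.scope_nodup.map Fin.val_injective
  lt := by
    intro v hv
    obtain ⟨v, _, rfl⟩ := List.mem_map.1 hv
    exact v.2
  length_le := by
    have := hI c.toRelConstraint ⟨c, hc, rfl⟩
    rw [ConstraintData.toRelConstraint, List.toFinset_card_of_nodup c.scope_nodup] at this
    simpa [ConstraintData.raw] using this

theorem exists_list_fin {n : ℕ} {l : List ℕ} (h : ∀ v ∈ l, v < n) :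
    ∃ l' : List (Fin n), l'.map Fin.val = l :=
  ⟨l.pmap Fin.mk h, by simp [List.map_pmap]⟩

theorem exists_rawBags_eq {n : ℕ} {L : List (List ℕ)} (h : ∀ B ∈ L, ∀ v ∈ B, v < n) :
    ∃ L' : List (List (Fin n)), rawBags L' = L := by
  induction L with
  | nil => exact ⟨[], rfl⟩
  | cons B L ih =>
    obtain ⟨L', rfl⟩ := ih fun B hB => h B (List.mem_cons_of_mem _ hB)
    obtain ⟨B', rfl⟩ := exists_list_fin (h B List.mem_cons_self)
    exact ⟨B' :: L', rfl⟩

theorem exists_rawEdges_eq {n : ℕ} {E : List (ℕ × ℕ)} (h : ∀ e ∈ E, e.1 < n ∧ e.2 < n) :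
    ∃ E' : List (Fin n × Fin n), rawEdges E' = E := by
  induction E with
  | nil => exact ⟨[], rfl⟩
  | cons e E ih =>
    obtain ⟨E', rfl⟩ := ih fun e he => h e (List.mem_cons_of_mem _ he)
    exact ⟨(⟨e.1, (h e List.mem_cons_self).1⟩, ⟨e.2, (h e List.mem_cons_self).2⟩) :: E', rfl⟩

/-- A graph with bags on natural numbers which is a path decomposition is an instance. -/
theorem RawState.Decomposed.exists_plainInstance {S : RawState} (h : S.Decomposed) :
    ∃ J : PlainInstance, J.n = S.n ∧ rawEdges J.edges = S.edges ∧ rawBags J.bags = S.bags := by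
  obtain ⟨n, E, L⟩ := S
  obtain ⟨h1, h2, h3, h4, h5, h6⟩ := h
  simp only at h1 h2 h3 h4 h5 h6
  obtain ⟨E, rfl⟩ := exists_rawEdges_eq h1
  obtain ⟨L, rfl⟩ := exists_rawBags_eq h2
  refine ⟨⟨n, E, L, ?_, ?_, ?_, ?_⟩, rfl, rfl, rfl⟩
  · simpa [rawBags] using h3
  · intro v
    obtain ⟨B, hB, hvB⟩ := h4 v v.2
    obtain ⟨B', hB', h, _⟩ := exists_mem_toFinset_iff.2 ⟨B, hB, hvB, hvB⟩
    exact ⟨B', hB', h⟩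
  · intro u v huv
    refine exists_mem_toFinset_iff.2 ?_
    simp only [graphOfEdges, SimpleGraph.fromRel_adj] at huv
    rcases huv.2 with h | h
    · exact h5 _ (mem_rawEdges.2 h)
    · obtain ⟨B, hB, h1, h2⟩ := h5 _ (mem_rawEdges.2 h)
      exact ⟨B, hB, h2, h1⟩
  · intro v i j k hij hjk hi hk
    rw [inBag_rawBags_iff] at hi hk ⊢
    exact h6 v i j k hij hjk hi hk

theorem le_foldr_max {l : List ℕ} {a : ℕ} (h : a ∈ l) : a ≤ l.foldr max 0 := by
  induction l with
  | nil => simp at h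
  | cons b l ih =>
    rcases List.mem_cons.1 h with rfl | h
    · exact le_max_left _ _
    · exact (ih h).trans (le_max_right _ _)

theorem foldr_max_le {l : List ℕ} {b : ℕ} (h : ∀ a ∈ l, a ≤ b) : l.foldr max 0 ≤ b := by
  induction l with
  | nil => simp
  | cons a l ih =>
    exact max_le (h a List.mem_cons_self) (ih fun a ha => h a (List.mem_cons_of_mem _ ha))

theorem RawState.ReducesFrom.width_le {g : ℕ} {I : RelInstance} {S : RawState}
    (h : I.raw.ReducesFrom g S) {J : PlainInstance} (hJ : rawBags J.bags = S.bags) :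
    J.width ≤ I.width + g := by
  have key : ((J.bags.map List.toFinset).map Finset.card).foldr max 0 ≤
      ((I.bags.map List.toFinset).map Finset.card).foldr max 0 + g := by
    refine foldr_max_le fun a ha => ?_
    simp only [List.map_map, List.mem_map, Function.comp_apply] at ha
    obtain ⟨B, hB, rfl⟩ := ha
    obtain ⟨B₀, hB₀, new, hnew, hlen⟩ := h.shape (B.map Fin.val) (by
      rw [← hJ]
      exact List.mem_map.2 ⟨B, hB, rfl⟩)
    obtain ⟨B₀, hB₀', rfl⟩ := List.mem_map.1 hB₀
    have hcard : ∀ {n : ℕ} (B : List (Fin n)), B.toFinset.card = (B.map Fin.val).toFinset.card := by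
      intro n B
      rw [← Finset.card_map Fin.valEmbedding]
      congr 1
      ext v
      simp
    rw [hcard B, hnew, List.toFinset_append]
    refine (Finset.card_union_le _ _).trans (Nat.add_le_add ?_ ?_)
    · rw [← hcard B₀]
      exact le_foldr_max (by simpa using ⟨B₀, hB₀', rfl⟩)
    · exact (List.toFinset_card_le new).trans hlen
  simp only [PlainInstance.width, RelInstance.width, pathWidth]
  lia

/-- The result of replacing all constraints, one after the other, by gadgets. -/
theorem foldl_step_spec {d g m : ℕ} {t r : ZMod m} (G : GadgetFamily d g)
    (hG : ∀ T, Realizes t r (G.adj T) (G.att T) T) {S₀ : RawState} (R : List RawConstraint) :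
    ∀ {S : RawState}, S₀.ReducesFrom g S →
      (∀ c ∈ R, c.Valid d S₀.n ∧ ∃ B ∈ S₀.bags, ∀ v ∈ c.1, v ∈ B) →
      S₀.ReducesFrom g (R.foldl G.step S) ∧
        ((∃ x, IsRawSolution t r S.n S.edges R x) ↔
          ∃ x, IsRawSolution t r (R.foldl G.step S).n (R.foldl G.step S).edges [] x) := by
  induction R with
  | nil => exact fun h _ => ⟨h, Iff.rfl⟩
  | cons c R ih =>
    intro S hS hR
    obtain ⟨hc, hB⟩ := hR c List.mem_cons_self
    have hR' := fun c' hc' => hR c' (List.mem_cons_of_mem _ hc')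
    obtain ⟨h1, h2⟩ := ih (hS.step G hc hB) hR'
    refine ⟨h1, (exists_rawSolution_step G hG hS.decomposed.edge_lt ?_ ?_).trans h2⟩
    · exact ⟨hc.nodup, fun v hv => (hc.lt v hv).trans_le hS.le, hc.length_le⟩
    · exact fun c' hc' v hv => ((hR' c' hc').1.lt v hv).trans_le hS.le

end SigmaRho

namespace SigmaRho

/-! ### A structured programming language for stack machines -/

/-- Programs for a machine with stacks `K` over the alphabet `Γ` and a memory in `σ`. The program
`loop k c p` pops `o` from the stack `k` (`none` if it is empty), executes `p o`, and repeats this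
as long as `c o` holds. -/
inductive Prog (K σ Γ : Type) : Type
  | push (k : K) (a : Γ) : Prog K σ Γ
  | set (f : σ → σ) : Prog K σ Γ
  | seq (p q : Prog K σ Γ) : Prog K σ Γ
  | switch (p : σ → Prog K σ Γ) : Prog K σ Γ
  | loop (k : K) (c : Option Γ → Bool) (p : Option Γ → Prog K σ Γ) : Prog K σ Γ

namespace Prog

variable {K σ Γ : Type}

/-- The execution of a program: `Exec p v S v' S' n` says that `p` transforms the memory `v` and
the stacks `S` into `v'` and `S'` in `n` steps. -/
inductive Exec [DecidableEq K] :
    Prog K σ Γ → σ → (K → List Γ) → σ → (K → List Γ) → ℕ → Prop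
  | push (k a v S) : Exec (push k a) v S v (Function.update S k (a :: S k)) 1
  | set (f v S) : Exec (set f) v S (f v) S 1
  | seq {p q v S v₁ S₁ v₂ S₂ n₁ n₂} : Exec p v S v₁ S₁ n₁ → Exec q v₁ S₁ v₂ S₂ n₂ →
      Exec (seq p q) v S v₂ S₂ (n₁ + n₂)
  | switch {p : σ → Prog K σ Γ} {v S v' S' n} : Exec (p v) v S v' S' n →
      Exec (switch p) v S v' S' (n + 1)
  | loop_final {k c} {p : Option Γ → Prog K σ Γ} {v S v' S' n} : c (S k).head? = false →
      Exec (p (S k).head?) v (Function.update S k (S k).tail) v' S' n →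
      Exec (loop k c p) v S v' S' (n + 1)
  | loop_again {k c} {p : Option Γ → Prog K σ Γ} {v S v₁ S₁ v₂ S₂ n₁ n₂} :
      c (S k).head? = true →
      Exec (p (S k).head?) v (Function.update S k (S k).tail) v₁ S₁ n₁ →
      Exec (loop k c p) v₁ S₁ v₂ S₂ n₂ → Exec (loop k c p) v S v₂ S₂ (n₁ + n₂ + 1)

/-- The labels of the machine for a program. -/
def Label : Prog K σ Γ → Type
  | push _ _ => Unit
  | set _ => Unit
  | seq p q => Label p ⊕ Label q
  | switch p => Option (Σ v, Label (p v))
  | loop _ _ p => Option (Σ o, Label (p o))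

theorem finite_label [Finite σ] [Finite Γ] (p : Prog K σ Γ) : Finite p.Label := by
  induction p with
  | push => exact inferInstanceAs (Finite Unit)
  | set => exact inferInstanceAs (Finite Unit)
  | seq p q hp hq => exact inferInstanceAs (Finite (Label p ⊕ Label q))
  | switch p hp => exact inferInstanceAs (Finite (Option (Σ v, Label (p v))))
  | loop k c p hp => exact inferInstanceAs (Finite (Option (Σ o, Label (p o))))

/-- The label at which the execution of a program begins. -/
def entry : (p : Prog K σ Γ) → p.Label
  | push _ _ => ()
  | set _ => ()
  | seq p _ => .inl p.entry
  | switch _ => none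
  | loop _ _ _ => none

/-- The statements of the machine for a program which is part of a larger machine: `emb` embeds its
labels, and `exit` is the label at which the execution continues. The memory of the machine also
holds the symbol which was popped last. -/
def code {Λ : Type} : (p : Prog K σ Γ) → (p.Label → Λ) → Λ → p.Label →
    Turing.TM2.Stmt (fun _ : K => Γ) Λ (σ × Option Γ)
  | push k a, _, exit => fun _ => .push k (fun _ => a) (.goto fun _ => exit)
  | set f, _, exit => fun _ => .load (fun v => (f v.1, v.2)) (.goto fun _ => exit)
  | seq p q, emb, exit => Sum.elim (p.code (fun l => emb (.inl l)) (emb (.inr q.entry)))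
      (q.code (fun l => emb (.inr l)) exit)
  | switch p, emb, exit => fun
    | none => .goto fun v => emb (some ⟨v.1, (p v.1).entry⟩)
    | some ⟨v, l⟩ => (p v).code (fun l => emb (some ⟨v, l⟩)) exit l
  | loop k c p, emb, exit => fun
    | none => .pop k (fun v o => (v.1, o)) (.goto fun v => emb (some ⟨v.2, (p v.2).entry⟩))
    | some ⟨o, l⟩ => (p o).code (fun l => emb (some ⟨o, l⟩)) (bif c o then emb none else exit) l

section

variable {Λ : Type} (exit : Λ)

theorem code_switch_none (p : σ → Prog K σ Γ) (emb : (switch p).Label → Λ) :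
    (switch p).code emb exit none = .goto fun v => emb (some ⟨v.1, (p v.1).entry⟩) := by
  rw [code]

theorem code_switch_some (p : σ → Prog K σ Γ) (emb : (switch p).Label → Λ) (v : σ)
    (l : (p v).Label) : (switch p).code emb exit (some ⟨v, l⟩) =
      (p v).code (fun l => emb (some ⟨v, l⟩)) exit l := by
  rw [code]

theorem code_loop_none (k : K) (c : Option Γ → Bool) (p : Option Γ → Prog K σ Γ)
    (emb : (loop k c p).Label → Λ) : (loop k c p).code emb exit none =
      .pop k (fun v o => (v.1, o)) (.goto fun v => emb (some ⟨v.2, (p v.2).entry⟩)) := by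
  rw [code]

theorem code_loop_some (k : K) (c : Option Γ → Bool) (p : Option Γ → Prog K σ Γ)
    (emb : (loop k c p).Label → Λ) (o : Option Γ) (l : (p o).Label) :
    (loop k c p).code emb exit (some ⟨o, l⟩) =
      (p o).code (fun l => emb (some ⟨o, l⟩)) (bif c o then emb none else exit) l := by
  rw [code]

end

variable [DecidableEq K]

/-- The machine simulates the execution of a program step by step. -/
theorem Exec.simulate {Λ : Type} {M : Λ → Turing.TM2.Stmt (fun _ : K => Γ) Λ (σ × Option Γ)}
    {p : Prog K σ Γ} {v v' : σ} {S S' : K → List Γ} {n : ℕ} (h : Exec p v S v' S' n) :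
    ∀ (emb : p.Label → Λ) (exit : Λ), (∀ l, M (emb l) = p.code emb exit l) → ∀ o, ∃ o',
      (flip bind (Turing.TM2.step M))^[n] (some ⟨some (emb p.entry), (v, o), S⟩) =
        some ⟨some exit, (v', o'), S'⟩ := by
  induction h with
  | push k a v S =>
    intro emb exit hM o
    exact ⟨o, by simp [flip, hM, code]⟩
  | set f v S =>
    intro emb exit hM o
    exact ⟨o, by simp [flip, hM, code]⟩
  | seq _ _ ih₁ ih₂ =>
    intro emb exit hM o
    obtain ⟨o₁, h₁⟩ := ih₁ (fun l => emb (.inl l)) _ (fun l => hM (.inl l)) o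
    obtain ⟨o₂, h₂⟩ := ih₂ (fun l => emb (.inr l)) _ (fun l => hM (.inr l)) o₁
    refine ⟨o₂, ?_⟩
    rw [Nat.add_comm, Function.iterate_add_apply]
    exact (congrArg _ h₁).trans h₂
  | @switch p v S v' S' n _ ih =>
    intro emb exit hM o
    obtain ⟨o', h'⟩ := ih (fun l => emb (some ⟨v, l⟩)) exit
      (fun l => (hM (some ⟨v, l⟩)).trans (code_switch_some exit p emb v l)) o
    refine ⟨o', ?_⟩
    have h0 := (hM none).trans (code_switch_none exit p emb)
    rw [Function.iterate_succ_apply, ← h']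
    refine congrArg _ (congrArg some ?_)
    exact congrArg (fun q => Turing.TM2.stepAux q (v, o) S) h0
  | @loop_final k c p v S v' S' n hc _ ih =>
    intro emb exit hM o
    obtain ⟨o', h'⟩ := ih (fun l => emb (some ⟨(S k).head?, l⟩)) exit
      (fun l => (hM (some ⟨(S k).head?, l⟩)).trans
        ((code_loop_some exit k c p emb _ l).trans (by rw [hc, cond_false]))) (S k).head?
    refine ⟨o', ?_⟩
    have h0 := (hM none).trans (code_loop_none exit k c p emb)
    rw [Function.iterate_succ_apply, ← h']
    refine congrArg _ (congrArg some ?_)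
    exact congrArg (fun q => Turing.TM2.stepAux q (v, o) S) h0
  | @loop_again k c p v S v₁ S₁ v₂ S₂ n₁ n₂ hc _ _ ih₁ ih₂ =>
    intro emb exit hM o
    obtain ⟨o₁, h₁⟩ := ih₁ (fun l => emb (some ⟨(S k).head?, l⟩)) (emb none)
      (fun l => (hM (some ⟨(S k).head?, l⟩)).trans
        ((code_loop_some exit k c p emb _ l).trans (by rw [hc, cond_true]))) (S k).head?
    obtain ⟨o₂, h₂⟩ := ih₂ emb exit hM o₁
    refine ⟨o₂, ?_⟩
    have h0 := (hM none).trans (code_loop_none exit k c p emb)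
    rw [Function.iterate_succ_apply, Nat.add_comm, Function.iterate_add_apply]
    refine Eq.trans (congrArg _ (Eq.trans ?_ h₁)) h₂
    refine congrArg _ (congrArg some ?_)
    exact congrArg (fun q => Turing.TM2.stepAux q (v, o) S) h0

/-- The machine that executes a program, and then resets its memory. -/
noncomputable def machine [Fintype K] [Finite σ] {Γ : Type} [Fintype Γ] (p : Prog K σ Γ)
    (k₀ k₁ : K) (v₀ : σ) : Turing.FinTM2 :=
  letI := p.finite_label
  { K := K
    k₀ := k₀
    k₁ := k₁
    Γ := fun _ => Γ
    Λ := Option p.Label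
    main := some p.entry
    ΛFin := Fintype.ofFinite _
    σ := σ × Option Γ
    initialState := (v₀, none)
    σFin := Fintype.ofFinite _
    Γk₀Fin := inferInstance
    m := fun
      | some l => p.code some none l
      | none => .load (fun _ => (v₀, none)) .halt }

theorem dite_eq_update (k₀ : K) (s : List Γ) :
    (fun k => dite (k = k₀) (fun _ => s) fun _ => []) =
      Function.update (fun _ : K => ([] : List Γ)) k₀ s := by
  funext k
  by_cases hk : k = k₀ <;> simp [hk]

/-- A function is computable in polynomial time if it is computed by a program in polynomial time,
which leaves all stacks but the output stack empty. -/
theorem nonempty_computableInPolyTime [Fintype K] [Finite σ] {Γ : Type} [Fintype Γ] {α β : Type}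
    {ea : α → List Γ} {eb : β → List Γ} {f : α → β} (p : Prog K σ Γ) (k₀ k₁ : K) (v₀ : σ)
    (P : Polynomial ℕ)
    (h : ∀ a, ∃ v' n, n ≤ P.eval (ea a).length ∧
      Exec p v₀ (Function.update (fun _ => []) k₀ (ea a)) v'
        (Function.update (fun _ => []) k₁ (eb (f a))) n) :
    Nonempty (Turing.TM2ComputableInPolyTime ea eb f) := by
  have key : ∀ a, ∃ n ≤ (P + 1).eval (ea a).length,
      (flip bind (p.machine k₀ k₁ v₀).step)^[n]
        (some (Turing.initList (p.machine k₀ k₁ v₀) (ea a))) =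
          some (Turing.haltList (p.machine k₀ k₁ v₀) (eb (f a))) := by
    intro a
    obtain ⟨v', n, hn, hexec⟩ := h a
    obtain ⟨o', h'⟩ := hexec.simulate (M := (p.machine k₀ k₁ v₀).m) some none (fun l => rfl) none
    refine ⟨n + 1, by simpa using hn, ?_⟩
    rw [Nat.add_comm, Function.iterate_add_apply]
    have e1 : Turing.initList (p.machine k₀ k₁ v₀) (ea a) =
        ⟨some (some p.entry), (v₀, none), Function.update (fun _ => []) k₀ (ea a)⟩ :=
      congrArg (Turing.TM2.Cfg.mk _ _) (dite_eq_update k₀ (ea a))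
    have e2 : Turing.haltList (p.machine k₀ k₁ v₀) (eb (f a)) =
        ⟨none, (v₀, none), Function.update (fun _ => []) k₁ (eb (f a))⟩ :=
      congrArg (Turing.TM2.Cfg.mk _ _) (dite_eq_update k₁ (eb (f a)))
    rw [e1, e2]
    refine (congrArg _ h').trans ?_
    rfl
  choose n hn hrun using key
  exact ⟨{
    tm := p.machine k₀ k₁ v₀
    inputAlphabet := Equiv.refl Γ
    outputAlphabet := Equiv.refl Γ
    time := P + 1
    outputsFun := fun a => {
      steps := n a
      evals_in_steps :=
        (congrArg (fun l => (flip bind (p.machine k₀ k₁ v₀).step)^[n a]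
          (some (Turing.initList (p.machine k₀ k₁ v₀) l))) (List.map_id (ea a))).trans
          ((hrun a).trans (congrArg (fun l => some (Turing.haltList (p.machine k₀ k₁ v₀) l))
            (List.map_id (eb (f a))).symm))
      steps_le_m := hn a } }⟩

end Prog

end SigmaRho

namespace SigmaRho

namespace Prog

variable {K σ Γ : Type} [DecidableEq K]

/-! ### Running times of programs -/

/-- The program `p` transforms `v` and `S` into `v'` and `S'` in at most `T` steps. -/
def Runs (p : Prog K σ Γ) (v : σ) (S : K → List Γ) (v' : σ) (S' : K → List Γ) (T : ℕ) : Prop :=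
  ∃ n ≤ T, Exec p v S v' S' n

variable {p q : Prog K σ Γ} {v v₁ v' : σ} {S S₁ S' : K → List Γ} {T T₁ T₂ : ℕ}

theorem Runs.mono (h : Runs p v S v' S' T₁) (hT : T₁ ≤ T₂) : Runs p v S v' S' T₂ := by
  obtain ⟨n, hn, h⟩ := h
  exact ⟨n, hn.trans hT, h⟩

theorem Runs.congr {v'' : σ} {S'' : K → List Γ} (h : Runs p v S v' S' T) (hv : v' = v'')
    (hS : S' = S'') : Runs p v S v'' S'' T := hv ▸ hS ▸ h

theorem Runs.seq (h₁ : Runs p v S v₁ S₁ T₁) (h₂ : Runs q v₁ S₁ v' S' T₂) :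
    Runs (seq p q) v S v' S' (T₁ + T₂) := by
  obtain ⟨n₁, hn₁, h₁⟩ := h₁
  obtain ⟨n₂, hn₂, h₂⟩ := h₂
  exact ⟨n₁ + n₂, Nat.add_le_add hn₁ hn₂, h₁.seq h₂⟩

theorem runs_push (k : K) (a : Γ) (v : σ) (S : K → List Γ) :
    Runs (push k a) v S v (Function.update S k (a :: S k)) 1 := ⟨1, le_rfl, .push ..⟩

theorem runs_set (f : σ → σ) (v : σ) (S : K → List Γ) :
    Runs (set f) v S (f v) S 1 := ⟨1, le_rfl, .set ..⟩

theorem Runs.switch {p : σ → Prog K σ Γ} (h : Runs (p v) v S v' S' T) :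
    Runs (switch p) v S v' S' (T + 1) := by
  obtain ⟨n, hn, h⟩ := h
  exact ⟨n + 1, by lia, h.switch⟩

theorem Runs.loop_final {k : K} {c : Option Γ → Bool} {p : Option Γ → Prog K σ Γ}
    (hc : c (S k).head? = false)
    (h : Runs (p (S k).head?) v (Function.update S k (S k).tail) v' S' T) :
    Runs (loop k c p) v S v' S' (T + 1) := by
  obtain ⟨n, hn, h⟩ := h
  exact ⟨n + 1, by lia, h.loop_final hc⟩

theorem Runs.loop_again {k : K} {c : Option Γ → Bool} {p : Option Γ → Prog K σ Γ}
    (hc : c (S k).head? = true)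
    (h₁ : Runs (p (S k).head?) v (Function.update S k (S k).tail) v₁ S₁ T₁)
    (h₂ : Runs (loop k c p) v₁ S₁ v' S' T₂) :
    Runs (loop k c p) v S v' S' (T₁ + T₂ + 1) := by
  obtain ⟨n₁, hn₁, h₁⟩ := h₁
  obtain ⟨n₂, hn₂, h₂⟩ := h₂
  exact ⟨n₁ + n₂ + 1, by lia, h₁.loop_again hc h₂⟩

/-- The program that does nothing. -/
def skip : Prog K σ Γ := set id

theorem runs_skip (v : σ) (S : K → List Γ) : Runs skip v S v S 1 := runs_set id v S

/-- Sequential composition of a list of programs. -/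
def block : List (Prog K σ Γ) → Prog K σ Γ
  | [] => skip
  | p :: l => seq p (block l)

theorem runs_block_nil (v : σ) (S : K → List Γ) : Runs (block []) v S v S 1 := runs_skip v S

theorem Runs.block_cons {l : List (Prog K σ Γ)} (h₁ : Runs p v S v₁ S₁ T₁)
    (h₂ : Runs (block l) v₁ S₁ v' S' T₂) : Runs (block (p :: l)) v S v' S' (T₁ + T₂) :=
  h₁.seq h₂

/-! ### Moving words between stacks -/

/-- The stacks after pushing the symbols of the word `w`, one after the other, on each of the
stacks `ds`. -/
def addTo (S : K → List Γ) (ds : List K) (w : List Γ) : K → List Γ :=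
  fun k => if k ∈ ds then w.reverse ++ S k else S k

/-- The stacks after moving the word `w` from the stack `src`, on which `rest` remains, to each of
the stacks `ds`. -/
def feed (S : K → List Γ) (src : K) (rest : List Γ) (ds : List K) (w : List Γ) : K → List Γ :=
  Function.update (addTo S ds w) src rest

theorem feed_feed {src : K} {ds : List K} (h : src ∉ ds) (S : K → List Γ) (r₁ r₂ w₁ w₂ : List Γ) :
    feed (feed S src r₁ ds w₁) src r₂ ds w₂ = feed S src r₂ ds (w₁ ++ w₂) := by
  funext k
  by_cases hk : k = src
  · subst hk
    simp [feed]
  · by_cases hk' : k ∈ ds <;> simp [feed, addTo, hk, hk']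

theorem feed_self (S : K → List Γ) (src : K) (ds : List K) : feed S src (S src) ds [] = S := by
  funext k
  by_cases hk : k = src
  · subst hk
    simp [feed]
  · by_cases hk' : k ∈ ds <;> simp [feed, addTo, hk, hk']

@[simp] theorem feed_src (S : K → List Γ) (src : K) (rest : List Γ) (ds : List K) (w : List Γ) :
    feed S src rest ds w src = rest := by
  simp [feed]

theorem feed_of_mem {src k : K} {ds : List K} (hk : k ≠ src) (hk' : k ∈ ds) (S : K → List Γ)
    (rest w : List Γ) : feed S src rest ds w k = w.reverse ++ S k := by
  simp [feed, addTo, hk, hk']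

theorem feed_of_notMem {src k : K} {ds : List K} (hk : k ≠ src) (hk' : k ∉ ds) (S : K → List Γ)
    (rest w : List Γ) : feed S src rest ds w k = S k := by
  simp [feed, addTo, hk, hk']

theorem feed_nil (S : K → List Γ) (src : K) (rest w : List Γ) :
    feed S src rest [] w = Function.update S src rest := by
  funext k
  by_cases hk : k = src
  · subst hk
    simp [feed]
  · simp [feed, addTo, hk]

theorem feed_singleton {src dst : K} (h : src ≠ dst) (S : K → List Γ) (rest w : List Γ) :
    feed S src rest [dst] w =
      Function.update (Function.update S src rest) dst (w.reverse ++ S dst) := by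
  funext k
  by_cases hk : k = src
  · subst hk
    simp [feed, h]
  · by_cases hk' : k = dst
    · subst hk'
      simp [feed, addTo, hk]
    · simp [feed, addTo, hk, hk']

/-- Pushes a symbol on each of the stacks `ds`. -/
def pushes (ds : List K) (a : Γ) : Prog K σ Γ := block (ds.map fun k => push k a)

theorem runs_pushes {ds : List K} (h : ds.Nodup) (a : Γ) (v : σ) (S : K → List Γ) :
    Runs (pushes ds a) v S v (addTo S ds [a]) (ds.length + 1) := by
  induction ds generalizing S with
  | nil => exact (runs_block_nil v S).congr rfl (by funext k; simp [addTo])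
  | cons d ds ih =>
    rw [List.nodup_cons] at h
    refine (((runs_push d a v S).block_cons (ih h.2 _)).congr rfl ?_).mono ?_
    · funext k
      by_cases hk : k = d
      · subst hk
        simp [addTo, h.1]
      · by_cases hk' : k ∈ ds <;> simp [addTo, hk, hk']
    · simp
      lia

/-- Moves the whole content of the stack `src` to each of the stacks `ds`. -/
def teeAll (src : K) (ds : List K) : Prog K σ Γ :=
  loop src Option.isSome fun o => match o with
    | some a => pushes ds a
    | none => skip

theorem runs_teeAll {src : K} {ds : List K} (hnd : ds.Nodup) (hsrc : src ∉ ds) (v : σ)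
    (S : K → List Γ) :
    Runs (teeAll src ds) v S v (feed S src [] ds (S src))
      ((ds.length + 2) * ((S src).length + 1)) := by
  generalize hw : S src = w
  induction w generalizing S with
  | nil =>
    refine ((Runs.loop_final (by simp [hw]) ?_).congr rfl (?_ : S = _)).mono
      (?_ : 1 + 1 ≤ _)
    · rw [hw]
      refine (runs_skip v _).congr rfl ?_
      rw [List.tail_nil, ← hw, Function.update_eq_self]
    · rw [← hw, feed, hw]
      conv_lhs => rw [← feed_self S src ds, feed, hw]
    · simp
  | cons a w ih =>
    have h1 := runs_pushes (σ := σ) hnd a v (Function.update S src w)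
    have h2 := ih (addTo (Function.update S src w) ds [a]) (by simp [addTo, hsrc])
    refine ((Runs.loop_again (by simp [hw]) (by simpa [hw] using h1) h2).congr rfl ?_).mono ?_
    · have : addTo (Function.update S src w) ds [a] = feed S src w ds [a] := by
        funext k
        by_cases hk : k = src
        · subst hk
          simp [feed, addTo, hsrc]
        · simp [feed, addTo, hk]
      rw [this, feed_feed hsrc]
      rfl
    · simp only [List.length_cons]
      ring_nf
      lia

theorem runs_move {src dst : K} (h : src ≠ dst) (v : σ) (S : K → List Γ) :
    Runs (teeAll src [dst]) v S v
      (Function.update (Function.update S src []) dst ((S src).reverse ++ S dst))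
      (3 * ((S src).length + 1)) :=
  (runs_teeAll (by simp) (by simpa using h) v S).congr rfl (feed_singleton h _ _ _)

theorem runs_clear (src : K) (v : σ) (S : K → List Γ) :
    Runs (teeAll src []) v S v (Function.update S src []) (2 * ((S src).length + 1)) :=
  (runs_teeAll (by simp) (by simp) v S).congr rfl (feed_nil _ _ _ _)

/-! ### Reading encoded data -/

variable {f : σ → σ}

/-- On stacks satisfying `I`, the program `p` moves the word `w` from the stack `src` to each of the
stacks `ds` and applies `f` to the memory, in time linear in the length of `w`. -/
def Scans (I : (K → List Γ) → Prop) (src : K) (ds : List K) (p : Prog K σ Γ) (f : σ → σ)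
    (w : List Γ) (c : ℕ) : Prop :=
  ∀ v S rest, I S → S src = w ++ rest → Runs p v S (f v) (feed S src rest ds w) (c * w.length)

theorem Scans.mono {I : (K → List Γ) → Prop} {src : K} {ds : List K} {w : List Γ} {c c' : ℕ}
    (h : Scans I src ds p f w c) (hc : c ≤ c') : Scans I src ds p f w c' :=
  fun v S rest hI hS => (h v S rest hI hS).mono (Nat.mul_le_mul_right _ hc)

theorem Scans.seq {I : (K → List Γ) → Prop} {src : K} {ds : List K} {w₁ w₂ : List Γ} {c : ℕ}
    {f₁ f₂ : σ → σ} (hsrc : src ∉ ds)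
    (hI : ∀ S rest w, I S → I (feed S src rest ds w))
    (h₁ : Scans I src ds p f₁ w₁ c) (h₂ : Scans I src ds q f₂ w₂ c) :
    Scans I src ds (Prog.seq p q) (f₂ ∘ f₁) (w₁ ++ w₂) c := by
  intro v S rest hS hw
  have e₁ := h₁ v S (w₂ ++ rest) hS (by simpa using hw)
  have e₂ := h₂ (f₁ v) _ rest (hI S (w₂ ++ rest) w₁ hS) (feed_src _ _ _ _ _)
  refine ((e₁.seq e₂).congr rfl (feed_feed hsrc _ _ _ _ _)).mono ?_
  rw [List.length_append, Nat.mul_add]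

end Prog

end SigmaRho

namespace SigmaRho

namespace Prog

variable {K σ : Type} [DecidableEq K] {I : (K → List Sym) → Prop} {src : K} {ds : List K}
  {v : σ} {S : K → List Sym}

/-- Whether a popped symbol is a `tick`. -/
def isTick : Option Sym → Bool
  | some .tick => true
  | _ => false

/-- Whether a popped symbol is a `cons`. -/
def isCons : Option Sym → Bool
  | some .cons => true
  | _ => false

/-- Executes `body` for each entry of the encoded list on the stack `src`, and moves the list, up to
the final `nil`, to each of the stacks `ds`. -/
def eachList (src : K) (ds : List K) (body : Prog K σ Sym) : Prog K σ Sym :=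
  loop src isCons fun o => match o with
    | some .cons => seq (pushes ds .cons) body
    | _ => skip

theorem update_eq_feed (hsrc : src ∉ ds) (S : K → List Sym) (rest w : List Sym) :
    addTo (Function.update S src rest) ds w = feed S src rest ds w := by
  funext k
  by_cases hk : k = src
  · subst hk
    simp [feed, addTo, hsrc]
  · simp [feed, addTo, hk]

theorem feed_empty (S : K → List Sym) (src : K) (rest : List Sym) (ds : List K) :
    feed S src rest ds [] = Function.update S src rest := by
  funext k
  by_cases hk : k = src
  · subst hk
    simp [feed]
  · by_cases hk' : k ∈ ds <;> simp [feed, addTo, hk, hk']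

theorem runs_eachList {α : Type*} {enc : α → List Sym} {F : α → σ → σ} {body : Prog K σ Sym}
    (hnd : ds.Nodup) (hsrc : src ∉ ds) (hI : ∀ S rest w, I S → I (feed S src rest ds w))
    {c : ℕ} (hc : ds.length + 2 ≤ c) (l : List α)
    (hbody : ∀ a ∈ l, Scans I src ds body (F a) (enc a) c) (v : σ) (S : K → List Sym)
    (rest : List Sym) (hS : I S) (hw : S src = encodeList enc l ++ rest) :
    Runs (eachList src ds body) v S (l.foldl (fun v a => F a v) v)
      (feed S src rest ds (l.flatMap fun a => Sym.cons :: enc a))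
      (c * (l.flatMap fun a => Sym.cons :: enc a).length + 2) := by
  induction l generalizing v S with
  | nil =>
    refine ((Runs.loop_final (T := 1) (by simp [hw, encodeList, isCons]) ?_).mono (by lia))
    rw [List.flatMap_nil, feed_empty, hw]
    exact runs_skip v _
  | cons a l ih =>
    have hw' : S src = Sym.cons :: (enc a ++ (encodeList enc l ++ rest)) := by
      simp [hw, encodeList]
    have h1 := runs_pushes (σ := σ) hnd Sym.cons v
      (Function.update S src (enc a ++ (encodeList enc l ++ rest)))
    rw [update_eq_feed hsrc] at h1
    have h2 := hbody a List.mem_cons_self v _ (encodeList enc l ++ rest)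
      (hI S (enc a ++ (encodeList enc l ++ rest)) [Sym.cons] hS) (feed_src _ _ _ _ _)
    rw [feed_feed hsrc] at h2
    have h3 := ih (fun b hb => hbody b (List.mem_cons_of_mem _ hb)) (F a v) _
      (hI S (encodeList enc l ++ rest) ([Sym.cons] ++ enc a) hS) (feed_src _ _ _ _ _)
    rw [feed_feed hsrc] at h3
    refine ((Runs.loop_again (by simp [hw', isCons]) (by simpa [hw'] using h1.seq h2) h3).congr
      rfl (by simp)).mono ?_
    simp only [List.flatMap_cons, List.length_append, List.length_cons, Nat.mul_add]
    lia

/-- Executes `body` for each entry of the encoded list on the stack `src`, and moves the list to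
each of the stacks `ds`. -/
def teeList (src : K) (ds : List K) (body : Prog K σ Sym) : Prog K σ Sym :=
  seq (eachList src ds body) (pushes ds .nil)

theorem scans_teeList {α : Type*} {enc : α → List Sym} {F : α → σ → σ} {body : Prog K σ Sym}
    (hnd : ds.Nodup) (hsrc : src ∉ ds) (hI : ∀ S rest w, I S → I (feed S src rest ds w))
    {c : ℕ} (hc : ds.length + 3 ≤ c) (l : List α)
    (hbody : ∀ a ∈ l, Scans I src ds body (F a) (enc a) c) :
    Scans I src ds (teeList src ds body) (fun v => l.foldl (fun v a => F a v) v)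
      (encodeList enc l) c := by
  intro v S rest hS hw
  have h1 := runs_eachList hnd hsrc hI (by lia) l hbody v S rest hS hw
  have h2 := runs_pushes (σ := σ) hnd Sym.nil (l.foldl (fun v a => F a v) v)
    (feed S src rest ds (l.flatMap fun a => Sym.cons :: enc a))
  refine ((h1.seq h2).congr rfl ?_).mono ?_
  · rw [encodeList, ← feed_feed hsrc S rest rest]
    funext k
    by_cases hk : k = src
    · subst hk
      simp [addTo, hsrc]
    · simp [feed, hk]
  · simp only [encodeList, List.length_append, List.length_singleton, Nat.mul_add]
    lia

theorem Scans.congr {p : Prog K σ Sym} {f f' : σ → σ} {w : List Sym} {c : ℕ}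
    (h : Scans I src ds p f w c) (hf : ∀ v, f v = f' v) : Scans I src ds p f' w c :=
  fun v S rest hI hS => (h v S rest hI hS).congr (hf v) rfl

theorem foldl_id_eq {α : Type*} (l : List α) (v : σ) : l.foldl (fun v _ => id v) v = v := by
  induction l with
  | nil => rfl
  | cons a l ih => exact ih

theorem scans_teeList_id {α : Type*} {enc : α → List Sym} {body : Prog K σ Sym}
    (hnd : ds.Nodup) (hsrc : src ∉ ds) (hI : ∀ S rest w, I S → I (feed S src rest ds w))
    {c : ℕ} (hc : ds.length + 3 ≤ c) (l : List α)
    (hbody : ∀ a ∈ l, Scans I src ds body id (enc a) c) :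
    Scans I src ds (teeList src ds body) id (encodeList enc l) c :=
  (scans_teeList (F := fun _ => id) hnd hsrc hI hc l hbody).congr fun v => foldl_id_eq l v

/-- Moves an encoded number from the stack `src` to each of the stacks `ds`. -/
def teeNum (src : K) (ds : List K) : Prog K σ Sym :=
  loop src isTick fun o => match o with
    | some a => pushes ds a
    | none => skip

theorem scans_teeNum (hnd : ds.Nodup) (hsrc : src ∉ ds) (k : ℕ) :
    Scans I src ds (teeNum src ds : Prog K σ Sym) id (encodeNat k) (ds.length + 2) := by
  intro v S rest hI hw
  clear hI
  induction k generalizing S with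
  | zero =>
    have h1 := runs_pushes (σ := σ) hnd Sym.mark v (Function.update S src rest)
    rw [update_eq_feed hsrc] at h1
    have hw' : S src = Sym.mark :: rest := hw
    refine ((Runs.loop_final (by simp [hw', isTick]) (by simpa [hw'] using h1)).congr rfl
      ?_).mono (by simp [encodeNat])
    rfl
  | succ k ih =>
    have hw' : S src = Sym.tick :: (encodeNat k ++ rest) := by
      simp [hw, encodeNat, List.replicate_succ]
    have h1 := runs_pushes (σ := σ) hnd Sym.tick v (Function.update S src (encodeNat k ++ rest))
    rw [update_eq_feed hsrc] at h1
    have h2 := ih (feed S src (encodeNat k ++ rest) ds [Sym.tick]) (feed_src _ _ _ _ _)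
    rw [feed_feed hsrc] at h2
    refine ((Runs.loop_again (by simp [hw', isTick]) (by simpa [hw'] using h1) h2).congr
      rfl ?_).mono ?_
    · simp [encodeNat, List.replicate_succ]
    · simp only [encodeNat, List.length_append, List.length_replicate, List.length_singleton]
      ring_nf
      lia

/-- Moves an encoded number from the stack `src` to each of the stacks `ds`, and adds it to the
number of ticks on the stack `r`. -/
def readNum (src r : K) (ds : List K) : Prog K σ Sym :=
  loop src isTick fun o => match o with
    | some .tick => seq (pushes ds .tick) (push r .tick)
    | some a => pushes ds a
    | none => skip

theorem runs_readNum (hnd : ds.Nodup) (hsrc : src ∉ ds) {r : K} (hr : r ≠ src) (hrd : r ∉ ds)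
    (k : ℕ) (v : σ) (S : K → List Sym) (rest : List Sym) (hw : S src = encodeNat k ++ rest) :
    Runs (readNum src r ds) v S v (Function.update (feed S src rest ds (encodeNat k)) r
      (List.replicate k Sym.tick ++ S r)) ((ds.length + 3) * (k + 1)) := by
  induction k generalizing S with
  | zero =>
    have h1 := runs_pushes (σ := σ) hnd Sym.mark v (Function.update S src rest)
    rw [update_eq_feed hsrc] at h1
    have hw' : S src = Sym.mark :: rest := hw
    refine ((Runs.loop_final (by simp [hw', isTick]) (by simpa [hw'] using h1)).congr rfl ?_).mono
      (by simp)
    rw [show List.replicate 0 Sym.tick ++ S r = feed S src rest ds (encodeNat 0) r by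
      simp [feed_of_notMem hr hrd], Function.update_eq_self]
    rfl
  | succ k ih =>
    have hw' : S src = Sym.tick :: (encodeNat k ++ rest) := by
      simp [hw, encodeNat, List.replicate_succ]
    have h1 := runs_pushes (σ := σ) hnd Sym.tick v (Function.update S src (encodeNat k ++ rest))
    rw [update_eq_feed hsrc] at h1
    have h1' := h1.seq (runs_push r Sym.tick v _)
    rw [feed_of_notMem hr hrd] at h1'
    have h2 := ih (Function.update (feed S src (encodeNat k ++ rest) ds [Sym.tick]) r
      (Sym.tick :: S r)) (by rw [Function.update_of_ne hr.symm, feed_src])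
    refine ((Runs.loop_again (by simp [hw', isTick]) (by simpa [hw'] using h1') h2).congr
      rfl ?_).mono ?_
    · funext x
      by_cases hx : x = r
      · subst hx
        simp [List.replicate_succ']
      · by_cases hx' : x = src
        · subst hx'
          simp [hx]
        · by_cases hx2 : x ∈ ds
          · simp [hx, feed_of_mem hx' hx2, encodeNat, List.replicate_succ]
          · simp [hx, feed_of_notMem hx' hx2]
    · ring_nf
      lia

/-- Pushes the encoding of `j` plus the number of ticks on the stack `r` on the stack `dst`; the
stack `aux` is used to restore `r`. -/
def emitNum (r aux dst : K) (j : ℕ) : Prog K σ Sym :=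
  block [teeAll r [aux, dst], teeAll aux [r], block (List.replicate j (push dst .tick)),
    push dst .mark]

theorem runs_replicate_push (dst : K) (a : Sym) (j : ℕ) (v : σ) (S : K → List Sym) :
    Runs (block (List.replicate j (push dst a))) v S v
      (Function.update S dst (List.replicate j a ++ S dst)) (j + 1) := by
  induction j generalizing S with
  | zero => exact (runs_block_nil v S).congr rfl (by simp)
  | succ j ih =>
    refine (((runs_push dst a v S).block_cons (ih _)).congr rfl ?_).mono (by lia)
    simp [List.replicate_succ']

theorem runs_emitNum {r aux dst : K} (h1 : r ≠ aux) (h2 : r ≠ dst) (h3 : aux ≠ dst) {a : ℕ}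
    (j : ℕ) (v : σ) (S : K → List Sym) (hr : S r = List.replicate a Sym.tick) (haux : S aux = []) :
    Runs (emitNum r aux dst j) v S v
      (Function.update S dst ((encodeNat (a + j)).reverse ++ S dst)) (7 * a + j + 12) := by
  have e1 := runs_teeAll (σ := σ) (src := r) (ds := [aux, dst]) (by simpa using h3)
    (by simp [h1, h2]) v S
  have e2 := runs_teeAll (σ := σ) (src := aux) (ds := [r]) (by simp) (by simpa using h1.symm) v
    (feed S r [] [aux, dst] (S r))
  have e3 := runs_replicate_push dst Sym.tick j v
    (feed (feed S r [] [aux, dst] (S r)) aux [] [r] (feed S r [] [aux, dst] (S r) aux))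
  refine ((e1.block_cons (e2.block_cons (e3.block_cons
    ((runs_push dst Sym.mark v _).block_cons (runs_block_nil v _))))).congr rfl ?_).mono ?_
  · funext k
    by_cases hk : k = dst
    · subst hk
      simp only [feed, addTo, ne_eq, h2.symm, h3.symm, hr, encodeNat, not_false_eq_true,
        Function.update_of_ne, Function.update_self, List.mem_cons,
        or_true, or_false, if_true, if_false, List.not_mem_nil, List.reverse_replicate,
        List.reverse_append, List.reverse_singleton, List.cons_append]
      rw [← List.append_assoc, List.replicate_append_replicate, Nat.add_comm,
        List.nil_append]
    · by_cases hk1 : k = r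
      · subst hk1
        simp [feed, addTo, hk, h1, h1.symm, haux, hr]
      · by_cases hk2 : k = aux
        · subst hk2
          simp [feed, hk, haux]
        · simp [feed, addTo, hk, hk1, hk2]
  · simp [feed_of_mem h1.symm, hr, haux]
    lia

end Prog

end SigmaRho

namespace SigmaRho

/-! ### Registers of the reduction program -/

/-- The stacks of the program. Stack `pos i` holds the vertex at position `i` of the scope that is
being processed, in unary. -/
inductive Reg (d : ℕ) : Type
  | inp | out | num | rel | edge | bag | cur | cura | posa | cpy | tmp
  | pos (i : Fin d)
  deriving DecidableEq, Fintype

/-- The contents of all stacks. -/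
structure Mem (d : ℕ) where
  inp : List Sym := []
  out : List Sym := []
  num : List Sym := []
  rel : List Sym := []
  edge : List Sym := []
  bag : List Sym := []
  cur : List Sym := []
  cura : List Sym := []
  posa : List Sym := []
  cpy : List Sym := []
  tmp : List Sym := []
  pos : Fin d → List Sym := fun _ => []

/-- The contents of all stacks, as a function. -/
def Mem.stk {d : ℕ} (M : Mem d) : Reg d → List Sym
  | .inp => M.inp
  | .out => M.out
  | .num => M.num
  | .rel => M.rel
  | .edge => M.edge
  | .bag => M.bag
  | .cur => M.cur
  | .cura => M.cura
  | .posa => M.posa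
  | .cpy => M.cpy
  | .tmp => M.tmp
  | .pos i => M.pos i

section

variable {d : ℕ} (M : Mem d) (w : List Sym)

theorem Mem.exists_stk (S : Reg d → List Sym) : ∃ M : Mem d, M.stk = S :=
  ⟨⟨S .inp, S .out, S .num, S .rel, S .edge, S .bag, S .cur, S .cura, S .posa, S .cpy, S .tmp,
    fun i => S (.pos i)⟩, by funext k; cases k <;> rfl⟩

@[simp] theorem Mem.stk_inp : M.stk .inp = M.inp := rfl
@[simp] theorem Mem.stk_out : M.stk .out = M.out := rfl
@[simp] theorem Mem.stk_num : M.stk .num = M.num := rfl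
@[simp] theorem Mem.stk_rel : M.stk .rel = M.rel := rfl
@[simp] theorem Mem.stk_edge : M.stk .edge = M.edge := rfl
@[simp] theorem Mem.stk_bag : M.stk .bag = M.bag := rfl
@[simp] theorem Mem.stk_cur : M.stk .cur = M.cur := rfl
@[simp] theorem Mem.stk_cura : M.stk .cura = M.cura := rfl
@[simp] theorem Mem.stk_posa : M.stk .posa = M.posa := rfl
@[simp] theorem Mem.stk_cpy : M.stk .cpy = M.cpy := rfl
@[simp] theorem Mem.stk_tmp : M.stk .tmp = M.tmp := rfl
@[simp] theorem Mem.stk_pos (i : Fin d) : M.stk (.pos i) = M.pos i := rfl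

@[simp] theorem Mem.update_inp :
    Function.update M.stk .inp w = Mem.stk { M with inp := w } := by
  funext k; cases k <;> simp

@[simp] theorem Mem.update_out :
    Function.update M.stk .out w = Mem.stk { M with out := w } := by
  funext k; cases k <;> simp

@[simp] theorem Mem.update_num :
    Function.update M.stk .num w = Mem.stk { M with num := w } := by
  funext k; cases k <;> simp

@[simp] theorem Mem.update_rel :
    Function.update M.stk .rel w = Mem.stk { M with rel := w } := by
  funext k; cases k <;> simp

@[simp] theorem Mem.update_edge :
    Function.update M.stk .edge w = Mem.stk { M with edge := w } := by
  funext k; cases k <;> simp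

@[simp] theorem Mem.update_bag :
    Function.update M.stk .bag w = Mem.stk { M with bag := w } := by
  funext k; cases k <;> simp

@[simp] theorem Mem.update_cur :
    Function.update M.stk .cur w = Mem.stk { M with cur := w } := by
  funext k; cases k <;> simp

@[simp] theorem Mem.update_cura :
    Function.update M.stk .cura w = Mem.stk { M with cura := w } := by
  funext k; cases k <;> simp

@[simp] theorem Mem.update_posa :
    Function.update M.stk .posa w = Mem.stk { M with posa := w } := by
  funext k; cases k <;> simp

@[simp] theorem Mem.update_cpy :
    Function.update M.stk .cpy w = Mem.stk { M with cpy := w } := by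
  funext k; cases k <;> simp

@[simp] theorem Mem.update_tmp :
    Function.update M.stk .tmp w = Mem.stk { M with tmp := w } := by
  funext k; cases k <;> simp

@[simp] theorem Mem.update_pos (i : Fin d) :
    Function.update M.stk (.pos i) w = Mem.stk { M with pos := Function.update M.pos i w } := by
  funext k
  cases k with
  | pos j =>
    by_cases h : j = i
    · subst h; simp
    · simp [h]
  | _ => simp

end

/-- The memory of the program: the length of the scope, the positions of the scope found so far in
the list that is being read, the relation read so far, the outcome of a comparison, and whether a
bag has been inserted. -/
structure PState (d : ℕ) where
  len : Fin (d + 1)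
  mask : Fin d → Bool
  table : Finset (Fin d → Bool)
  flag : Bool
  done : Bool

instance (d : ℕ) : Finite (PState d) :=
  Finite.of_injective (β := Fin (d + 1) × (Fin d → Bool) × Finset (Fin d → Bool) × Bool × Bool)
    (fun v => (v.len, v.mask, v.table, v.flag, v.done)) (by
      rintro ⟨_, _, _, _, _⟩ ⟨_, _, _, _, _⟩ h
      simpa using h)

instance : Fintype Sym where
  elems := ⟨↑[Sym.tick, Sym.mark, Sym.cons, Sym.nil], by simp⟩
  complete a := by cases a <;> simp

namespace Prog

variable {d : ℕ}

@[simp] theorem addTo_nil {K : Type} [DecidableEq K] (S : K → List Sym) (w : List Sym) :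
    addTo S [] w = S := by
  funext k; simp [addTo]

@[simp] theorem addTo_cons {K : Type} [DecidableEq K] (S : K → List Sym) (k : K) (ds : List K)
    (w : List Sym) :
    addTo S (k :: ds) w = Function.update (addTo S ds w) k (w.reverse ++ S k) := by
  funext x
  by_cases hx : x = k
  · subst hx; simp [addTo]
  · simp [addTo, hx]

/-! ### Comparing numbers -/

/-- Pops a symbol of `pos i` for each symbol on `cur`, and records whether there are enough. -/
def compareLoop (i : Fin d) : Prog (Reg d) (PState d) Sym :=
  loop .cur Option.isSome fun o => match o with
    | some _ => seq (push .cura .tick) (loop (.pos i) (fun _ => false) fun o => match o with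
        | some _ => push .posa .tick
        | none => set fun v => { v with flag := false })
    | none => skip

theorem runs_compareLoop (i : Fin d) (a b : ℕ) (v : PState d) (M : Mem d)
    (hc : M.cur = List.replicate a Sym.tick) (hp : M.pos i = List.replicate b Sym.tick) :
    Runs (compareLoop i) v M.stk { v with flag := v.flag && decide (a ≤ b) }
      (Mem.stk { M with
        cur := []
        cura := List.replicate a Sym.tick ++ M.cura
        posa := List.replicate (min a b) Sym.tick ++ M.posa
        pos := Function.update M.pos i (List.replicate (b - a) Sym.tick) }) (4 * a + 2) := by
  induction a generalizing b v M with
  | zero =>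
    refine ((Runs.loop_final (T := 1) (by simp [hc]) ?_).congr rfl rfl).mono (by lia)
    simp only [Mem.stk_cur, hc, List.replicate_zero, List.head?_nil, List.tail_nil,
      Mem.update_cur]
    refine (runs_skip v (Mem.stk _)).congr ?_ ?_
    · simp
    · simp [← hp]
  | succ a ih =>
    cases b with
    | zero =>
      have h2 := ih 0 { v with flag := false } { M with
        cur := List.replicate a Sym.tick
        cura := Sym.tick :: M.cura
        pos := Function.update M.pos i [] } rfl (by simp)
      refine ((Runs.loop_again (T₁ := 3) (by simp [hc, List.replicate_succ]) ?_ h2).congr ?_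
        ?_).mono (by lia)
      · simp only [Mem.stk_cur, hc, List.replicate_succ, List.head?_cons, List.tail_cons,
          Mem.update_cur]
        refine (runs_push _ _ _ _).seq ((Runs.loop_final (T := 1) rfl ?_).congr rfl rfl)
        simp only [Mem.stk_cura, Mem.update_cura, Mem.stk_pos, hp, List.replicate_zero,
          List.head?_nil, List.tail_nil, Mem.update_pos]
        exact runs_set _ _ _
      · simp
      · simp [List.replicate_succ']
    | succ b =>
      have h2 := ih b v { M with
        cur := List.replicate a Sym.tick
        cura := Sym.tick :: M.cura
        posa := Sym.tick :: M.posa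
        pos := Function.update M.pos i (List.replicate b Sym.tick) } rfl (by simp)
      refine ((Runs.loop_again (T₁ := 3) (by simp [hc, List.replicate_succ]) ?_ h2).congr ?_
        ?_).mono (by lia)
      · simp only [Mem.stk_cur, hc, List.replicate_succ, List.head?_cons, List.tail_cons,
          Mem.update_cur]
        refine (runs_push _ _ _ _).seq ((Runs.loop_final (T := 1) rfl ?_).congr rfl rfl)
        simp only [Mem.stk_cura, Mem.update_cura, Mem.stk_pos, hp, List.replicate_succ,
          List.head?_cons, List.tail_cons, Mem.update_pos]
        exact (runs_push _ _ _ _).congr rfl (by simp)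
      · simp
      · simp [List.replicate_succ', Nat.succ_min_succ]

/-- Resets the flag if the number on `pos i` is positive. -/
def testZero (i : Fin d) : Prog (Reg d) (PState d) Sym :=
  loop (.pos i) (fun _ => false) fun o => match o with
    | some _ => seq (push (.pos i) .tick) (set fun v => { v with flag := false })
    | none => skip

theorem runs_testZero (i : Fin d) (b : ℕ) (v : PState d) (M : Mem d)
    (hp : M.pos i = List.replicate b Sym.tick) :
    Runs (testZero i) v M.stk { v with flag := v.flag && decide (b = 0) } M.stk 3 := by
  refine Runs.loop_final (T := 2) rfl ?_
  cases b with
  | zero =>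
    simp only [Mem.stk_pos, hp, List.replicate_zero, List.head?_nil, List.tail_nil,
      Mem.update_pos]
    refine ((runs_skip v (Mem.stk _)).congr ?_ ?_).mono (by lia)
    · simp
    · rw [show Function.update M.pos i [] = M.pos by
        rw [← List.replicate_zero (a := Sym.tick), ← hp, Function.update_eq_self]]
  | succ b =>
    simp only [Mem.stk_pos, hp, List.replicate_succ, List.head?_cons, List.tail_cons,
      Mem.update_pos]
    refine ((runs_push _ _ v (Mem.stk _)).seq (runs_set _ _ _)).congr ?_ ?_
    · simp
    · simp [← List.replicate_succ, ← hp]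

/-- Adds position `i` of the scope to the mask if the number on `cur` is the vertex there. -/
def compare (i : Fin d) : Prog (Reg d) (PState d) Sym :=
  block [set fun v => { v with flag := true }, compareLoop i, testZero i,
    teeAll .cura [.cur], teeAll .posa [.pos i],
    set fun v => { v with
      mask := Function.update v.mask i (v.mask i || (decide (i.val < v.len.val) && v.flag))
      flag := false }]

theorem runs_compare (i : Fin d) (a b : ℕ) (v : PState d) (M : Mem d)
    (hc : M.cur = List.replicate a Sym.tick) (hp : M.pos i = List.replicate b Sym.tick)
    (hc' : M.cura = []) (hp' : M.posa = []) :
    Runs (compare i) v M.stk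
      { v with
        mask := Function.update v.mask i
          (v.mask i || (decide (i.val < v.len.val) && decide (b = a)))
        flag := false }
      M.stk (10 * a + 16) := by
  have e1 := runs_set (fun v : PState d => { v with flag := true }) v M.stk
  have e2 := runs_compareLoop i a b { v with flag := true } M hc hp
  have e3 := runs_testZero i (b - a) { v with flag := true && decide (a ≤ b) } { M with
        cur := []
        cura := List.replicate a Sym.tick ++ M.cura
        posa := List.replicate (min a b) Sym.tick ++ M.posa
        pos := Function.update M.pos i (List.replicate (b - a) Sym.tick) } (by simp)
  have e4 := runs_move (src := Reg.cura) (dst := Reg.cur) (by simp)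
    { v with flag := (true && decide (a ≤ b)) && decide (b - a = 0) } (Mem.stk { M with
        cur := []
        cura := List.replicate a Sym.tick ++ M.cura
        posa := List.replicate (min a b) Sym.tick ++ M.posa
        pos := Function.update M.pos i (List.replicate (b - a) Sym.tick) })
  have e5 := runs_move (src := Reg.posa) (dst := Reg.pos i) (by simp)
    { v with flag := (true && decide (a ≤ b)) && decide (b - a = 0) } (Mem.stk { M with
        posa := List.replicate (min a b) Sym.tick ++ M.posa
        pos := Function.update M.pos i (List.replicate (b - a) Sym.tick) })
  have hba : min a b + (b - a) = b := by lia
  obtain ⟨inp, out, num, rel, edge, bag, cur, cura, posa, cpy, tmp, pos⟩ := M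
  dsimp only at hc hp hc' hp'
  subst hc hc' hp'
  have hup : Function.update pos i (List.replicate b Sym.tick) = pos := by
    rw [← hp, Function.update_eq_self]
  simp [hba, hup] at e1 e2 e3 e4 e5
  refine ((e1.block_cons (e2.block_cons (e3.block_cons (e4.block_cons (e5.block_cons
    ((runs_set _ _ _).block_cons (runs_block_nil _ _))))))).congr ?_ ?_).mono ?_
  · have : (a ≤ b ∧ b ≤ a) ↔ b = a := by lia
    simp [← Bool.decide_and, Nat.sub_eq_zero_iff_le, this]
  · simp
  · lia

/-- The memory after reading the number `a`, if `p i` is the vertex at position `i` of the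
scope. -/
def markNum (p : Fin d → ℕ) (a : ℕ) (v : PState d) : PState d :=
  { v with
    mask := fun i => v.mask i || (decide (i.val < v.len.val) && decide (p i = a))
    flag := false }

theorem runs_compareAll (p : Fin d → ℕ) (a : ℕ) (v : PState d) (M : Mem d)
    (hc : M.cur = List.replicate a Sym.tick) (hp : ∀ i, M.pos i = List.replicate (p i) Sym.tick)
    (hc' : M.cura = []) (hp' : M.posa = []) :
    Runs (block (set (fun v => { v with flag := false }) :: (List.finRange d).map compare)) v M.stk
      (markNum p a v) M.stk (d * (10 * a + 16) + 2) := by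
  have key : ∀ (L : List (Fin d)) (v : PState d), v.flag = false →
      Runs (block (L.map compare)) v M.stk
        { v with mask := fun i => v.mask i || (decide (i ∈ L) && (decide (i.val < v.len.val) &&
          decide (p i = a))) } M.stk (L.length * (10 * a + 16) + 1) := by
    intro L
    induction L with
    | nil => exact fun v hv => ((runs_block_nil v M.stk).congr (by simp) rfl).mono (by simp)
    | cons i L ih =>
      intro v hv
      refine (((runs_compare i a (p i) v M hc (hp i) hc' hp').block_cons (ih _ rfl)).congr ?_
        rfl).mono ?_
      · simp only [PState.mk.injEq, hv, and_true, true_and]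
        funext j
        by_cases hj : j = i
        · subst hj
          by_cases hL : j ∈ L <;> simp [hL]
        · simp [hj]
      · rw [List.length_cons]
        ring_nf
        lia
  refine (((runs_set _ v M.stk).block_cons (key (List.finRange d) _ rfl)).congr ?_ rfl).mono ?_
  · simp [markNum]
  · rw [List.length_finRange]
    lia

/-- Moves an encoded number from the stack `src` to each of the stacks `ds`, and adds the position
of this number in the scope, if there is one, to the mask. -/
def scanNum (src : Reg d) (ds : List (Reg d)) : Prog (Reg d) (PState d) Sym :=
  block [readNum src .cur ds,
    block (set (fun v => { v with flag := false }) :: (List.finRange d).map compare),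
    teeAll .cur []]

/-- The stacks that are not used for comparing numbers. -/
def _root_.SigmaRho.Reg.isData : Reg d → Bool
  | .cur | .cura | .posa | .pos _ => false
  | _ => true

/-- The stacks used for comparing numbers are ready, and `p i` is stored as position `i` of the
scope. -/
def ScopeAt (p : Fin d → ℕ) (S : Reg d → List Sym) : Prop :=
  S .cur = [] ∧ S .cura = [] ∧ S .posa = [] ∧ ∀ i, S (.pos i) = List.replicate (p i) Sym.tick

theorem ScopeAt.feed {p : Fin d → ℕ} {S : Reg d → List Sym} (h : ScopeAt p S) {src : Reg d}
    {ds : List (Reg d)} (hs : ∀ r ∈ src :: ds, r.isData = true) (rest w : List Sym) :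
    ScopeAt p (feed S src rest ds w) := by
  have key : ∀ r : Reg d, r.isData = false → Prog.feed S src rest ds w r = S r := by
    intro r hr
    refine feed_of_notMem ?_ ?_ _ _ _
    · rintro rfl
      simp [hs r (by simp)] at hr
    · intro hr'
      simp [hs r (by simp [hr'])] at hr
  obtain ⟨h1, h2, h3, h4⟩ := h
  refine ⟨?_, ?_, ?_, fun i => ?_⟩ <;> rw [key _ rfl]
  exacts [h1, h2, h3, h4 i]

theorem scans_scanNum (p : Fin d → ℕ) {src : Reg d} {ds : List (Reg d)} (hnd : (src :: ds).Nodup)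
    (hs : ∀ r ∈ src :: ds, r.isData = true) (a : ℕ) :
    Scans (ScopeAt p) src ds (scanNum src ds) (markNum p a) (encodeNat a)
      (ds.length + 16 * d + 10) := by
  intro v S rest hS hw
  rw [List.nodup_cons] at hnd
  have hc : Reg.cur ≠ src := fun h => by simpa [← h, Reg.isData] using hs src (by simp)
  have hc' : Reg.cur ∉ ds := fun h => by
    simpa [Reg.isData] using hs .cur (by simp [h])
  have e1 := runs_readNum hnd.2 hnd.1 hc hc' a v S rest hw
  have hS' := hS.feed hs rest (encodeNat a)
  obtain ⟨M, hM⟩ := Mem.exists_stk (feed S src rest ds (encodeNat a))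
  rw [hS.1, List.append_nil, ← hM, Mem.update_cur] at e1
  rw [← hM] at hS' ⊢
  obtain ⟨h1, h2, h3, h4⟩ := hS'
  have e2 := runs_compareAll p a v { M with cur := List.replicate a Sym.tick } rfl h4 h2 h3
  have e3 := runs_clear (Reg.cur : Reg d) (markNum p a v)
    (Mem.stk { M with cur := List.replicate a Sym.tick })
  refine ((e1.block_cons (e2.block_cons (e3.block_cons (runs_block_nil _ _)))).congr rfl ?_).mono ?_
  · rw [Mem.update_cur]
    simp only [Mem.stk_cur] at h1
    rw [← h1]
  · simp only [Mem.stk_cur, encodeNat, List.length_append, List.length_replicate,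
      List.length_singleton]
    ring_nf
    nlinarith

/-- The memory after reading the list `l`, if `p i` is the vertex at position `i` of the scope. -/
def markList (p : Fin d → ℕ) (l : List ℕ) (v : PState d) : PState d :=
  l.foldl (fun v a => markNum p a v) v

theorem markList_eq (p : Fin d → ℕ) (l : List ℕ) (v : PState d) : ∃ b,
    markList p l v = { v with
      mask := fun i => v.mask i || (decide (i.val < v.len.val) && decide (p i ∈ l))
      flag := b } := by
  induction l generalizing v with
  | nil => exact ⟨v.flag, by simp [markList]⟩
  | cons a l ih =>
    obtain ⟨b, hb⟩ := ih (markNum p a v)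
    refine ⟨b, hb.trans ?_⟩
    simp only [markNum, PState.mk.injEq, true_and, and_true]
    funext i
    by_cases h : i.val < v.len.val <;> simp [h, Bool.or_assoc]

/-- Moves an encoded list of numbers from the stack `src` to each of the stacks `ds`, up to the
final `nil`, and adds the positions of its entries in the scope to the mask. -/
def scanList (src : Reg d) (ds : List (Reg d)) : Prog (Reg d) (PState d) Sym :=
  eachList src ds (scanNum src ds)

theorem runs_scanList (p : Fin d → ℕ) {src : Reg d} {ds : List (Reg d)} (hnd : (src :: ds).Nodup)
    (hs : ∀ r ∈ src :: ds, r.isData = true) (l : List ℕ) (v : PState d) (S : Reg d → List Sym)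
    (rest : List Sym) (hS : ScopeAt p S) (hw : S src = encodeList encodeNat l ++ rest) :
    Runs (scanList src ds) v S (markList p l v)
      (feed S src rest ds (l.flatMap fun a => Sym.cons :: encodeNat a))
      ((ds.length + 16 * d + 10) * (l.flatMap fun a => Sym.cons :: encodeNat a).length + 2) := by
  rw [List.nodup_cons] at hnd
  exact runs_eachList hnd.2 hnd.1 (fun S rest w h => h.feed hs rest w) (by lia) l
    (fun a _ => scans_scanNum p (List.nodup_cons.2 hnd) hs a) v S rest hS hw

end Prog

end SigmaRho

namespace SigmaRho

theorem encodeList_cons {α : Type*} (enc : α → List Sym) (a : α) (l : List α) :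
    encodeList enc (a :: l) = Sym.cons :: (enc a ++ encodeList enc l) := by
  simp [encodeList]

@[simp] theorem length_encodeNat (k : ℕ) : (encodeNat k).length = k + 1 := by
  simp [encodeNat]

namespace Prog

variable {d : ℕ}

/-! ### Reading a constraint -/

/-- The number `k`, truncated at `d`. -/
def mkLen (d k : ℕ) : Fin (d + 1) := ⟨min k d, by lia⟩

/-- The positions of a scope, in unary. -/
def posOf (d : ℕ) (l : List ℕ) : Fin d → List Sym := fun i => List.replicate (l.getD i 0) Sym.tick

theorem posOf_nil : posOf d [] = fun _ => [] := by
  funext i; simp [posOf]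

/-- Reads the scope of a constraint. -/
def readScope : Prog (Reg d) (PState d) Sym :=
  loop .rel isCons fun o => match o with
    | some .cons => switch fun v =>
        if h : v.len.val < d then
          seq (readNum .rel (.pos ⟨v.len.val, h⟩) [])
            (set fun v => { v with len := mkLen d (v.len.val + 1) })
        else skip
    | _ => skip

theorem runs_readScope (pre l : List ℕ) (h : pre.length + l.length ≤ d) (v : PState d) (M : Mem d)
    (hv : v.len.val = pre.length) (hpos : M.pos = posOf d pre) (rest : List Sym)
    (hw : M.rel = encodeList encodeNat l ++ rest) :
    Runs readScope v M.stk { v with len := mkLen d (pre.length + l.length) }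
      (Mem.stk { M with rel := rest, pos := posOf d (pre ++ l) })
      (5 * (encodeList encodeNat l).length) := by
  induction l generalizing pre v M with
  | nil =>
    refine ((Runs.loop_final (T := 1) (by simp [hw, encodeList, isCons]) ?_).mono
      (by simp [encodeList]))
    simp only [Mem.stk_rel, hw, encodeList, List.flatMap_nil, List.nil_append, List.cons_append,
      List.head?_cons, List.tail_cons, Mem.update_rel, List.append_nil]
    refine (runs_skip v (Mem.stk _)).congr ?_ ?_
    · have : v.len = mkLen d (pre.length + 0) := Fin.ext (by simp [mkLen]; lia)
      simp only [List.length_nil, ← this]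
    · rw [← hpos]
  | cons a l ih =>
    rw [List.length_cons] at h
    have hlt : v.len.val < d := by lia
    have e1 := runs_readNum (σ := PState d) (ds := []) (src := Reg.rel)
      (r := Reg.pos ⟨v.len.val, hlt⟩) (by simp)
      (by simp) (by simp) (by simp) a v
      (Mem.stk { M with rel := encodeNat a ++ (encodeList encodeNat l ++ rest) })
      (encodeList encodeNat l ++ rest) (by simp)
    have hup : Function.update M.pos ⟨v.len.val, hlt⟩
        (List.replicate a Sym.tick ++ M.pos ⟨v.len.val, hlt⟩) = posOf d (pre ++ [a]) := by
      funext i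
      by_cases hi : i.val = pre.length
      · obtain rfl : i = ⟨v.len.val, hlt⟩ := Fin.ext (by simp [hi, hv])
        simp [hpos, posOf, hv]
      · rw [Function.update_of_ne (fun h => hi (by simp [h, hv])), hpos]
        simp only [posOf]
        congr 1
        rcases lt_or_gt_of_ne hi with hi | hi
        · rw [List.getD_append _ _ _ _ hi]
        · rw [List.getD_append_right _ _ _ _ hi.le, List.getD_eq_default _ _ hi.le,
            List.getD_eq_default _ _ (by simp; lia)]
    rw [feed_nil] at e1
    simp only [Mem.update_rel, Mem.stk_pos, Mem.update_pos, hup] at e1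
    have e2 := ih (pre ++ [a]) (by simp; lia) { v with len := mkLen d (v.len.val + 1) }
      { M with rel := encodeList encodeNat l ++ rest, pos := posOf d (pre ++ [a]) }
      (by simp [mkLen, hv]; lia) rfl rfl
    refine ((Runs.loop_again (T₁ := 3 * (a + 1) + 1 + 1) (by simp [hw, encodeList_cons, isCons]) ?_
      e2).congr ?_ ?_).mono ?_
    · simp only [Mem.stk_rel, hw, encodeList_cons, List.cons_append, List.append_assoc,
        List.head?_cons, List.tail_cons, Mem.update_rel]
      refine Runs.switch ?_
      rw [dif_pos hlt]
      exact e1.seq (runs_set _ _ _)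
    · simp only [List.length_append, List.length_cons, List.length_nil]
      congr 2
      lia
    · simp
    · rw [encodeList_cons]
      simp only [List.length_cons, List.length_append, length_encodeNat]
      lia

/-- The vertices at the positions of a scope. -/
def scopePos (d : ℕ) (l : List ℕ) : Fin d → ℕ := fun i => l.getD i 0

theorem scopeAt_stk {M : Mem d} {l : List ℕ} (h1 : M.cur = []) (h2 : M.cura = [])
    (h3 : M.posa = []) (h4 : M.pos = posOf d l) : ScopeAt (scopePos d l) M.stk :=
  ⟨h1, h2, h3, fun i => by rw [Mem.stk_pos, h4]; rfl⟩

theorem markList_mask {l : List ℕ} (A : List ℕ) (v : PState d) (hv : v.len.val = l.length) :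
    ∃ b, markList (scopePos d l) A { v with mask := fun _ => false } = { v with
      mask := selMask d l (fun v => decide (v ∈ A))
      flag := b } := by
  obtain ⟨b, hb⟩ := markList_eq (scopePos d l) A { v with mask := fun _ => false }
  refine ⟨b, hb.trans ?_⟩
  simp only [PState.mk.injEq, true_and, and_true]
  funext i
  by_cases hi : i.val < l.length <;> simp [selMask, scopePos, hi, hv]

/-- Reads the accepted selections of a constraint. -/
def readTable : Prog (Reg d) (PState d) Sym :=
  seq (set fun v => { v with table := ∅ }) (eachList .rel [] (block
    [set fun v => { v with mask := fun _ => false }, scanList .rel [],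
      set fun v => { v with table := insert v.mask v.table }]))

theorem runs_readTable (c : RawConstraint) (v : PState d) (M : Mem d)
    (hv : v.len.val = c.1.length) (h1 : M.cur = []) (h2 : M.cura = []) (h3 : M.posa = [])
    (hpos : M.pos = posOf d c.1) (rest : List Sym)
    (hw : M.rel = encodeList (encodeList encodeNat) c.2 ++ rest) :
    ∃ v' : PState d, v'.len = v.len ∧ v'.table = accTable d c ∧
      Runs readTable v M.stk v' (Mem.stk { M with rel := rest })
        ((16 * d + 15) * (encodeList (encodeList encodeNat) c.2).length + 3) := by
  let F : List ℕ → PState d → PState d := fun A v =>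
    { markList (scopePos d c.1) A { v with mask := fun _ => false } with
      table := insert (markList (scopePos d c.1) A { v with mask := fun _ => false }).mask
        (markList (scopePos d c.1) A { v with mask := fun _ => false }).table }
  have hF : ∀ (L : List (List ℕ)) (v : PState d), v.len.val = c.1.length →
      (L.foldl (fun v A => F A v) v).len = v.len ∧ (L.foldl (fun v A => F A v) v).table =
        (L.map fun A => selMask d c.1 (fun v => decide (v ∈ A))).toFinset ∪ v.table := by
    intro L
    induction L with
    | nil => simp
    | cons A L ih =>
      intro v hv
      obtain ⟨b, hb⟩ := markList_mask A v hv
      have hFA : F A v = { v with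
          mask := selMask d c.1 (fun v => decide (v ∈ A))
          table := insert (selMask d c.1 (fun v => decide (v ∈ A))) v.table
          flag := b } := by
        simp only [F, hb]
      obtain ⟨i1, i2⟩ := ih (F A v) (by rw [hFA]; exact hv)
      refine ⟨by rw [List.foldl_cons, i1, hFA], ?_⟩
      rw [List.foldl_cons, i2, hFA, List.map_cons, List.toFinset_cons, Finset.union_insert,
        Finset.insert_union]
  have hbody : ∀ A ∈ c.2, Scans (ScopeAt (scopePos d c.1)) Reg.rel [] (block
      [set fun v => { v with mask := fun _ => false }, scanList .rel [],
        set fun v => { v with table := insert v.mask v.table }]) (F A)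
      (encodeList encodeNat A) (16 * d + 15) := by
    intro A _ v S rest hS hw
    have e1 := runs_set (fun v : PState d => { v with mask := fun _ => false }) v S
    have e2 := runs_scanList (scopePos d c.1) (src := Reg.rel) (ds := []) (by simp)
      (by simp [Reg.isData]) A { v with mask := fun _ => false } S rest hS hw
    refine ((e1.block_cons (e2.block_cons ((runs_set _ _ _).block_cons
      (runs_block_nil _ _)))).congr rfl ?_).mono ?_
    · rw [feed_nil, feed_nil]
    · simp only [encodeList, List.length_append, List.length_singleton, List.length_nil]
      ring_nf
      lia
  have e1 := runs_set (fun v : PState d => { v with table := ∅ }) v M.stk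
  have e2 := runs_eachList (F := F) (ds := []) (src := Reg.rel) (by simp) (by simp)
    (fun S rest w h => h.feed (by simp [Reg.isData]) rest w) (c := 16 * d + 15) (by simp) c.2 hbody
    { v with table := ∅ } M.stk rest (scopeAt_stk h1 h2 h3 hpos) hw
  obtain ⟨i1, i2⟩ := hF c.2 { v with table := ∅ } hv
  refine ⟨_, i1, by rw [i2, Finset.union_empty]; rfl, ((e1.seq e2).congr rfl ?_).mono ?_⟩
  · rw [feed_nil, Mem.update_rel]
  · simp only [encodeList, List.length_append, List.length_singleton]
    ring_nf
    lia

end Prog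

end SigmaRho

namespace SigmaRho

namespace Prog

variable {d : ℕ}

/-! ### Inserting the gadget -/

/-- Pushes the encoded vertices `n + j`, for `j` in the list `js`, on the stack `bag`. -/
def emitVertices (js : List ℕ) : Prog (Reg d) (PState d) Sym :=
  block (js.map fun j => seq (push .bag .cons) (emitNum .num .cura .bag j))

theorem runs_emitVertices {n g : ℕ} (js : List ℕ) (hjs : ∀ j ∈ js, j < g) (v : PState d)
    (M : Mem d) (hn : M.num = List.replicate n Sym.tick) (hc : M.cura = []) :
    Runs (emitVertices js) v M.stk v
      (Mem.stk { M with
        bag := ((js.map (n + ·)).flatMap fun a => Sym.cons :: encodeNat a).reverse ++ M.bag })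
      (js.length * (7 * n + g + 13) + 1) := by
  induction js generalizing M with
  | nil => exact ((runs_block_nil v M.stk).congr rfl (by simp)).mono (by simp)
  | cons j js ih =>
    have e1 := runs_emitNum (σ := PState d) (r := Reg.num) (aux := Reg.cura) (dst := Reg.bag)
      (by simp) (by simp) (by simp) (a := n) j v (Mem.stk { M with bag := Sym.cons :: M.bag })
      hn hc
    have e2 := ih (fun i hi => hjs i (by simp [hi]))
      { M with bag := (encodeNat (n + j)).reverse ++ Sym.cons :: M.bag } hn hc
    have e0 := runs_push Reg.bag Sym.cons v M.stk
    rw [Mem.update_bag] at e0 e1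
    refine (((e0.seq e1).block_cons e2).congr rfl (by simp)).mono ?_
    have := hjs j (by simp)
    rw [List.length_cons]
    ring_nf
    lia

/-- Pushes a copy of the bag that was read last, enlarged by the vertices of the gadget, on the
stack `bag`. -/
def copyBag (g : ℕ) : Prog (Reg d) (PState d) Sym :=
  block [set fun v => { v with done := true }, push .bag .cons, teeAll .cpy [.tmp],
    teeAll .tmp [.bag], emitVertices (List.range g), push .bag .nil]

theorem runs_copyBag {g n : ℕ} (w : List Sym) (v : PState d) (M : Mem d)
    (hn : M.num = List.replicate n Sym.tick) (hc : M.cura = []) (hw : M.cpy = w.reverse)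
    (ht : M.tmp = []) :
    Runs (copyBag g) v M.stk { v with done := true } (Mem.stk { M with
        cpy := []
        bag := Sym.nil :: ((((List.range g).map (n + ·)).flatMap fun a =>
          Sym.cons :: encodeNat a).reverse ++ (w.reverse ++ Sym.cons :: M.bag)) })
      (6 * w.length + g * (7 * n + g + 13) + 11) := by
  have f0 := runs_set (fun v : PState d => { v with done := true }) v M.stk
  have f1 := runs_push Reg.bag Sym.cons { v with done := true } M.stk
  have f2 := runs_move (src := Reg.cpy) (dst := Reg.tmp) (by simp) { v with done := true }
    (Mem.stk { M with bag := Sym.cons :: M.bag })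
  have f3 := runs_move (src := Reg.tmp) (dst := Reg.bag) (by simp) { v with done := true }
    (Mem.stk { M with bag := Sym.cons :: M.bag, cpy := [], tmp := w })
  have f4 := runs_emitVertices (n := n) (g := g) (List.range g) (by simp)
    { v with done := true }
    { M with bag := w.reverse ++ Sym.cons :: M.bag, cpy := [], tmp := [] } hn hc
  have f5 := runs_push Reg.bag Sym.nil { v with done := true } (Mem.stk { M with
    cpy := []
    tmp := []
    bag := (((List.range g).map (n + ·)).flatMap fun a => Sym.cons :: encodeNat a).reverse ++
        (w.reverse ++ Sym.cons :: M.bag) })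
  simp only [Mem.stk_bag, Mem.update_bag, Mem.stk_cpy, Mem.update_cpy, Mem.stk_tmp,
    Mem.update_tmp, hw, ht, List.append_nil, List.reverse_reverse, List.length_reverse,
    List.length_range] at f1 f2 f3 f4 f5
  refine ((f0.block_cons (f1.block_cons (f2.block_cons (f3.block_cons (f4.block_cons
    (f5.block_cons (runs_block_nil _ _))))))).congr rfl ?_).mono ?_
  · rw [← ht]
  · lia

/-- Adds an enlarged copy of the bag that was read last if it is the first one that contains the
scope. -/
def endBag (g : ℕ) (v : PState d) : Prog (Reg d) (PState d) Sym :=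
  if v.done = false ∧ v.mask = (fun i => decide (i.val < v.len.val)) then
    copyBag g else teeAll .cpy []

/-- Moves a bag from the stack `inp` to the stack `bag`; if it is the first one that contains the
scope, then an enlarged copy is added. -/
def processBag (g : ℕ) : Prog (Reg d) (PState d) Sym :=
  block [pushes [.bag] .cons, set fun v => { v with mask := fun _ => false },
    scanList .inp [.bag, .cpy], push .bag .nil,
    switch (endBag g)]

/-- A bound for the running time of `processBag` per symbol of the bag. -/
def bagCost (d g n : ℕ) : ℕ := 16 * d + 40 + g * (7 * n + g + 13)

/-- The stacks while a constraint with the given scope is being processed. -/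
structure _root_.SigmaRho.Mem.Ready (M : Mem d) (n : ℕ) (scope : List ℕ) : Prop where
  num : M.num = List.replicate n Sym.tick
  cur : M.cur = []
  cura : M.cura = []
  posa : M.posa = []
  cpy : M.cpy = []
  tmp : M.tmp = []
  pos : M.pos = posOf d scope

theorem selMask_eq_iff {c : RawConstraint} (hc : c.1.length ≤ d) (B : List ℕ) :
    selMask d c.1 (fun v => decide (v ∈ B)) = (fun i => decide (i.val < c.1.length)) ↔
      scopeIn c B = true := by
  simp only [scopeIn, decide_eq_true_eq]
  constructor
  · intro h v hv
    obtain ⟨i, hi, rfl⟩ := List.getElem_of_mem hv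
    simpa [selMask, hi] using congrFun h ⟨i, by lia⟩
  · intro h
    funext i
    by_cases hi : i.val < c.1.length
    · simp [selMask, hi, h _ (List.getElem_mem hi)]
    · simp [selMask, hi]

theorem runs_processBag {g n : ℕ} {c : RawConstraint} (hc : c.1.length ≤ d) (B : List ℕ)
    (v : PState d) (M : Mem d) (hv : v.len.val = c.1.length) (hM : M.Ready n c.1)
    (rest : List Sym) (hw : M.inp = encodeList encodeNat B ++ rest) :
    ∃ v' : PState d, v'.len = v.len ∧ v'.table = v.table ∧ v'.done = (v.done || scopeIn c B) ∧
      Runs (processBag g) v M.stk v' (Mem.stk { M with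
          inp := rest
          bag := ((bif !v.done && scopeIn c B then [B, B ++ List.range' n g] else [B]).flatMap
            fun B => Sym.cons :: encodeList encodeNat B).reverse ++ M.bag })
        ((B.flatMap fun a => Sym.cons :: encodeNat a).length * bagCost d g n + bagCost d g n) := by
  obtain ⟨h1, h2, h3, h4, h5, h6, h7⟩ := hM
  obtain ⟨b, hb⟩ := markList_mask B v hv
  have e1 := runs_pushes (ds := [Reg.bag]) (by simp) Sym.cons v M.stk
  have e2 := runs_set (fun v : PState d => { v with mask := fun _ => false }) v
    (addTo M.stk [Reg.bag] [Sym.cons])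
  have e3 := runs_scanList (scopePos d c.1) (src := Reg.inp) (ds := [.bag, .cpy]) (by simp)
    (by simp [Reg.isData]) B { v with mask := fun _ => false }
    (Mem.stk { M with bag := Sym.cons :: M.bag }) rest (scopeAt_stk h2 h3 h4 h7) hw
  rw [hb] at e3
  generalize hx : (B.flatMap fun a => Sym.cons :: encodeNat a) = w at e3 ⊢
  set v₁ : PState d := { v with
      mask := selMask d c.1 (fun v => decide (v ∈ B))
      flag := b } with hv₁
  have e4 := runs_push Reg.bag Sym.nil v₁ (Mem.stk { M with
    inp := rest
    bag := w.reverse ++ Sym.cons :: M.bag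
    cpy := w.reverse })
  simp only [feed, addTo_cons, addTo_nil, Mem.stk_bag, Mem.stk_cpy, Mem.update_bag, Mem.update_cpy,
    Mem.update_inp, h5, List.append_nil, List.reverse_singleton, List.singleton_append]
    at e1 e2 e3 e4
  have hcond : (v₁.done = false ∧ v₁.mask = fun i => decide (i.val < v₁.len.val)) ↔
      (!v.done && scopeIn c B) = true := by
    rw [Bool.and_eq_true, ← selMask_eq_iff hc, Bool.not_eq_true']
    simp only [hv₁, hv]
  have e123 := fun {v' S' T} (h : Runs (endBag g v₁) v₁ _ v' S' T) =>
    e1.block_cons (e2.block_cons (e3.block_cons (e4.block_cons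
      ((Runs.switch (p := endBag g) h).block_cons (runs_block_nil v' S')))))
  rw [endBag] at e123
  by_cases hin : (!v.done && scopeIn c B) = true
  · have f1 := runs_copyBag (g := g) w v₁ { M with
      inp := rest
      bag := Sym.nil :: (w.reverse ++ Sym.cons :: M.bag)
      cpy := w.reverse } h1 h3 rfl h6
    rw [if_pos (hcond.2 hin)] at e123
    refine ⟨_, ?_, ?_, ?_, ((e123 f1).congr rfl ?_).mono ?_⟩
    · rfl
    · rfl
    · rw [Bool.and_eq_true] at hin
      simp [hin.2]
    · rw [hin, cond_true]
      simp [encodeList, hx, h5, List.range'_eq_map_range]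
    · simp only [List.length_cons, List.length_nil, bagCost]
      ring_nf
      nlinarith [Nat.zero_le (w.length * g * n), Nat.zero_le (w.length * g),
        Nat.zero_le (w.length * g ^ 2)]
  · have f1 := runs_clear Reg.cpy v₁ (Mem.stk { M with
      inp := rest
      bag := Sym.nil :: (w.reverse ++ Sym.cons :: M.bag)
      cpy := w.reverse })
    simp only [Mem.stk_cpy, Mem.update_cpy, ← h5, List.length_reverse] at f1
    rw [if_neg (fun h => hin (hcond.1 h))] at e123
    refine ⟨_, ?_, ?_, ?_, ((e123 f1).congr rfl ?_).mono ?_⟩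
    · rfl
    · rfl
    · cases h : v.done <;> simp_all
    · rw [Bool.not_eq_true] at hin
      rw [hin, cond_false]
      simp [encodeList, hx]
    · simp only [List.length_cons, List.length_nil, bagCost]
      ring_nf
      nlinarith [Nat.zero_le (w.length * g * n), Nat.zero_le (w.length * g),
        Nat.zero_le (w.length * g ^ 2)]

end Prog

end SigmaRho

namespace SigmaRho

/-- The encoding of an edge given by natural numbers. -/
def encodePair (e : ℕ × ℕ) : List Sym := encodeNat e.1 ++ encodeNat e.2

namespace Prog

variable {d : ℕ}

/-- Moves all bags from the stack `inp` to the stack `bag`, with an enlarged copy of the first one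
that contains the scope. -/
def processBags (g : ℕ) : Prog (Reg d) (PState d) Sym :=
  loop .inp isCons fun o => match o with
    | some .cons => processBag g
    | _ => skip

/-- If `done` does not hold at the beginning, the bags are those after inserting an enlarged copy;
otherwise they are unchanged. -/
theorem runs_processBags {g n : ℕ} {c : RawConstraint} (hc : c.1.length ≤ d) (L : List (List ℕ))
    (v : PState d) (M : Mem d) (hv : v.len.val = c.1.length) (hM : M.Ready n c.1)
    (hw : M.inp = encodeList (encodeList encodeNat) L) :
    ∃ v' : PState d, v'.len = v.len ∧ v'.table = v.table ∧
      Runs (processBags g) v M.stk v' (Mem.stk { M with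
          inp := []
          bag := ((bif v.done then L else insertBag (scopeIn c) (List.range' n g) L).flatMap
            fun B => Sym.cons :: encodeList encodeNat B).reverse ++ M.bag })
        (M.inp.length * bagCost d g n) := by
  have hK : 2 ≤ bagCost d g n := by
    rw [bagCost]
    lia
  induction L generalizing v M with
  | nil =>
    refine ⟨v, rfl, rfl, (Runs.loop_final (T := 1) (by simp [hw, encodeList, isCons]) ?_).mono ?_⟩
    · simp only [Mem.stk_inp, hw, encodeList, List.flatMap_nil, List.nil_append,
        List.head?_cons, List.tail_cons, Mem.update_inp]
      refine (runs_skip v (Mem.stk _)).congr rfl ?_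
      cases v.done <;> simp [insertBag]
    · rw [hw]
      simpa [encodeList] using hK
  | cons B L ih =>
    rw [encodeList_cons] at hw
    obtain ⟨v₁, i1, i2, i3, h1⟩ := runs_processBag (g := g) hc B v
      { M with inp := encodeList encodeNat B ++ encodeList (encodeList encodeNat) L } hv
      ⟨hM.1, hM.2, hM.3, hM.4, hM.5, hM.6, hM.7⟩ _ rfl
    obtain ⟨v₂, j1, j2, h2⟩ := ih v₁ { M with
        inp := encodeList (encodeList encodeNat) L
        bag := ((bif !v.done && scopeIn c B then [B, B ++ List.range' n g] else [B]).flatMap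
            fun B => Sym.cons :: encodeList encodeNat B).reverse ++ M.bag }
      (by rw [i1, hv]) ⟨hM.1, hM.2, hM.3, hM.4, hM.5, hM.6, hM.7⟩ rfl
    refine ⟨v₂, j1.trans i1, j2.trans i2, ((Runs.loop_again (T₁ := (B.flatMap fun a =>
      Sym.cons :: encodeNat a).length * bagCost d g n + bagCost d g n) (by simp [hw, isCons]) ?_
      h2).congr rfl ?_).mono ?_⟩
    · simp only [Mem.stk_inp, hw, List.head?_cons, List.tail_cons, Mem.update_inp]
      exact h1
    · rw [i3]
      by_cases hB : scopeIn c B = true <;> cases v.done <;> simp [insertBag, hB]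
    · rw [hw]
      simp only [encodeList, List.length_cons, List.length_append, List.length_nil]
      ring_nf
      nlinarith

/-! ### Emitting the edges of the gadget -/

/-- Pushes one end of an edge of the gadget on the stack `edge`. -/
def emitEnd {g : ℕ} : Fin d ⊕ Fin g → Prog (Reg d) (PState d) Sym
  | .inl i => emitNum (.pos i) .cura .edge 0
  | .inr j => emitNum .num .cura .edge j

theorem runs_emitEnd {n g : ℕ} {scope : List ℕ} (hs : ∀ v ∈ scope, v < n) (e : Fin d ⊕ Fin g)
    (v : PState d) (M : Mem d) (hM : M.Ready n scope) :
    Runs (emitEnd e) v M.stk v (Mem.stk { M with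
      edge := (encodeNat (nodeNum n scope e)).reverse ++ M.edge }) (7 * n + g + 12) := by
  cases e with
  | inl i =>
    refine ((runs_emitNum (σ := PState d) (r := Reg.pos i) (aux := Reg.cura) (dst := Reg.edge)
      (by simp) (by simp) (by simp) (a := scope.getD i 0) 0 v M.stk ?_ hM.cura).congr rfl
      ?_).mono ?_
    · rw [Mem.stk_pos, hM.pos]
      rfl
    · simp [nodeNum]
    · have : scope.getD i 0 ≤ n := by
        by_cases hi : i.val < scope.length
        · rw [List.getD_eq_getElem _ _ hi]
          exact (hs _ (List.getElem_mem hi)).le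
        · rw [List.getD_eq_default _ _ (by lia)]
          exact Nat.zero_le _
      lia
  | inr j =>
    refine ((runs_emitNum (σ := PState d) (r := Reg.num) (aux := Reg.cura) (dst := Reg.edge)
      (by simp) (by simp) (by simp) (a := n) j v M.stk hM.num hM.cura).congr rfl ?_).mono ?_
    · simp [nodeNum]
    · lia

/-- Pushes the edges of the gadget on the stack `edge`. -/
def emitEdges {g : ℕ} (L : List ((Fin d ⊕ Fin g) × Fin g)) : Prog (Reg d) (PState d) Sym :=
  block (L.map fun e => seq (push .edge .cons) (seq (emitEnd e.1) (emitEnd (g := g) (.inr e.2))))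

theorem runs_emitEdges {n g : ℕ} {scope : List ℕ} (hs : ∀ v ∈ scope, v < n)
    (L : List ((Fin d ⊕ Fin g) × Fin g)) (v : PState d) (M : Mem d) (hM : M.Ready n scope) :
    Runs (emitEdges L) v M.stk v (Mem.stk { M with
      edge := ((L.map fun e => (nodeNum n scope e.1, n + e.2.val)).flatMap
        fun e => Sym.cons :: encodePair e).reverse ++ M.edge })
      (L.length * (14 * n + 2 * g + 25) + 1) := by
  induction L generalizing M with
  | nil => exact ((runs_block_nil v M.stk).congr rfl (by simp)).mono (by simp)
  | cons e L ih =>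
    have e0 := runs_push Reg.edge Sym.cons v M.stk
    have e1 := runs_emitEnd hs e.1 v { M with edge := Sym.cons :: M.edge }
      ⟨hM.1, hM.2, hM.3, hM.4, hM.5, hM.6, hM.7⟩
    have e2 := runs_emitEnd hs (.inr e.2) v
      { M with edge := (encodeNat (nodeNum n scope e.1)).reverse ++ Sym.cons :: M.edge }
      ⟨hM.1, hM.2, hM.3, hM.4, hM.5, hM.6, hM.7⟩
    have e3 := ih { M with edge := (encodeNat (nodeNum n scope (.inr (α := Fin d) e.2))).reverse ++
        ((encodeNat (nodeNum n scope e.1)).reverse ++ Sym.cons :: M.edge) }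
      ⟨hM.1, hM.2, hM.3, hM.4, hM.5, hM.6, hM.7⟩
    rw [Mem.update_edge] at e0
    refine (((e0.seq (e1.seq e2)).block_cons e3).congr rfl ?_).mono ?_
    · simp [encodePair, nodeNum]
    · rw [List.length_cons]
      ring_nf
      lia

/-- Clears the stacks that hold the scope. -/
def clearScope : Prog (Reg d) (PState d) Sym :=
  block ((List.finRange d).map fun i => teeAll (.pos i) [])

theorem runs_clearScope {n : ℕ} (v : PState d) (M : Mem d) (hM : ∀ i, (M.pos i).length ≤ n) :
    Runs clearScope v M.stk v (Mem.stk { M with pos := fun _ => [] }) (d * (2 * n + 2) + 1) := by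
  have key : ∀ (L : List (Fin d)) (M : Mem d), (∀ i, (M.pos i).length ≤ n) →
      Runs (block (L.map fun i => teeAll (.pos i) [])) v M.stk v
        (Mem.stk { M with pos := fun i => if i ∈ L then [] else M.pos i })
        (L.length * (2 * n + 2) + 1) := by
    intro L
    induction L with
    | nil => exact fun M _ => ((runs_block_nil v M.stk).congr rfl (by simp)).mono (by simp)
    | cons i L ih =>
      intro M hM
      have e1 := runs_clear (Reg.pos i) v M.stk
      rw [Mem.update_pos] at e1
      refine ((e1.block_cons (ih _ fun j => ?_)).congr rfl ?_).mono ?_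
      · by_cases hj : j = i
        · subst hj
          simp
        · simpa [hj] using hM j
      · congr 2
        funext j
        by_cases hj : j = i
        · subst hj
          simp
        · simp [hj]
      · have := hM i
        simp only [Mem.stk_pos, List.length_cons]
        ring_nf
        lia
  refine ((key (List.finRange d) M hM).congr rfl ?_).mono (by rw [List.length_finRange])
  simp

end Prog

end SigmaRho

namespace SigmaRho

/-- The encoding of a constraint on natural numbers. -/
def RawConstraint.encode (c : RawConstraint) : List Sym :=
  encodeList encodeNat c.1 ++ encodeList (encodeList encodeNat) c.2

theorem GadgetFamily.length_code_le {d g : ℕ} (G : GadgetFamily d g) (T : Finset (Fin d → Bool))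
    (l : ℕ) : (G.code T l).length ≤ (g + d) * g := by
  rw [GadgetFamily.code, List.length_append, List.length_map, List.length_map, Nat.add_mul]
  refine Nat.add_le_add ((List.length_filter_le _ _).trans ?_)
    ((List.length_filter_le _ _).trans ?_) <;>
    exact (List.length_product _ _).le.trans (by simp)

namespace Prog

variable {d : ℕ}

/-- The stacks between the processing of two constraints: the bags are on the stack `inp`, and the
encodings of the edges are in reversed order on the stack `edge`. -/
def _root_.SigmaRho.Mem.ofState (d : ℕ) (S : RawState) (rel : List Sym) : Mem d where
  inp := encodeList (encodeList encodeNat) S.bags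
  num := List.replicate S.n Sym.tick
  rel := rel
  edge := (S.edges.flatMap fun e => Sym.cons :: encodePair e).reverse

/-- Replaces a constraint by its gadget. When the edges of the gadget are emitted, the memory holds
the whole relation, so the program can branch to the edges of the gadget for this relation. -/
noncomputable def processRel {g : ℕ} (G : GadgetFamily d g) : Prog (Reg d) (PState d) Sym :=
  block [set fun v => { v with len := mkLen d 0 }, readScope, readTable,
    set fun v => { v with done := false }, processBags g, push .inp .nil, teeAll .bag [.inp],
    switch fun v => emitEdges (G.code v.table v.len.val),
    block (List.replicate g (push .num .tick)), clearScope]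

/-- The constant factor in the quadratic bound for the running time of `processRel`. -/
def relCost (d g : ℕ) : ℕ :=
  16 * d + 20 + (16 * d + 40 + g * (g + 20)) + (g + d) * g * (2 * g + 39) + (2 * d + g) + 20

theorem runs_processRel {g : ℕ} (G : GadgetFamily d g) {S : RawState} {c : RawConstraint}
    (hc : c.Valid d S.n) (v : PState d) (rest : List Sym) {X : ℕ} (h1 : c.encode.length ≤ X)
    (h2 : (encodeList (encodeList encodeNat) S.bags).length ≤ X)
    (h3 : (encodeList (encodeList encodeNat) (G.step S c).bags).length ≤ X) (h4 : S.n ≤ X) :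
    ∃ v', Runs (processRel G) v (Mem.ofState d S (c.encode ++ rest)).stk v'
      (Mem.ofState d (G.step S c) rest).stk (relCost d g * (X + 1) ^ 2) := by
  have hcl := hc.length_le
  let M₀ := Mem.ofState d S (c.encode ++ rest)
  have e0 := runs_set (fun v : PState d => { v with len := mkLen d 0 }) v M₀.stk
  have e1 := runs_readScope [] c.1 (by simpa using hcl) { v with len := mkLen d 0 } M₀
    (by simp [mkLen]) (posOf_nil (d := d)).symm
    (encodeList (encodeList encodeNat) c.2 ++ rest)
    (by simp [M₀, Mem.ofState, RawConstraint.encode])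
  let M₁ : Mem d := { M₀ with
    rel := encodeList (encodeList encodeNat) c.2 ++ rest
    pos := posOf d c.1 }
  have hlen : (mkLen d (([] : List ℕ).length + c.1.length)).val = c.1.length := by
    simp [mkLen, hcl]
  obtain ⟨v₂, a1, a2, e2⟩ := runs_readTable c
    { v with len := mkLen d (([] : List ℕ).length + c.1.length) } M₁ hlen rfl rfl rfl rfl rest rfl
  have e3 := runs_set (fun v : PState d => { v with done := false }) v₂
    (Mem.stk { M₁ with rel := rest })
  obtain ⟨v₄, b1, b2, e4⟩ := runs_processBags (g := g) (n := S.n) hcl S.bags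
    { v₂ with done := false } { M₁ with rel := rest } (by rw [a1]; exact hlen)
    ⟨rfl, rfl, rfl, rfl, rfl, rfl, rfl⟩ rfl
  rw [cond_false] at e4
  let w := (insertBag (scopeIn c) (List.range' S.n g) S.bags).flatMap
    fun B => Sym.cons :: encodeList encodeNat B
  have e5 := runs_push Reg.inp Sym.nil v₄ (Mem.stk { M₁ with
    rel := rest
    inp := []
    bag := w.reverse ++ [] })
  have e6 := runs_move (src := Reg.bag) (dst := Reg.inp) (by simp) v₄ (Mem.stk { M₁ with
    rel := rest
    inp := [Sym.nil]
    bag := w.reverse ++ [] })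
  have e7 := Runs.switch (p := fun v => emitEdges (G.code v.table v.len.val))
    (runs_emitEdges hc.lt (G.code v₄.table v₄.len.val) v₄ { M₁ with
      rel := rest
      inp := w ++ [Sym.nil]
      bag := [] } ⟨rfl, rfl, rfl, rfl, rfl, rfl, rfl⟩)
  have e8 := runs_replicate_push Reg.num Sym.tick g v₄ (Mem.stk { M₁ with
      rel := rest
      inp := w ++ [Sym.nil]
      bag := []
      edge := (((G.code v₄.table v₄.len.val).map fun e => (nodeNum S.n c.1 e.1,
        S.n + e.2.val)).flatMap fun e => Sym.cons :: encodePair e).reverse ++ M₁.edge })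
  have hpos : ∀ i, (posOf d c.1 i).length ≤ S.n := by
    intro i
    rw [posOf, List.length_replicate]
    by_cases hi : i.val < c.1.length
    · rw [List.getD_eq_getElem _ _ hi]
      exact (hc.lt _ (List.getElem_mem hi)).le
    · rw [List.getD_eq_default _ _ (by lia)]
      exact Nat.zero_le _
  have e9 := runs_clearScope v₄ { M₁ with
      rel := rest
      inp := w ++ [Sym.nil]
      bag := []
      num := List.replicate g Sym.tick ++ M₁.num
      edge := (((G.code v₄.table v₄.len.val).map fun e => (nodeNum S.n c.1 e.1,
        S.n + e.2.val)).flatMap fun e => Sym.cons :: encodePair e).reverse ++ M₁.edge } hpos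
  simp only [Mem.update_inp, Mem.update_bag, Mem.stk_bag, Mem.stk_inp, List.append_nil,
    List.reverse_reverse, Mem.update_num, Mem.stk_num, List.length_reverse] at e5 e6 e8
  refine ⟨v₄, ((e0.block_cons (e1.block_cons (e2.block_cons (e3.block_cons
    ((e4.congr rfl ?_).block_cons (e5.block_cons (e6.block_cons (e7.block_cons (e8.block_cons
      (e9.block_cons (runs_block_nil _ _))))))))))).congr rfl ?_).mono ?_⟩
  · simp [w, M₁, M₀, Mem.ofState]
  · congr 1
    have hT : v₄.table = accTable d c := by rw [b2, a2]
    have hL : v₄.len.val = c.1.length := by rw [b1, a1]; exact hlen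
    simp [M₁, M₀, Mem.ofState, GadgetFamily.step, w, encodeList, GadgetFamily.edges, hT, hL,
      Nat.add_comm S.n g]
  · have hw : w.length ≤ X := by
      refine le_trans ?_ h3
      rw [encodeList, List.length_append]
      exact Nat.le_add_right _ _
    have hY : 1 ≤ X + 1 := Nat.le_add_left 1 X
    have hZ : X + 1 ≤ (X + 1) ^ 2 := Nat.le_self_pow two_ne_zero _
    rw [RawConstraint.encode, List.length_append] at h1
    have q1 : 5 * (encodeList encodeNat c.1).length +
        (16 * d + 15) * (encodeList (encodeList encodeNat) c.2).length ≤
          (16 * d + 20) * (X + 1) ^ 2 := by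
      refine le_trans ?_ (Nat.mul_le_mul_left _ (show (encodeList encodeNat c.1).length +
        (encodeList (encodeList encodeNat) c.2).length ≤ (X + 1) ^ 2 by lia))
      rw [Nat.mul_add]
      exact Nat.add_le_add (Nat.mul_le_mul_right _ (by lia)) (Nat.mul_le_mul_right _ (by lia))
    have q2 : (encodeList (encodeList encodeNat) S.bags).length * bagCost d g S.n ≤
        (16 * d + 40 + g * (g + 20)) * (X + 1) ^ 2 := by
      have : bagCost d g S.n ≤ (16 * d + 40 + g * (g + 20)) * (X + 1) := by
        rw [bagCost, Nat.add_mul (16 * d + 40), Nat.mul_assoc g]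
        refine Nat.add_le_add (Nat.le_mul_of_pos_right _ hY) (Nat.mul_le_mul_left _ ?_)
        nlinarith
      calc _ ≤ (X + 1) * ((16 * d + 40 + g * (g + 20)) * (X + 1)) :=
            Nat.mul_le_mul (by lia) this
        _ = _ := by ring
    have q3 : (G.code v₄.table v₄.len.val).length * (14 * S.n + 2 * g + 25) ≤
        (g + d) * g * (2 * g + 39) * (X + 1) ^ 2 := by
      have : 14 * S.n + 2 * g + 25 ≤ (2 * g + 39) * (X + 1) := by nlinarith
      refine (Nat.mul_le_mul (G.length_code_le _ _) this).trans ?_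
      rw [← Nat.mul_assoc]
      exact Nat.mul_le_mul_left _ hZ
    have q4 : d * (2 * S.n + 2) + g ≤ (2 * d + g) * (X + 1) ^ 2 := by
      refine le_trans ?_ (Nat.mul_le_mul_left _ hZ)
      nlinarith
    have q5 : 3 * (w.length + 1) + 17 ≤ 20 * (X + 1) ^ 2 := by lia
    have hsum : relCost d g * (X + 1) ^ 2 = (16 * d + 20) * (X + 1) ^ 2 +
        (16 * d + 40 + g * (g + 20)) * (X + 1) ^ 2 + (g + d) * g * (2 * g + 39) * (X + 1) ^ 2 +
        (2 * d + g) * (X + 1) ^ 2 + 20 * (X + 1) ^ 2 := by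
      rw [relCost]
      ring
    rw [hsum]
    refine le_trans ?_ (Nat.add_le_add (Nat.add_le_add (Nat.add_le_add (Nat.add_le_add q1 q2) q3)
      q4) q5)
    have hi : ({ M₁ with rel := rest } : Mem d).inp.length =
      (encodeList (encodeList encodeNat) S.bags).length := rfl
    rw [hi]
    lia

end Prog

end SigmaRho

namespace SigmaRho

/-! ### Sizes of encodings -/

theorem length_encodeList_le {α : Type*} {enc : α → List Sym} {l : List α} {b : ℕ}
    (h : ∀ a ∈ l, (enc a).length ≤ b) : (encodeList enc l).length ≤ l.length * (b + 1) + 1 := by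
  induction l with
  | nil => simp [encodeList]
  | cons a l ih =>
    have h1 := h a List.mem_cons_self
    have h2 := ih fun a ha => h a (List.mem_cons_of_mem _ ha)
    rw [encodeList_cons, List.length_cons, List.length_append, List.length_cons, Nat.add_mul]
    lia

theorem length_le_length_encodeList {α : Type*} (enc : α → List Sym) (l : List α) :
    l.length ≤ (encodeList enc l).length := by
  induction l with
  | nil => simp
  | cons a l ih =>
    rw [encodeList_cons, List.length_cons, List.length_cons, List.length_append]
    lia

theorem length_enc_le_length_encodeList {α : Type*} (enc : α → List Sym) {l : List α} {a : α}
    (ha : a ∈ l) : (enc a).length ≤ (encodeList enc l).length := by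
  induction l with
  | nil => simp at ha
  | cons b l ih =>
    rw [encodeList_cons, List.length_cons, List.length_append]
    rcases List.mem_cons.1 ha with rfl | ha
    · lia
    · have := ih ha
      lia

/-- A bound for the length of the encoding of `k` bags of length at most `w`, in a graph with at
most `n` vertices. -/
def bagsBound (k w n : ℕ) : ℕ := k * (w * (n + 1) + 2) + 1

theorem length_encode_bags_le {k w n : ℕ} {L : List (List ℕ)} (h1 : L.length ≤ k)
    (h2 : ∀ B ∈ L, B.length ≤ w) (h3 : ∀ B ∈ L, ∀ v ∈ B, v < n) :
    (encodeList (encodeList encodeNat) L).length ≤ bagsBound k w n := by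
  refine (length_encodeList_le (b := w * (n + 1) + 1) fun B hB => ?_).trans ?_
  · refine (length_encodeList_le (b := n) fun v hv => ?_).trans ?_
    · simpa using h3 B hB v hv
    · exact Nat.add_le_add_right (Nat.mul_le_mul_right _ (h2 B hB)) _
  · exact Nat.add_le_add_right (Nat.mul_le_mul_right _ h1) _

theorem length_insertBag_le (p : List ℕ → Bool) (new : List ℕ) (L : List (List ℕ)) :
    (insertBag p new L).length ≤ L.length + 1 := by
  induction L with
  | nil => simp [insertBag]
  | cons B L ih =>
    rw [insertBag]
    split
    · simp
    · simpa using ih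

theorem foldl_step_n {d g : ℕ} (G : GadgetFamily d g) (R : List RawConstraint) (S : RawState) :
    (R.foldl G.step S).n = S.n + R.length * g := by
  induction R generalizing S with
  | nil => simp
  | cons c R ih =>
    rw [List.foldl_cons, ih, List.length_cons, Nat.add_mul, GadgetFamily.step]
    lia

theorem foldl_step_bags {d g : ℕ} (G : GadgetFamily d g) (R : List RawConstraint) (S : RawState) :
    (R.foldl G.step S).bags.length ≤ S.bags.length + R.length := by
  induction R generalizing S with
  | nil => simp
  | cons c R ih =>
    refine (ih _).trans ?_
    have := length_insertBag_le (scopeIn c) (List.range' S.n g) S.bags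
    rw [List.length_cons, GadgetFamily.step]
    lia

theorem foldl_step_edges {d g : ℕ} (G : GadgetFamily d g) (R : List RawConstraint) (S : RawState) :
    (R.foldl G.step S).edges.length ≤ S.edges.length + R.length * ((g + d) * g) := by
  induction R generalizing S with
  | nil => simp
  | cons c R ih =>
    refine (ih _).trans ?_
    have := G.length_code_le (accTable d c) c.1.length
    rw [List.length_cons, GadgetFamily.step, List.length_append, GadgetFamily.edges,
      List.length_map, Nat.add_mul]
    lia

/-- Each bag arises from an original bag by adding at most one gadget. So the encoding of the bags
stays polynomially bounded, however many constraints have been replaced. -/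
theorem RawState.ReducesFrom.length_encode_bags_le {g k w n : ℕ} {S₀ S : RawState}
    (h : S₀.ReducesFrom g S) (h1 : S.bags.length ≤ k) (h2 : ∀ B ∈ S₀.bags, B.length + g ≤ w)
    (h3 : S.n ≤ n) : (encodeList (encodeList encodeNat) S.bags).length ≤ bagsBound k w n := by
  refine SigmaRho.length_encode_bags_le h1 (fun B hB => ?_) fun B hB v hv =>
    (h.decomposed.bag_lt B hB v hv).trans_le h3
  obtain ⟨B₀, hB₀, new, rfl, hnew⟩ := h.shape B hB
  have := h2 B₀ hB₀
  rw [List.length_append]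
  lia

namespace Prog

variable {d : ℕ}

/-! ### The reduction program -/

/-- Replaces all constraints by their gadgets. -/
noncomputable def processRels {g : ℕ} (G : GadgetFamily d g) : Prog (Reg d) (PState d) Sym :=
  loop .rel isCons fun o => match o with
    | some .cons => processRel G
    | _ => skip

theorem runs_processRels {g : ℕ} (G : GadgetFamily d g) {S₀ : RawState} {k w n X : ℕ}
    (hw : ∀ B ∈ S₀.bags, B.length + g ≤ w) (hX : bagsBound k w n ≤ X) (hnX : n ≤ X)
    (R : List RawConstraint) (S : RawState) (hS : S₀.ReducesFrom g S)
    (hR : ∀ c ∈ R, c.Valid d S₀.n ∧ ∃ B ∈ S₀.bags, ∀ v ∈ c.1, v ∈ B)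
    (hRX : ∀ c ∈ R, c.encode.length ≤ X) (hk : S.bags.length + R.length ≤ k)
    (hn : S.n + R.length * g ≤ n) (v : PState d) :
    ∃ v', Runs (processRels G) v (Mem.ofState d S (encodeList RawConstraint.encode R)).stk v'
      (Mem.ofState d (R.foldl G.step S) []).stk
      (R.length * (relCost d g * (X + 1) ^ 2 + 1) + 2) := by
  induction R generalizing S v with
  | nil =>
    refine ⟨v, (Runs.loop_final (T := 1) (by simp [Mem.ofState, encodeList, isCons]) ?_).mono
      (by simp)⟩
    simp only [Mem.stk_rel, Mem.ofState, encodeList, List.flatMap_nil, List.nil_append,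
      List.head?_cons, List.tail_cons, Mem.update_rel]
    exact runs_skip v (Mem.stk _)
  | cons c R ih =>
    rw [List.length_cons] at hk hn
    rw [Nat.add_mul] at hn
    obtain ⟨hc, hB⟩ := hR c List.mem_cons_self
    have hS' := hS.step G hc hB
    have hk' : (G.step S c).bags.length ≤ S.bags.length + 1 := length_insertBag_le _ _ _
    have hn' : (G.step S c).n = S.n + g := rfl
    obtain ⟨v₁, e1⟩ := runs_processRel G (S := S) (c := c)
      ⟨hc.nodup, fun v hv => (hc.lt v hv).trans_le hS.le, hc.length_le⟩ v
      (encodeList RawConstraint.encode R) (hRX c List.mem_cons_self)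
      ((hS.length_encode_bags_le (k := k) (by lia) hw (n := n) (by lia)).trans hX)
      ((hS'.length_encode_bags_le (k := k) (by lia) hw (n := n) (by lia)).trans hX) (by lia)
    obtain ⟨v₂, e2⟩ := ih (G.step S c) hS' (fun c hc => hR c (List.mem_cons_of_mem _ hc))
      (fun c hc => hRX c (List.mem_cons_of_mem _ hc)) (by lia) (by lia) v₁
    refine ⟨v₂, (Runs.loop_again (by simp [Mem.ofState, encodeList_cons, isCons]) ?_ e2).mono
      (T₁ := relCost d g * (X + 1) ^ 2 + (R.length * (relCost d g * (X + 1) ^ 2 + 1) + 2) + 1) ?_⟩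
    · rw [Mem.stk_rel]
      simp only [Mem.ofState, encodeList_cons, List.head?_cons, List.tail_cons, Mem.update_rel]
      exact e1
    · rw [List.length_cons, Nat.add_mul]
      lia

/-- Reads the input. -/
def readInput : Prog (Reg d) (PState d) Sym :=
  block [readNum .inp .num [],
    eachList .inp [.edge] (seq (teeNum .inp [.edge]) (teeNum .inp [.edge])),
    teeList .inp [.tmp] (seq (teeList .inp [.tmp] (teeNum .inp [.tmp]))
      (teeList .inp [.tmp] (teeList .inp [.tmp] (teeNum .inp [.tmp])))),
    teeAll .tmp [.rel]]

theorem runs_readInput (S : RawState) (R : List RawConstraint) (v : PState d) :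
    Runs readInput v (Mem.stk { inp := encodeNat S.n ++ (encodeList encodePair S.edges ++
        (encodeList RawConstraint.encode R ++ encodeList (encodeList encodeNat) S.bags)) })
      v (Mem.ofState d S (encodeList RawConstraint.encode R)).stk
      (7 * (encodeNat S.n ++ (encodeList encodePair S.edges ++ (encodeList RawConstraint.encode R ++
        encodeList (encodeList encodeNat) S.bags))).length + 10) := by
  have e1 := runs_readNum (σ := PState d) (src := (Reg.inp : Reg d)) (r := Reg.num) (ds := [])
    (by simp) (by simp) (by simp) (by simp) S.n v
    (Mem.stk { inp := encodeNat S.n ++ (encodeList encodePair S.edges ++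
        (encodeList RawConstraint.encode R ++ encodeList (encodeList encodeNat) S.bags)) }) _ rfl
  have e2 := runs_eachList (I := fun _ => True) (src := (Reg.inp : Reg d)) (ds := [Reg.edge])
    (enc := encodePair) (F := fun _ => id) (c := 3) (by simp) (by simp) (fun _ _ _ _ => trivial)
    (by simp) S.edges (fun e _ => (scans_teeNum (by simp) (by simp) e.1).seq (by simp)
      (fun _ _ _ _ => trivial) (scans_teeNum (by simp) (by simp) e.2)) v
    (Mem.stk {
      inp := encodeList encodePair S.edges ++
        (encodeList RawConstraint.encode R ++ encodeList (encodeList encodeNat) S.bags)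
      num := List.replicate S.n Sym.tick }) _ trivial rfl
  have num : ∀ k, Scans (fun _ => True) (Reg.inp : Reg d) [Reg.tmp]
      (teeNum .inp [.tmp] : Prog (Reg d) (PState d) Sym) id (encodeNat k) 4 := fun k =>
    (scans_teeNum (by simp) (by simp) k).mono (by simp)
  have list := fun l : List ℕ => scans_teeList_id (I := fun _ => True) (σ := PState d)
    (src := (Reg.inp : Reg d)) (ds := [Reg.tmp]) (c := 4) (by simp) (by simp)
    (fun _ _ _ _ => trivial) (by simp) l fun k _ => num k
  have lists := fun l : List (List ℕ) => scans_teeList_id (I := fun _ => True) (σ := PState d)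
    (src := (Reg.inp : Reg d)) (ds := [Reg.tmp]) (c := 4) (by simp) (by simp)
    (fun _ _ _ _ => trivial) (by simp) l fun k _ => list k
  have e3 := scans_teeList_id (I := fun _ => True) (σ := PState d)
    (src := (Reg.inp : Reg d)) (ds := [Reg.tmp]) (c := 4) (enc := RawConstraint.encode) (by simp)
    (by simp) (fun _ _ _ _ => trivial) (by simp) R (fun c _ =>
      (list c.1).seq (by simp) (fun _ _ _ _ => trivial) (lists c.2)) v
    (Mem.stk {
      inp := encodeList RawConstraint.encode R ++ encodeList (encodeList encodeNat) S.bags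
      num := List.replicate S.n Sym.tick
      edge := (S.edges.flatMap fun e => Sym.cons :: encodePair e).reverse }) _ trivial rfl
  have e4 := runs_move (src := (Reg.tmp : Reg d)) (dst := Reg.rel) (by simp) v
    (Mem.stk {
      inp := encodeList (encodeList encodeNat) S.bags
      num := List.replicate S.n Sym.tick
      edge := (S.edges.flatMap fun e => Sym.cons :: encodePair e).reverse
      tmp := (encodeList RawConstraint.encode R).reverse })
  simp only [foldl_id_eq] at e2
  refine ((e1.congr rfl ?_).block_cons ((e2.congr rfl ?_).block_cons ((e3.congr rfl ?_).block_cons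
    (e4.block_cons (runs_block_nil _ _))))).congr rfl ?_ |>.mono ?_
  · simp [feed]
  · simp [feed]
  · simp [feed]
  · simp [Mem.ofState]
  · simp [encodeList]
    lia

/-- Writes the output. -/
def writeOutput : Prog (Reg d) (PState d) Sym :=
  block [teeAll .inp [.bag], teeAll .bag [.out], push .out .nil, teeAll .edge [.out],
    push .out .mark, teeAll .num [.out]]

theorem runs_writeOutput (S : RawState) (v : PState d) :
    Runs writeOutput v (Mem.ofState d S []).stk v
      (Mem.stk { out := encodeNat S.n ++ encodeList encodePair S.edges ++
        encodeList (encodeList encodeNat) S.bags })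
      (6 * (encodeList (encodeList encodeNat) S.bags).length +
        3 * (encodeList encodePair S.edges).length + 3 * S.n + 15) := by
  have e1 := runs_move (src := Reg.inp) (dst := Reg.bag) (by simp) v (Mem.ofState d S []).stk
  have e2 := runs_move (src := Reg.bag) (dst := Reg.out) (by simp) v
    (Mem.stk { Mem.ofState d S [] with
      inp := []
      bag := (encodeList (encodeList encodeNat) S.bags).reverse })
  have e3 := runs_push Reg.out Sym.nil v (Mem.stk { Mem.ofState d S [] with
      inp := []
      out := encodeList (encodeList encodeNat) S.bags })
  have e4 := runs_move (src := Reg.edge) (dst := Reg.out) (by simp) v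
    (Mem.stk { Mem.ofState d S [] with
      inp := []
      out := Sym.nil :: encodeList (encodeList encodeNat) S.bags })
  have e5 := runs_push Reg.out Sym.mark v (Mem.stk { Mem.ofState d S [] with
      inp := []
      edge := []
      out := encodeList encodePair S.edges ++ encodeList (encodeList encodeNat) S.bags })
  have e6 := runs_move (src := Reg.num) (dst := Reg.out) (by simp) v
    (Mem.stk { Mem.ofState d S [] with
      inp := []
      edge := []
      out := Sym.mark ::
        (encodeList encodePair S.edges ++ encodeList (encodeList encodeNat) S.bags) })
  refine ((e1.congr rfl ?_).block_cons ((e2.congr rfl ?_).block_cons ((e3.congr rfl ?_).block_cons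
    ((e4.congr rfl ?_).block_cons ((e5.congr rfl ?_).block_cons (e6.block_cons
      (runs_block_nil _ _))))))).congr rfl ?_ |>.mono ?_
  · simp [Mem.ofState]
  · simp [Mem.ofState]
  · simp [Mem.ofState]
  · simp [Mem.ofState, encodeList]
  · simp [Mem.ofState]
  · simp [Mem.ofState, encodeNat]
  · simp [Mem.ofState, encodeList]
    lia

/-- The program for the reduction. -/
noncomputable def reduction {g : ℕ} (G : GadgetFamily d g) : Prog (Reg d) (PState d) Sym :=
  seq readInput (seq (processRels G) writeOutput)

end Prog

end SigmaRho

namespace SigmaRho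

/-- The encoding of a graph with bags, given by natural numbers. -/
def RawState.encode (S : RawState) : List Sym :=
  encodeNat S.n ++ encodeList encodePair S.edges ++ encodeList (encodeList encodeNat) S.bags

/-- The encoding of a graph with constraints and bags, given by natural numbers. -/
def RawState.encodeWith (S : RawState) (R : List RawConstraint) : List Sym :=
  encodeNat S.n ++ (encodeList encodePair S.edges ++
    (encodeList RawConstraint.encode R ++ encodeList (encodeList encodeNat) S.bags))

namespace Prog

variable {d : ℕ}

/-- A bound for the numbers and words that occur during the reduction of an input of length `L`. -/
def sizeBound (g L : ℕ) : ℕ := bagsBound (L + L) (L + g) (L + L * g) + (L + L * g) + L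

/-- A bound for the running time of the reduction on an input of length `L`. -/
def timeBound (d g L : ℕ) : ℕ :=
  7 * L + 10 + (L * (relCost d g * (sizeBound g L + 1) ^ 2 + 1) + 2) +
    (6 * sizeBound g L + 3 * ((L + L * ((g + d) * g)) * (2 * (L + L * g) + 1) + 1) +
      3 * (L + L * g) + 15)

theorem exists_polynomial_timeBound (d g : ℕ) :
    ∃ P : Polynomial ℕ, ∀ L, P.eval L = timeBound d g L := by
  let X : Polynomial ℕ := Polynomial.X
  let s : Polynomial ℕ := (X + X) * ((X + g) * (X + X * g + 1) + 2) + 1 + (X + X * g) + X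
  refine ⟨7 * X + 10 + (X * ((relCost d g : Polynomial ℕ) * (s + 1) ^ 2 + 1) + 2) +
    (6 * s + 3 * ((X + X * ((g + d) * g)) * (2 * (X + X * g) + 1) + 1) + 3 * (X + X * g) + 15),
    fun L => ?_⟩
  simp [timeBound, sizeBound, bagsBound, X, s]

theorem runs_reduction {g : ℕ} (G : GadgetFamily d g) {S : RawState} (hS : S.Decomposed)
    (R : List RawConstraint)
    (hR : ∀ c ∈ R, c.Valid d S.n ∧ ∃ B ∈ S.bags, ∀ v ∈ c.1, v ∈ B)
    (hS' : S.ReducesFrom g (R.foldl G.step S)) (v : PState d) :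
    ∃ v', Runs (reduction G) v (Mem.stk { inp := S.encodeWith R }) v'
      (Mem.stk { out := (R.foldl G.step S).encode })
      (timeBound d g (S.encodeWith R).length) := by
  generalize hL : (S.encodeWith R).length = L
  have hL' := hL
  simp only [RawState.encodeWith, List.length_append, length_encodeNat] at hL'
  have l1 := length_le_length_encodeList encodePair S.edges
  have l2 := length_le_length_encodeList RawConstraint.encode R
  have l3 := length_le_length_encodeList (encodeList encodeNat) S.bags
  have hRg : R.length * g ≤ L * g := Nat.mul_le_mul_right _ (by lia)
  have hRQ : R.length * ((g + d) * g) ≤ L * ((g + d) * g) := Nat.mul_le_mul_right _ (by lia)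
  have hw : ∀ B ∈ S.bags, B.length + g ≤ L + g := fun B hB => by
    have := length_le_length_encodeList encodeNat B
    have := length_enc_le_length_encodeList (encodeList encodeNat) hB
    lia
  have hn := foldl_step_n G R S
  have hX : bagsBound (L + L) (L + g) (L + L * g) ≤ sizeBound g L := by
    rw [sizeBound]
    lia
  have e1 := runs_readInput S R v
  obtain ⟨v₁, e2⟩ := runs_processRels G (k := L + L) (w := L + g) (n := L + L * g)
    (X := sizeBound g L) hw hX (by rw [sizeBound]; lia) R S (hS.reducesFrom_self g) hR
    (fun c hc => by
      have := length_enc_le_length_encodeList RawConstraint.encode hc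
      rw [sizeBound]
      lia) (by lia) (by lia) v
  have e3 := runs_writeOutput (R.foldl G.step S) v₁
  refine ⟨v₁, (e1.seq (e2.seq e3)).mono ?_⟩
  have b1 := (hS'.length_encode_bags_le (k := L + L) (w := L + g) (n := L + L * g)
    ((foldl_step_bags G R S).trans (by lia)) hw (by lia)).trans hX
  have b2 : (encodeList encodePair (R.foldl G.step S).edges).length ≤
      (L + L * ((g + d) * g)) * (2 * (L + L * g) + 1) + 1 := by
    refine (length_encodeList_le (b := 2 * (L + L * g)) fun e he => ?_).trans ?_
    · have := hS'.decomposed.edge_lt e he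
      rw [encodePair, List.length_append, length_encodeNat, length_encodeNat]
      lia
    · refine Nat.add_le_add_right (Nat.mul_le_mul_right _ ?_) _
      have := foldl_step_edges G R S
      lia
  have b3 : R.length * (relCost d g * (sizeBound g L + 1) ^ 2 + 1) ≤
      L * (relCost d g * (sizeBound g L + 1) ^ 2 + 1) := Nat.mul_le_mul_right _ (by lia)
  rw [RawState.encodeWith] at hL
  rw [hL, timeBound]
  lia

end Prog

end SigmaRho

namespace SigmaRho

/-! ### Encodings of instances, and the reduction -/

theorem encodeList_map {α β : Type*} (enc : β → List Sym) (f : α → β) (l : List α) :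
    encodeList enc (l.map f) = encodeList (fun a => enc (f a)) l := by
  simp [encodeList, List.flatMap_map]

theorem encodeList_rawEdges {n : ℕ} (E : List (Fin n × Fin n)) :
    encodeList encodePair (rawEdges E) = encodeList encodeEdge E :=
  encodeList_map _ _ _

theorem encodeList_map_val {n : ℕ} (l : List (Fin n)) :
    encodeList encodeNat (l.map Fin.val) = encodeList encodeVertex l :=
  encodeList_map _ _ _

theorem encodeList_rawBags {n : ℕ} (L : List (List (Fin n))) :
    encodeList (encodeList encodeNat) (rawBags L) = encodeList (encodeList encodeVertex) L := by
  rw [rawBags, encodeList_map]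
  simp only [encodeList_map_val]

theorem ConstraintData.raw_encode {n : ℕ} (c : ConstraintData n) :
    c.raw.encode = encodeConstraint c := by
  rw [RawConstraint.encode, ConstraintData.raw, encodeList_map_val, encodeList_rawBags,
    encodeConstraint]

theorem RelInstance.encodeWith_raw (I : RelInstance) :
    I.raw.encodeWith (I.rels.map ConstraintData.raw) = I.encode := by
  rw [RawState.encodeWith, RelInstance.encode, encodeList_map, RelInstance.raw,
    encodeList_rawEdges, encodeList_rawBags]
  simp only [ConstraintData.raw_encode, List.append_assoc]

theorem RelInstance.encode_eq {S : RawState} {J : PlainInstance} (h1 : J.n = S.n)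
    (h2 : rawEdges J.edges = S.edges) (h3 : rawBags J.bags = S.bags) : J.encode = S.encode := by
  rw [RawState.encode, PlainInstance.encode, ← h1, ← h2, ← h3, encodeList_rawEdges,
    encodeList_rawBags]

theorem exists_gadgetFamily {m : ℕ} (hm : 3 ≤ m) (s r : ZMod m) (hr : r ≠ 0) :
    ∃ c : ℕ, ∀ d, ∃ g ≤ c * 2 ^ d, ∃ G : GadgetFamily d g,
      ∀ T : Finset (Fin d → Bool), Realizes (r - s) r (G.adj T) (G.att T) T := by
  obtain ⟨c, hc⟩ := exists_relation_gadget hm s r hr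
  refine ⟨c, fun d => ?_⟩
  obtain ⟨g, hg, h⟩ := hc d
  choose adj att h using h
  exact ⟨g, hg, ⟨fun T => adj T, fun T => att T⟩, fun T => h T⟩

end SigmaRho

theorem mainTheorem5 (m : ℕ) (σ ρ : Set ℕ)
    (hσ : SigmaRho.IsResidueClass m σ) (hρ : SigmaRho.IsResidueClass m ρ)
    (hσρ : SigmaRho.IsDifficult σ ρ) :
    ∃ C : ℕ, ∀ d : ℕ, ∃ f : SigmaRho.RelInstanceOfArity d → SigmaRho.PlainInstance,
      SigmaRho.IsPolyTime f ∧
        ∀ I : SigmaRho.RelInstanceOfArity d,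
          (I.1.IsYes σ ρ ↔ (f I).IsYes σ ρ) ∧
            (f I).width ≤ I.1.width + (C : ℤ) * 2 ^ d := by
  open SigmaRho in
  obtain ⟨s, hs⟩ := hσ.exists_zmod
  obtain ⟨r, hr⟩ := hρ.exists_zmod
  obtain ⟨hm, hr0⟩ := hσρ.zmod hσ.1 hs hr
  obtain ⟨C, hC⟩ := exists_gadgetFamily hm s r hr0
  refine ⟨C, fun d => ?_⟩
  obtain ⟨g, hg, G, hG⟩ := hC d
  have hvalid : ∀ I : RelInstanceOfArity d, ∀ c ∈ I.1.rels.map ConstraintData.raw,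
      c.Valid d I.1.raw.n ∧ ∃ B ∈ I.1.raw.bags, ∀ v ∈ c.1, v ∈ B := by
    intro I c' hc'
    obtain ⟨c, hc, rfl⟩ := List.mem_map.1 hc'
    exact ⟨ConstraintData.raw_valid I.2 hc, I.1.exists_bag_scope hc⟩
  have hspec := fun I : RelInstanceOfArity d => foldl_step_spec G hG
    (I.1.rels.map ConstraintData.raw) (I.1.decomposed.reducesFrom_self g) (hvalid I)
  choose f hf₁ hf₂ hf₃ using fun I : RelInstanceOfArity d =>
    (hspec I).1.decomposed.exists_plainInstance
  refine ⟨f, ?_, fun I => ⟨?_, ?_⟩⟩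
  · obtain ⟨P, hP⟩ := Prog.exists_polynomial_timeBound d g
    refine Prog.nonempty_computableInPolyTime (Prog.reduction G) .inp .out
      ⟨0, fun _ => false, ∅, false, false⟩ P fun I => ?_
    obtain ⟨v', t, ht, hrun⟩ := Prog.runs_reduction G I.1.decomposed _ (hvalid I) (hspec I).1
      ⟨0, fun _ => false, ∅, false, false⟩
    rw [I.1.encodeWith_raw] at ht hrun
    refine ⟨v', t, by rwa [hP], ?_⟩
    have hnil : (fun _ => [] : Reg d → List Sym) = Mem.stk {} := by
      funext k
      cases k <;> rfl
    rw [hnil, Mem.update_inp, Mem.update_out, RelInstance.encode_eq (hf₁ I) (hf₂ I) (hf₃ I)]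
    exact hrun
  · rw [RelInstance.isYes_iff hs hr, PlainInstance.isYes_iff hs hr, (hspec I).2, hf₂, hf₁]
  · refine ((hspec I).1.width_le (hf₃ I)).trans ?_
    have : (g : ℤ) ≤ C * 2 ^ d := by exact_mod_cast hg
    lia
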